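/- Let $\Bbbk$ be a field. All categories, functors and module structures below are $\Bbbk$-linear. Let $\mathcal C$ be an abelian monoidal category, with $\otimes$ bilinear on morphisms. **Conventions.** A $\mathcal C$-module category is an abelian category $\mathcal M$ with a coherent, bilinear left action $\triangleright:\mathcal C\times\mathcal M\to\mathcal M$. An equivalence of $\mathcal C$-module categories is a linear equivalence which is a strong $\mathcal C$-module functor. An object $\ell\in\mathcal M$ is *closed* (*coclosed*) if $-\triangleright\ell:\mathcal C\to\mathcal M$ has a right (left) adjoint, written $[\ell,-]$ (resp. $\lceil\ell,-\rceil$). It is *$\mathcal C$-projective* (*$\mathcal C$-injective*) if $P\triangleright\ell$ is projective (injective) for every projective (injective) $P\in\mathcal C$. It is a *$\mathcal C$-generator* (*$\mathcal C$-cogenerator*) if every projective (injective) object of $\mathcal M$ is a direct summand of $P\triangleright\ell$ for some projective (injective) $P\in\mathcal C$. A *lax $\mathcal C$-module monad* is a monad $T$ on $\mathcal C$ whose underlying functor is a lax $\mathcal C$-module functor, with structure maps $x\triangleright Ty\to T(x\triangleright y)$, such that the unit and the multiplication are morphisms of lax $\mathcal C$-module functors. The Kleisli category $\mathcal C_T$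 is then a $\mathcal C$-module category (on objects as in $\mathcal C$). An *extended* $\mathcal C$-module structure on the Eilenberg–Moore category $\mathcal C^T$ is a bilinear $\mathcal C$-module structure $\blacktriangleright$ together with a strong $\mathcal C$-module structure on the canonical functor $\mathcal C_T\to\mathcal C^T$, such that for all $x\in\mathcal C$ and $(m,\nabla)\in\mathcal C^T$ the canonical morphism $T(x\triangleright m)\cong x\blacktriangleright Tm\to x\blacktriangleright m$ is the coequaliser in $\mathcal C^T$ of the two morphisms $T(x\triangleright Tm)\rightrightarrows T(x\triangleright m)$ given by $T(x\triangleright\nabla)$ and by the lax structure of $T$ followed by its multiplication (the Linton coequaliser). Oplax $\mathcal C$-module comonads $S$, the co-Kleisli category and extended structures on the category of coalgebras $\mathcal C^S$ (given by Linton equalisers) are defined dually. **Part 1.** Suppose that $\mathcal C$ has enough projectives and that $x\otimes-$ is right exact for every $x\in\mathcal C$. Call $(\mathcal M,\ell)$ a *projective pair* if $\mathcal M$ is an abelian $\mathcal C$-module category with enough projectives such that $x\triangleright-$ is right exact for every $x\in\mathcal C$, and $\ell\in\mathcal M$ is a closed $\mathcal C$-projective $\mathcal C$-generator. 1. For every projective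 pair $(\mathcal M,\ell)$ the monad $T=[\ell,-\triangleright\ell]$, with the lax $\mathcal C$-module structure induced by the adjunction, is right exact; $\mathcal C^T$ has an extended $\mathcal C$-module structure, and for every such structure $\mathcal M\simeq\mathcal C^{T}$ as $\mathcal C$-module categories. 2. For every right exact lax $\mathcal C$-module monad $T$ on $\mathcal C$, the category $\mathcal C^T$ has an extended $\mathcal C$-module structure, and for every such structure $(\mathcal C^T,T1)$ is a projective pair. 3. Identify $(\mathcal M,\ell)$ with $(\mathcal N,\ell')$ if $\mathcal M\simeq\mathcal N$ as $\mathcal C$-module categories, and identify right exact lax $\mathcal C$-module monads $T$ and $S$ on $\mathcal C$ if $\mathcal C^T\simeq\mathcal C^S$ as $\mathcal C$-module categories (with the extended structures). These are equivalence relations, and $(\mathcal M,\ell)\mapsto[\ell,-\triangleright\ell]$ and $T\mapsto(\mathcal C^T,T1)$ induce mutually inverse bijections between the classes of projective pairs and the classes of right exact lax $\mathcal C$-module monads on $\mathcal C$. **Part 2.** Suppose that $\mathcal C$ has enough injectives and that $x\otimes-$ is left exact for every $x\in\mathcal C$. Call $(\mathcal M,\ell)$ an *injective pair* if $\mathcal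 M$ is an abelian $\mathcal C$-module category with enough injectives such that $x\triangleright-$ is left exact for every $x\in\mathcal C$, and $\ell\in\mathcal M$ is a coclosed $\mathcal C$-injective $\mathcal C$-cogenerator. 1. For every injective pair $(\mathcal M,\ell)$ the comonad $S=\lceil\ell,-\triangleright\ell\rceil$, with the oplax $\mathcal C$-module structure induced by the adjunction, is left exact; $\mathcal C^S$ has an extended $\mathcal C$-module structure, and for every such structure $\mathcal M\simeq\mathcal C^{S}$ as $\mathcal C$-module categories. 2. For every left exact oplax $\mathcal C$-module comonad $S$ on $\mathcal C$, the category $\mathcal C^S$ of coalgebras has an extended $\mathcal C$-module structure, and for every such structure $(\mathcal C^S,S1)$ is an injective pair. 3. With the identifications $(\mathcal M,\ell)\sim(\mathcal N,\ell')$ if $\mathcal M\simeq\mathcal N$, and $S\sim G$ if $\mathcal C^S\simeq\mathcal C^G$, as $\mathcal C$-module categories (these are equivalence relations), the assignments $(\mathcal M,\ell)\mapsto\lceil\ell,-\triangleright\ell\rceil$ and $S\mapsto(\mathcal C^S,S1)$ induce mutually inverse bijections between the classes of injective pairs and the classes of left exact oplax $\mathcal C$-module comonads on $\mathcal C$. 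-/

import Mathlib

open CategoryTheory CategoryTheory.Limits CategoryTheory.MonoidalCategory
open scoped CategoryTheory.MonoidalCategory.MonoidalLeftAction

universe w₂' w₁' w₂ w₁ v u

namespace ModuleReconstruction

section Actions

variable (k : Type*) [Field k] (C : Type*) [Category* C] [Preadditive C] [Linear k C]
  [MonoidalCategory C]

/-- The action bifunctor is `k`-bilinear on morphisms. -/
class BilinearAction (M : Type*) [Category* M] [Preadditive M] [Linear k M]
    [MonoidalLeftAction C M] : Prop where
  add_actionHomLeft {c c' : C} (f g : c ⟶ c') (m : M) : (f + g) ⊵ₗ m = f ⊵ₗ m + g ⊵ₗ m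
  smul_actionHomLeft {c c' : C} (r : k) (f : c ⟶ c') (m : M) : (r • f) ⊵ₗ m = r • (f ⊵ₗ m)
  actionHomRight_add (c : C) {m m' : M} (f g : m ⟶ m') : c ⊴ₗ (f + g) = c ⊴ₗ f + c ⊴ₗ g
  actionHomRight_smul (c : C) {m m' : M} (r : k) (f : m ⟶ m') : c ⊴ₗ (r • f) = r • (c ⊴ₗ f)

end Actions

section Monads

variable (C : Type*) [Category* C] [MonoidalCategory C]
variable {D : Type*} [Category* D] [MonoidalLeftAction C D]

/-- A lax `C`-module monad. -/
class LaxModuleMonad (T : Monad D) extends T.toFunctor.LaxLeftLinear C where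
  actionHomRight_η_comp_μₗ (c : C) (d : D) :
    c ⊴ₗ T.η.app d ≫ μₗ c d = T.η.app (c ⊙ₗ d)
  actionHomRight_μ_comp_μₗ (c : C) (d : D) :
    c ⊴ₗ T.μ.app d ≫ μₗ c d = μₗ c (T.obj d) ≫ T.map (μₗ c d) ≫ T.μ.app (c ⊙ₗ d)

/-- An oplax `C`-module comonad. -/
class OplaxModuleComonad (S : Comonad D) extends S.toFunctor.OplaxLeftLinear C where
  δₗ_comp_actionHomRight_ε (c : C) (d : D) :
    δₗ c d ≫ c ⊴ₗ S.ε.app d = S.ε.app (c ⊙ₗ d)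
  δₗ_comp_actionHomRight_δ (c : C) (d : D) :
    δₗ c d ≫ c ⊴ₗ S.δ.app d = S.δ.app (c ⊙ₗ d) ≫ S.map (δₗ c d) ≫ δₗ c (S.obj d)

variable {C}

instance kleisliActionStruct (T : Monad D) [LaxModuleMonad C T] :
    MonoidalLeftActionStruct C (Kleisli T) where
  actionObj c X := .mk T (c ⊙ₗ X.of)
  actionHomLeft f X := (Kleisli.Adjunction.toKleisli T).map (f ⊵ₗ X.of)
  actionHomRight c _ Y f := .mk (c ⊴ₗ f.of ≫ Functor.LaxLeftLinear.μₗ T.toFunctor c Y.of)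
  actionAssocIso c c' X := (Kleisli.Adjunction.toKleisli T).mapIso (αₗ c c' X.of)
  actionUnitIso X := (Kleisli.Adjunction.toKleisli T).mapIso (λₗ[C] X.of)


section

variable (T : Monad D)

theorem toKleisli_map_comp_of {X Y : D} {Z : Kleisli T} (f : X ⟶ Y)
    (g : (Kleisli.Adjunction.toKleisli T).obj Y ⟶ Z) :
    ((Kleisli.Adjunction.toKleisli T).map f ≫ g).of = f ≫ g.of := by
  have h := T.η.naturality_assoc g.of (T.μ.app Z.of)
  rw [T.left_unit] at h
  change (f ≫ T.η.app Y) ≫ T.map g.of ≫ T.μ.app Z.of = f ≫ g.of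
  rw [Category.assoc]
  exact congrArg (f ≫ ·) (h.symm.trans (Category.comp_id _))

theorem comp_toKleisli_map_of {X Y : D} {Z : Kleisli T}
    (g : Z ⟶ (Kleisli.Adjunction.toKleisli T).obj X) (f : X ⟶ Y) :
    (g ≫ (Kleisli.Adjunction.toKleisli T).map f).of = g.of ≫ T.map f := by
  change g.of ≫ T.map (f ≫ T.η.app Y) ≫ T.μ.app Y = g.of ≫ T.map f
  refine congrArg (g.of ≫ ·) ?_
  refine (congrArg (· ≫ T.μ.app Y) (T.map_comp f (T.η.app Y))).trans ?_
  exact (Category.assoc _ _ _).trans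
    ((congrArg (T.map f ≫ ·) (T.right_unit Y)).trans (Category.comp_id _))

variable [LaxModuleMonad C T]

theorem kleisli_actionHomRight_toKleisli_map (c : C) {X Y : D} (f : X ⟶ Y) :
    c ⊴ₗ (Kleisli.Adjunction.toKleisli T).map f =
      (Kleisli.Adjunction.toKleisli T).map (c ⊴ₗ f) := by
  apply Kleisli.hom_ext
  change c ⊴ₗ (f ≫ T.η.app Y) ≫ Functor.LaxLeftLinear.μₗ T.toFunctor c Y =
    c ⊴ₗ f ≫ T.η.app (c ⊙ₗ Y)
  rw [MonoidalLeftAction.actionHomRight_comp, Category.assoc,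
    LaxModuleMonad.actionHomRight_η_comp_μₗ]

/-- The `C`-module structure on the Kleisli category of a lax `C`-module monad; it acts on objects
as on `D`, and `c ▷ f` is `c ▷ X ⟶ c ▷ T Y ⟶ T (c ▷ Y)` for `f : X ⟶ T Y`. -/
instance kleisliAction : MonoidalLeftAction C (Kleisli T) where
  actionHom_def _ _ := rfl
  actionHomRight_id c X := by
    have h := kleisli_actionHomRight_toKleisli_map T c (𝟙 X.of)
    rw [MonoidalLeftAction.actionHomRight_id] at h
    exact (congrArg (c ⊴ₗ ·) ((Kleisli.Adjunction.toKleisli T).map_id X.of)).symm.trans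
      (h.trans ((Kleisli.Adjunction.toKleisli T).map_id (c ⊙ₗ X.of)))
  id_actionHomLeft c X := by
    change (Kleisli.Adjunction.toKleisli T).map (𝟙 c ⊵ₗ X.of) = _
    rw [MonoidalLeftAction.id_actionHomLeft]
    exact (Kleisli.Adjunction.toKleisli T).map_id (c ⊙ₗ X.of)
  actionHom_comp {c c' c'' X X' X''} f₁ f₂ g₁ g₂ := by
    apply Kleisli.hom_ext
    have hμ := LaxModuleMonad.actionHomRight_μ_comp_μₗ (T := T) c'' X''.of
    have e1 := toKleisli_map_comp_of T (Z := c'' ⊙ₗ X'') ((f₁ ≫ f₂) ⊵ₗ X.of) (c'' ⊴ₗ (g₁ ≫ g₂))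
    have e2 := toKleisli_map_comp_of T (Z := c' ⊙ₗ X') (f₁ ⊵ₗ X.of) (c' ⊴ₗ g₁)
    have e3 := toKleisli_map_comp_of T (Z := c'' ⊙ₗ X'') (f₂ ⊵ₗ X'.of) (c'' ⊴ₗ g₂)
    refine e1.trans ?_
    change _ = (_ : Kleisli.Hom _ _).of ≫ T.map (_ : Kleisli.Hom _ _).of ≫ T.μ.app _
    refine Eq.trans ?_ (congrArg₂ (fun a b => a ≫ T.map b ≫ T.μ.app (c'' ⊙ₗ X''.of)) e2 e3).symm
    change (f₁ ≫ f₂) ⊵ₗ X.of ≫ c'' ⊴ₗ (g₁.of ≫ T.map g₂.of ≫ T.μ.app X''.of) ≫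
      Functor.LaxLeftLinear.μₗ T.toFunctor c'' X''.of =
      (f₁ ⊵ₗ X.of ≫ c' ⊴ₗ g₁.of ≫ Functor.LaxLeftLinear.μₗ T.toFunctor c' X'.of) ≫
       T.map (f₂ ⊵ₗ X'.of ≫ c'' ⊴ₗ g₂.of ≫ Functor.LaxLeftLinear.μₗ T.toFunctor c'' X''.of) ≫
        T.μ.app (c'' ⊙ₗ X''.of)
    simp only [MonoidalLeftAction.actionHomRight_comp, MonoidalLeftAction.comp_actionHomLeft,
      Category.assoc, T.map_comp, hμ]
    rw [← Functor.LaxLeftLinear.μₗ_naturality_left_assoc,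
      ← Functor.LaxLeftLinear.μₗ_naturality_right_assoc, MonoidalLeftAction.action_exchange_assoc]
  actionAssocIso_hom_naturality {c₁ c₂ c₃ c₄ X Y} f g h := by
    let m := fun (c : C) (d : D) => Functor.LaxLeftLinear.μₗ T.toFunctor c d
    apply Kleisli.hom_ext
    have e1 := comp_toKleisli_map_of T (Z := (c₁ ⊗ c₃) ⊙ₗ X) ((f ⊗ₘ g) ⊙ₗₘ h) (αₗ c₂ c₄ Y.of).hom
    have e2 := toKleisli_map_comp_of T (αₗ c₁ c₃ X.of).hom (Z := c₂ ⊙ₗ c₄ ⊙ₗ Y) (f ⊙ₗₘ g ⊙ₗₘ h)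
    have e3 := toKleisli_map_comp_of T ((f ⊗ₘ g) ⊵ₗ X.of) (Z := (c₂ ⊗ c₄) ⊙ₗ Y) ((c₂ ⊗ c₄) ⊴ₗ h)
    have e4 := toKleisli_map_comp_of T (g ⊵ₗ X.of) (Z := c₄ ⊙ₗ Y) (c₄ ⊴ₗ h)
    have e5 := toKleisli_map_comp_of T (f ⊵ₗ (c₃ ⊙ₗ X.of)) (Z := c₂ ⊙ₗ c₄ ⊙ₗ Y)
      (c₂ ⊴ₗ (g ⊙ₗₘ h))
    refine e1.trans (Eq.trans ?_ e2.symm)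
    refine (congrArg (· ≫ T.map (αₗ c₂ c₄ Y.of).hom) e3).trans
      (Eq.trans ?_ (congrArg ((αₗ c₁ c₃ X.of).hom ≫ ·) e5).symm)
    refine Eq.trans ?_ (congrArg (fun t => (αₗ c₁ c₃ X.of).hom ≫ f ⊵ₗ (c₃ ⊙ₗ X.of) ≫
      c₂ ⊴ₗ t ≫ m c₂ (c₄ ⊙ₗ Y.of)) e4).symm
    change ((f ⊗ₘ g) ⊵ₗ X.of ≫ (c₂ ⊗ c₄) ⊴ₗ h.of ≫ m (c₂ ⊗ c₄) Y.of) ≫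
        T.map (αₗ c₂ c₄ Y.of).hom =
      (αₗ c₁ c₃ X.of).hom ≫ f ⊵ₗ (c₃ ⊙ₗ X.of) ≫ c₂ ⊴ₗ (g ⊵ₗ X.of ≫ c₄ ⊴ₗ h.of ≫ m c₄ Y.of) ≫
        m c₂ (c₄ ⊙ₗ Y.of)
    have a1 := Functor.LaxLeftLinear.μₗ_associativity T.toFunctor c₂ c₄ Y.of
    have a2 := MonoidalLeftAction.actionAssocIso_hom_naturality f g h.of
    rw [MonoidalLeftAction.actionHom_def, MonoidalLeftAction.actionHom_def,
      MonoidalLeftAction.actionHom_def] at a2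
    simp only [Category.assoc] at a2 ⊢
    refine (congrArg (fun t => (f ⊗ₘ g) ⊵ₗ X.of ≫ (c₂ ⊗ c₄) ⊴ₗ h.of ≫ t) a1).trans ?_
    simp only [MonoidalLeftAction.actionHomRight_comp, Category.assoc] at a2 ⊢
    simpa only [Category.assoc] using
      congrArg (· ≫ c₂ ⊴ₗ m c₄ Y.of ≫ m c₂ (c₄ ⊙ₗ Y.of)) a2
  actionUnitIso_hom_naturality {X Y} f := by
    apply Kleisli.hom_ext
    have e1 := toKleisli_map_comp_of T (λₗ[C] X.of).hom f
    have e2 := comp_toKleisli_map_of T (Z := 𝟙_ C ⊙ₗ X) (𝟙_ C ⊴ₗ f) (λₗ[C] Y.of).hom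
    refine e1.trans (Eq.trans ?_ e2.symm)
    change _ = (𝟙_ C ⊴ₗ f.of ≫ Functor.LaxLeftLinear.μₗ T.toFunctor (𝟙_ C) Y.of) ≫
      T.map (λₗ[C] Y.of).hom
    have h := Functor.LaxLeftLinear.μₗ_unitality T.toFunctor (C := C) Y.of
    rw [Category.assoc, MonoidalLeftAction.actionUnitIso_hom_naturality]
    exact congrArg (𝟙_ C ⊴ₗ f.of ≫ ·) h
  whiskerLeft_actionHomLeft c c' c'' f X := by
    let J := Kleisli.Adjunction.toKleisli T
    refine (congrArg J.map (MonoidalLeftAction.whiskerLeft_actionHomLeft c f X.of)).trans ?_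
    refine (J.map_comp _ _).trans (congrArg (J.map _ ≫ ·) ((J.map_comp _ _).trans ?_))
    exact congrArg (· ≫ J.map _) (kleisli_actionHomRight_toKleisli_map T c (f ⊵ₗ X.of)).symm
  whiskerRight_actionHomLeft {c c'} c'' f X := by
    let J := Kleisli.Adjunction.toKleisli T
    refine (congrArg J.map (MonoidalLeftAction.whiskerRight_actionHomLeft c'' f X.of)).trans ?_
    exact (J.map_comp _ _).trans (congrArg (J.map _ ≫ ·) (J.map_comp _ _))
  associator_actionHom c₁ c₂ c₃ X := by
    let J := Kleisli.Adjunction.toKleisli T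
    refine Eq.trans ?_ ((congrArg J.map
      (MonoidalLeftAction.associator_actionHom c₁ c₂ c₃ X.of)).trans (J.map_comp _ _))
    refine Eq.trans ?_ (J.map_comp _ _).symm
    refine congrArg (J.map _ ≫ ·) (Eq.trans ?_ (J.map_comp _ _).symm)
    exact congrArg (J.map _ ≫ ·) (kleisli_actionHomRight_toKleisli_map T c₁ (αₗ c₂ c₃ X.of).hom)
  rightUnitor_actionHom c X := by
    let J := Kleisli.Adjunction.toKleisli T
    refine (congrArg J.map (MonoidalLeftAction.rightUnitor_actionHom c X.of)).trans ?_
    refine (J.map_comp _ _).trans (congrArg (J.map _ ≫ ·) ?_)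
    exact (kleisli_actionHomRight_toKleisli_map T c (λₗ[C] X.of).hom).symm
  leftUnitor_actionHom c X := by
    let J := Kleisli.Adjunction.toKleisli T
    refine (congrArg J.map (MonoidalLeftAction.leftUnitor_actionHom c X.of)).trans ?_
    exact J.map_comp _ _

end

instance cokleisliActionStruct (S : Comonad D) [OplaxModuleComonad C S] :
    MonoidalLeftActionStruct C (Cokleisli S) where
  actionObj c X := .mk S (c ⊙ₗ X.of)
  actionHomLeft f X := (Cokleisli.Adjunction.toCokleisli S).map (f ⊵ₗ X.of)
  actionHomRight c X _ f := .mk (Functor.OplaxLeftLinear.δₗ S.toFunctor c X.of ≫ c ⊴ₗ f.of)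
  actionAssocIso c c' X := (Cokleisli.Adjunction.toCokleisli S).mapIso (αₗ c c' X.of)
  actionUnitIso X := (Cokleisli.Adjunction.toCokleisli S).mapIso (λₗ[C] X.of)

section

variable (S : Comonad D)

theorem toCokleisli_map_comp_of {X Y : D} {Z : Cokleisli S} (f : X ⟶ Y)
    (g : (Cokleisli.Adjunction.toCokleisli S).obj Y ⟶ Z) :
    ((Cokleisli.Adjunction.toCokleisli S).map f ≫ g).of = S.map f ≫ g.of := by
  change S.δ.app X ≫ S.map (S.ε.app X ≫ f) ≫ g.of = S.map f ≫ g.of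
  refine (congrArg (fun t => S.δ.app X ≫ t ≫ g.of) (S.map_comp (S.ε.app X) f)).trans ?_
  refine (congrArg (S.δ.app X ≫ ·) (Category.assoc _ _ _)).trans ?_
  refine (Category.assoc _ _ _).symm.trans ?_
  exact (congrArg (· ≫ S.map f ≫ g.of) (S.right_counit X)).trans (Category.id_comp _)

theorem comp_toCokleisli_map_of {X Y : D} {Z : Cokleisli S}
    (g : Z ⟶ (Cokleisli.Adjunction.toCokleisli S).obj X) (f : X ⟶ Y) :
    (g ≫ (Cokleisli.Adjunction.toCokleisli S).map f).of = g.of ≫ f := by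
  have h := S.ε.naturality g.of
  change S.δ.app Z.of ≫ S.map g.of ≫ S.ε.app X ≫ f = g.of ≫ f
  refine (congrArg (S.δ.app Z.of ≫ ·) (Category.assoc _ _ _).symm).trans ?_
  refine (congrArg (fun t => S.δ.app Z.of ≫ t ≫ f) h).trans ?_
  refine (congrArg (S.δ.app Z.of ≫ ·) (Category.assoc _ _ _)).trans ?_
  refine (Category.assoc _ _ _).symm.trans ?_
  exact (congrArg (· ≫ g.of ≫ f) (S.left_counit Z.of)).trans (Category.id_comp _)

variable [OplaxModuleComonad C S]

theorem cokleisli_actionHomRight_toCokleisli_map (c : C) {X Y : D} (f : X ⟶ Y) :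
    c ⊴ₗ (Cokleisli.Adjunction.toCokleisli S).map f =
      (Cokleisli.Adjunction.toCokleisli S).map (c ⊴ₗ f) := by
  apply Cokleisli.hom_ext
  change Functor.OplaxLeftLinear.δₗ S.toFunctor c X ≫ c ⊴ₗ (S.ε.app X ≫ f) =
    S.ε.app (c ⊙ₗ X) ≫ c ⊴ₗ f
  rw [MonoidalLeftAction.actionHomRight_comp, ← Category.assoc,
    OplaxModuleComonad.δₗ_comp_actionHomRight_ε]

/-- The `C`-module structure on the co-Kleisli category of an oplax `C`-module comonad; it acts on
objects as on `D`, and `c ▷ f` is `S (c ▷ X) ⟶ c ▷ S X ⟶ c ▷ Y` for `f : S X ⟶ Y`. -/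
instance cokleisliAction : MonoidalLeftAction C (Cokleisli S) where
  actionHom_def _ _ := rfl
  actionHomRight_id c X := by
    have h := cokleisli_actionHomRight_toCokleisli_map S c (𝟙 X.of)
    rw [MonoidalLeftAction.actionHomRight_id] at h
    exact (congrArg (c ⊴ₗ ·) ((Cokleisli.Adjunction.toCokleisli S).map_id X.of)).symm.trans
      (h.trans ((Cokleisli.Adjunction.toCokleisli S).map_id (c ⊙ₗ X.of)))
  id_actionHomLeft c X := by
    change (Cokleisli.Adjunction.toCokleisli S).map (𝟙 c ⊵ₗ X.of) = _
    rw [MonoidalLeftAction.id_actionHomLeft]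
    exact (Cokleisli.Adjunction.toCokleisli S).map_id (c ⊙ₗ X.of)
  actionHom_comp {c c' c'' X X' X''} f₁ f₂ g₁ g₂ := by
    apply Cokleisli.hom_ext
    have hδ := OplaxModuleComonad.δₗ_comp_actionHomRight_δ (S := S) c' X.of
    have e1 := toCokleisli_map_comp_of S (Z := c'' ⊙ₗ X'') ((f₁ ≫ f₂) ⊵ₗ X.of)
      (c'' ⊴ₗ (g₁ ≫ g₂))
    have e2 := toCokleisli_map_comp_of S (Z := c' ⊙ₗ X') (f₁ ⊵ₗ X.of) (c' ⊴ₗ g₁)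
    have e3 := toCokleisli_map_comp_of S (Z := c'' ⊙ₗ X'') (f₂ ⊵ₗ X'.of) (c'' ⊴ₗ g₂)
    refine e1.trans ?_
    change _ = S.δ.app _ ≫ S.map (_ : Cokleisli.Hom _ _).of ≫ (_ : Cokleisli.Hom _ _).of
    refine Eq.trans ?_ (congrArg₂ (fun a b => S.δ.app (c ⊙ₗ X.of) ≫ S.map a ≫ b) e2 e3).symm
    change S.map ((f₁ ≫ f₂) ⊵ₗ X.of) ≫ Functor.OplaxLeftLinear.δₗ S.toFunctor c'' X.of ≫
        c'' ⊴ₗ (S.δ.app X.of ≫ S.map g₁.of ≫ g₂.of) =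
      S.δ.app (c ⊙ₗ X.of) ≫ S.map (S.map (f₁ ⊵ₗ X.of) ≫
        Functor.OplaxLeftLinear.δₗ S.toFunctor c' X.of ≫ c' ⊴ₗ g₁.of) ≫
        S.map (f₂ ⊵ₗ X'.of) ≫ Functor.OplaxLeftLinear.δₗ S.toFunctor c'' X'.of ≫ c'' ⊴ₗ g₂.of
    have n : S.map (f₁ ⊵ₗ X.of) ≫ S.δ.app (c' ⊙ₗ X.of) =
      S.δ.app (c ⊙ₗ X.of) ≫ S.map (S.map (f₁ ⊵ₗ X.of)) := S.δ.naturality _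
    simp only [MonoidalLeftAction.actionHomRight_comp, MonoidalLeftAction.comp_actionHomLeft,
      Category.assoc, S.map_comp]
    have r₁ : S.map (f₂ ⊵ₗ X'.of) ≫ Functor.OplaxLeftLinear.δₗ S.toFunctor c'' X'.of =
      Functor.OplaxLeftLinear.δₗ S.toFunctor c' X'.of ≫ f₂ ⊵ₗ S.obj X'.of :=
      Functor.OplaxLeftLinear.δₗ_naturality_left S.toFunctor f₂ X'.of
    have r₂ : S.map (c' ⊴ₗ g₁.of) ≫ Functor.OplaxLeftLinear.δₗ S.toFunctor c' X'.of =
      Functor.OplaxLeftLinear.δₗ S.toFunctor c' (S.obj X.of) ≫ c' ⊴ₗ S.map g₁.of :=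
      Functor.OplaxLeftLinear.δₗ_naturality_right S.toFunctor c' g₁.of
    rw [Functor.OplaxLeftLinear.δₗ_naturality_left_assoc,
      Functor.OplaxLeftLinear.δₗ_naturality_left_assoc, reassoc_of% r₁, reassoc_of% r₂,
      ← reassoc_of% n, ← reassoc_of% hδ, Functor.OplaxLeftLinear.δₗ_naturality_left_assoc,
      MonoidalLeftAction.action_exchange_assoc, MonoidalLeftAction.action_exchange_assoc]
  actionAssocIso_hom_naturality {c₁ c₂ c₃ c₄ X Y} f g h := by
    let m := fun (c : C) (d : D) => Functor.OplaxLeftLinear.δₗ S.toFunctor c d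
    apply Cokleisli.hom_ext
    have e1 := comp_toCokleisli_map_of S (Z := (c₁ ⊗ c₃) ⊙ₗ X) ((f ⊗ₘ g) ⊙ₗₘ h)
      (αₗ c₂ c₄ Y.of).hom
    have e2 := toCokleisli_map_comp_of S (αₗ c₁ c₃ X.of).hom (Z := c₂ ⊙ₗ c₄ ⊙ₗ Y)
      (f ⊙ₗₘ g ⊙ₗₘ h)
    have e3 := toCokleisli_map_comp_of S ((f ⊗ₘ g) ⊵ₗ X.of) (Z := (c₂ ⊗ c₄) ⊙ₗ Y)
      ((c₂ ⊗ c₄) ⊴ₗ h)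
    have e4 := toCokleisli_map_comp_of S (g ⊵ₗ X.of) (Z := c₄ ⊙ₗ Y) (c₄ ⊴ₗ h)
    have e5 := toCokleisli_map_comp_of S (f ⊵ₗ (c₃ ⊙ₗ X.of)) (Z := c₂ ⊙ₗ c₄ ⊙ₗ Y)
      (c₂ ⊴ₗ (g ⊙ₗₘ h))
    refine e1.trans (Eq.trans ?_ e2.symm)
    refine (congrArg (· ≫ (αₗ c₂ c₄ Y.of).hom) e3).trans
      (Eq.trans ?_ (congrArg (S.map (αₗ c₁ c₃ X.of).hom ≫ ·) e5).symm)
    refine Eq.trans ?_ (congrArg (fun t => S.map (αₗ c₁ c₃ X.of).hom ≫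
      S.map (f ⊵ₗ (c₃ ⊙ₗ X.of)) ≫ m c₂ (c₃ ⊙ₗ X.of) ≫ c₂ ⊴ₗ t) e4).symm
    change (S.map ((f ⊗ₘ g) ⊵ₗ X.of) ≫ m (c₂ ⊗ c₄) X.of ≫ (c₂ ⊗ c₄) ⊴ₗ h.of) ≫
        (αₗ c₂ c₄ Y.of).hom =
      S.map (αₗ c₁ c₃ X.of).hom ≫ S.map (f ⊵ₗ (c₃ ⊙ₗ X.of)) ≫ m c₂ (c₃ ⊙ₗ X.of) ≫
        c₂ ⊴ₗ (S.map (g ⊵ₗ X.of) ≫ m c₄ X.of ≫ c₄ ⊴ₗ h.of)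
    have a1 : m (c₁ ⊗ c₃) X.of ≫ (αₗ c₁ c₃ (S.obj X.of)).hom = S.map (αₗ c₁ c₃ X.of).hom ≫
        m c₁ (c₃ ⊙ₗ X.of) ≫ c₁ ⊴ₗ m c₃ X.of :=
      Functor.OplaxLeftLinear.δₗ_associativity S.toFunctor c₁ c₃ X.of
    have a2 := MonoidalLeftAction.actionAssocIso_hom_naturality f g h.of
    have a3 {c c' : C} (t : c ⟶ c') (d : D) : S.map (t ⊵ₗ d) ≫ m c' d = m c d ≫ t ⊵ₗ S.obj d :=
      Functor.OplaxLeftLinear.δₗ_naturality_left S.toFunctor t d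
    rw [MonoidalLeftAction.actionHom_def, MonoidalLeftAction.actionHom_def,
      MonoidalLeftAction.actionHom_def] at a2
    have a5 := MonoidalLeftAction.action_exchange f (m c₃ X.of)
    simp only [Category.assoc] at a2
    simp only [Category.assoc, reassoc_of% a3]
    rw [a2, reassoc_of% a1, reassoc_of% a5,
      MonoidalLeftAction.actionHomRight_comp c₂ (m c₃ X.of)]
  actionUnitIso_hom_naturality {X Y} f := by
    apply Cokleisli.hom_ext
    have e1 := toCokleisli_map_comp_of S (λₗ[C] X.of).hom f
    have e2 := comp_toCokleisli_map_of S (Z := 𝟙_ C ⊙ₗ X) (𝟙_ C ⊴ₗ f) (λₗ[C] Y.of).hom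
    refine e1.trans (Eq.trans ?_ e2.symm)
    change _ = (Functor.OplaxLeftLinear.δₗ S.toFunctor (𝟙_ C) X.of ≫ 𝟙_ C ⊴ₗ f.of) ≫
      (λₗ[C] Y.of).hom
    have h := Functor.OplaxLeftLinear.δₗ_unitality_hom S.toFunctor (C := C) X.of
    rw [Category.assoc, ← MonoidalLeftAction.actionUnitIso_hom_naturality]
    exact (congrArg (· ≫ f.of) h.symm).trans (Category.assoc _ _ _)
  whiskerLeft_actionHomLeft c c' c'' f X := by
    let J := Cokleisli.Adjunction.toCokleisli S
    refine (congrArg J.map (MonoidalLeftAction.whiskerLeft_actionHomLeft c f X.of)).trans ?_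
    refine (J.map_comp _ _).trans (congrArg (J.map _ ≫ ·) ((J.map_comp _ _).trans ?_))
    exact congrArg (· ≫ J.map _) (cokleisli_actionHomRight_toCokleisli_map S c (f ⊵ₗ X.of)).symm
  whiskerRight_actionHomLeft {c c'} c'' f X := by
    let J := Cokleisli.Adjunction.toCokleisli S
    refine (congrArg J.map (MonoidalLeftAction.whiskerRight_actionHomLeft c'' f X.of)).trans ?_
    exact (J.map_comp _ _).trans (congrArg (J.map _ ≫ ·) (J.map_comp _ _))
  associator_actionHom c₁ c₂ c₃ X := by
    let J := Cokleisli.Adjunction.toCokleisli S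
    refine Eq.trans ?_ ((congrArg J.map
      (MonoidalLeftAction.associator_actionHom c₁ c₂ c₃ X.of)).trans (J.map_comp _ _))
    refine Eq.trans ?_ (J.map_comp _ _).symm
    refine congrArg (J.map _ ≫ ·) (Eq.trans ?_ (J.map_comp _ _).symm)
    exact congrArg (J.map _ ≫ ·) (cokleisli_actionHomRight_toCokleisli_map S c₁ (αₗ c₂ c₃ X.of).hom)
  rightUnitor_actionHom c X := by
    let J := Cokleisli.Adjunction.toCokleisli S
    refine (congrArg J.map (MonoidalLeftAction.rightUnitor_actionHom c X.of)).trans ?_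
    refine (J.map_comp _ _).trans (congrArg (J.map _ ≫ ·) ?_)
    exact (cokleisli_actionHomRight_toCokleisli_map S c (λₗ[C] X.of).hom).symm
  leftUnitor_actionHom c X := by
    let J := Cokleisli.Adjunction.toCokleisli S
    refine (congrArg J.map (MonoidalLeftAction.leftUnitor_actionHom c X.of)).trans ?_
    exact J.map_comp _ _

end

end Monads

section EM

variable {k : Type*} [Field k] {D : Type u} [Category.{v} D]

instance algebraLinear [Preadditive D] [Linear k D] (T : Monad D) [T.toFunctor.Additive]
    [T.toFunctor.Linear k] : Linear k T.Algebra where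
  homModule X Y :=
    { smul := fun r f =>
        { f := r • f.f
          h := by rw [Functor.map_smul, Linear.smul_comp, f.h, Linear.comp_smul] }
      one_smul := fun f => Monad.Algebra.Hom.ext (one_smul k f.f)
      mul_smul := fun r s f => Monad.Algebra.Hom.ext (mul_smul r s f.f)
      smul_zero := fun r => Monad.Algebra.Hom.ext (smul_zero r)
      smul_add := fun r f g => Monad.Algebra.Hom.ext (smul_add r f.f g.f)
      add_smul := fun r s f => Monad.Algebra.Hom.ext (add_smul r s f.f)
      zero_smul := fun f => Monad.Algebra.Hom.ext (zero_smul k f.f) }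
  smul_comp _ _ _ r f g := Monad.Algebra.Hom.ext (Linear.smul_comp _ _ _ r f.f g.f)
  comp_smul _ _ _ f r g := Monad.Algebra.Hom.ext (Linear.comp_smul _ _ _ f.f r g.f)

instance coalgebraLinear [Preadditive D] [Linear k D] (S : Comonad D) [S.toFunctor.Additive]
    [S.toFunctor.Linear k] : Linear k S.Coalgebra where
  homModule X Y :=
    { smul := fun r f =>
        { f := r • f.f
          h := by rw [Functor.map_smul, Linear.comp_smul, f.h, Linear.smul_comp] }
      one_smul := fun f => Comonad.Coalgebra.Hom.ext (one_smul k f.f)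
      mul_smul := fun r s f => Comonad.Coalgebra.Hom.ext (mul_smul r s f.f)
      smul_zero := fun r => Comonad.Coalgebra.Hom.ext (smul_zero r)
      smul_add := fun r f g => Comonad.Coalgebra.Hom.ext (smul_add r f.f g.f)
      add_smul := fun r s f => Comonad.Coalgebra.Hom.ext (add_smul r s f.f)
      zero_smul := fun f => Comonad.Coalgebra.Hom.ext (zero_smul k f.f) }
  smul_comp _ _ _ r f g := Comonad.Coalgebra.Hom.ext (Linear.smul_comp _ _ _ r f.f g.f)
  comp_smul _ _ _ f r g := Comonad.Coalgebra.Hom.ext (Linear.comp_smul _ _ _ f.f r g.f)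

/-- A finitely complete and cocomplete preadditive category with a conservative exact additive
functor to an abelian category is abelian. -/
@[reducible]
noncomputable def abelianOfExact {A : Type*} [Category* A] [Preadditive A] [HasFiniteLimits A]
    [HasFiniteColimits A] {B : Type*} [Category* B] [Abelian B] (U : A ⥤ B) [U.Additive]
    [PreservesFiniteLimits U] [PreservesFiniteColimits U] [U.ReflectsIsomorphisms] : Abelian A :=
  have : ∀ {X Y : A} (f : X ⟶ Y), IsIso (Abelian.coimageImageComparison f) := fun {X Y} f => by
    have h : IsIso (U.map (Abelian.coimageImageComparison f)) := by
      have e := Abelian.PreservesCoimageImageComparison.iso U f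
      exact (Arrow.isIso_iff_isIso_of_isIso e.inv).1
        (inferInstanceAs (IsIso (Abelian.coimageImageComparison (U.map f))))
    exact isIso_of_reflects_iso _ U
  Abelian.ofCoimageImageComparisonIsIso

@[reducible]
noncomputable def algebraAbelian [Abelian D] (T : Monad D) [T.toFunctor.Additive]
    [PreservesFiniteColimits T.toFunctor] : Abelian T.Algebra :=
  have : HasFiniteLimits T.Algebra :=
    ⟨fun _ _ _ => ⟨fun F => Monad.hasLimit_of_comp_forget_hasLimit F⟩⟩
  have : HasFiniteColimits T.Algebra :=
    ⟨fun _ _ _ => ⟨fun F => Monad.forget_creates_colimits_of_monad_preserves F⟩⟩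
  have : PreservesFiniteLimits T.forget := ⟨fun _ _ _ => inferInstance⟩
  have : PreservesFiniteColimits T.forget := ⟨fun _ _ _ => inferInstance⟩
  abelianOfExact T.forget


@[reducible]
noncomputable def coalgebraAbelian [Abelian D] (S : Comonad D) [S.toFunctor.Additive]
    [PreservesFiniteLimits S.toFunctor] : Abelian S.Coalgebra :=
  have : HasFiniteColimits S.Coalgebra :=
    ⟨fun _ _ _ => ⟨fun F => Comonad.hasColimit_of_comp_forget_hasColimit F⟩⟩
  have : HasFiniteLimits S.Coalgebra :=
    ⟨fun _ _ _ => ⟨fun F => Comonad.forget_creates_limits_of_comonad_preserves F⟩⟩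
  have : PreservesFiniteLimits S.forget := ⟨fun _ _ _ => inferInstance⟩
  have : PreservesFiniteColimits S.forget := ⟨fun _ _ _ => inferInstance⟩
  abelianOfExact S.forget

end EM

section Adj

variable {C : Type*} [Category* C] [MonoidalCategory C]
variable {D : Type*} [Category* D] [MonoidalLeftAction C D]
variable {M : Type*} [Category* M] [MonoidalLeftAction C M]

open Functor.LaxLeftLinear Functor.OplaxLeftLinear Functor.LeftLinear

/-- The right adjoint of a strong `C`-module functor is a lax `C`-module functor. -/
@[reducible]
def rightAdjointLax {F : D ⥤ M} {R : M ⥤ D} (adj : F ⊣ R) [F.LeftLinear C] :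
    R.LaxLeftLinear C where
  μₗ c m := adj.homEquiv _ _ (δₗ F c (R.obj m) ≫ c ⊴ₗ adj.counit.app m)
  μₗ_naturality_left f m := by
    rw [← adj.homEquiv_naturality_left, ← adj.homEquiv_naturality_right]
    congr 1
    rw [δₗ_naturality_left_assoc, Category.assoc, MonoidalLeftAction.action_exchange]
  μₗ_naturality_right c m m' f := by
    rw [← adj.homEquiv_naturality_left, ← adj.homEquiv_naturality_right]
    congr 1
    rw [δₗ_naturality_right_assoc, Category.assoc, ← MonoidalLeftAction.actionHomRight_comp,
      ← MonoidalLeftAction.actionHomRight_comp, adj.counit_naturality]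
  μₗ_associativity c c' m := by
    apply (adj.homEquiv _ _).symm.injective
    simp only [Adjunction.homEquiv_unit, Adjunction.homEquiv_counit, Functor.map_comp,
      MonoidalLeftAction.actionHomRight_comp, Category.assoc, Adjunction.counit_naturality,
      Adjunction.left_triangle_components_assoc, Adjunction.counit_naturality_assoc,
      δₗ_naturality_right_assoc, δₗ_associativity_assoc, MonoidalLeftAction.tensor_actionHomRight,
      Iso.inv_hom_id, Category.comp_id]
    simp only [← MonoidalLeftAction.actionHomRight_comp, Adjunction.counit_naturality,
      Adjunction.left_triangle_components_assoc, Adjunction.counit_naturality_assoc]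
  μₗ_unitality m := by
    apply (adj.homEquiv _ _).symm.injective
    simp [Adjunction.homEquiv_unit, Adjunction.homEquiv_counit]

/-- The left adjoint of a strong `C`-module functor is an oplax `C`-module functor. -/
@[reducible]
def leftAdjointOplax {L : M ⥤ D} {G : D ⥤ M} (adj : L ⊣ G) [G.LeftLinear C] :
    L.OplaxLeftLinear C where
  δₗ c m := (adj.homEquiv _ _).symm (c ⊴ₗ adj.unit.app m ≫ μₗ G c (L.obj m))
  δₗ_naturality_left f m := by
    rw [← adj.homEquiv_naturality_left_symm, ← adj.homEquiv_naturality_right_symm]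
    congr 1
    rw [Category.assoc, ← μₗ_naturality_left, ← MonoidalLeftAction.action_exchange_assoc]
    rfl
  δₗ_naturality_right c m m' f := by
    rw [← adj.homEquiv_naturality_left_symm, ← adj.homEquiv_naturality_right_symm]
    congr 1
    rw [Category.assoc, ← μₗ_naturality_right, ← MonoidalLeftAction.actionHomRight_comp_assoc,
      ← MonoidalLeftAction.actionHomRight_comp_assoc, adj.unit_naturality]
  δₗ_associativity c c' m := by
    apply (adj.homEquiv _ _).injective
    simp only [Adjunction.homEquiv_unit, Adjunction.homEquiv_counit, Functor.map_comp,
      MonoidalLeftAction.actionHomRight_comp, Category.assoc,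
      Adjunction.unit_naturality_assoc, Adjunction.right_triangle_components_assoc,
      μₗ_associativity, MonoidalLeftAction.tensor_actionHomRight, Functor.comp_obj,
      Iso.inv_hom_id_assoc]
    simp only [← μₗ_naturality_right, ← μₗ_naturality_right_assoc,
      ← MonoidalLeftAction.actionHomRight_comp_assoc,
      Adjunction.unit_naturality_assoc, Adjunction.right_triangle_components]
    simp
  δₗ_unitality_inv m := by
    apply (adj.homEquiv _ _).injective
    simp [Adjunction.homEquiv_unit, Adjunction.homEquiv_counit]

/-- The monad of an adjunction whose left adjoint is a strong `C`-module functor is a lax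
`C`-module monad. -/
@[reducible]
def adjunctionLaxMonad {F : D ⥤ M} {R : M ⥤ D} (adj : F ⊣ R) [F.LeftLinear C] :
    LaxModuleMonad C adj.toMonad :=
  letI := rightAdjointLax (C := C) adj
  { μₗ := fun c d => μₗ R c (F.obj d) ≫ R.map (μₗ F c d)
    μₗ_naturality_left := fun {c c'} f d => by
      change f ⊵ₗ R.obj (F.obj d) ≫ μₗ R c' (F.obj d) ≫ R.map (μₗ F c' d) =
        (μₗ R c (F.obj d) ≫ R.map (μₗ F c d)) ≫ R.map (F.map (f ⊵ₗ d))
      rw [μₗ_naturality_left_assoc, Category.assoc, ← R.map_comp, ← R.map_comp,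
        μₗ_naturality_left]
    μₗ_naturality_right := fun c {d d'} f => by
      change c ⊴ₗ R.map (F.map f) ≫ μₗ R c (F.obj d') ≫ R.map (μₗ F c d') =
        (μₗ R c (F.obj d) ≫ R.map (μₗ F c d)) ≫ R.map (F.map (c ⊴ₗ f))
      rw [μₗ_naturality_right_assoc, Category.assoc, ← R.map_comp, ← R.map_comp,
        μₗ_naturality_right]
    μₗ_associativity := fun c c' d => by
      change (μₗ R (c ⊗ c') (F.obj d) ≫ R.map (μₗ F (c ⊗ c') d)) ≫
        R.map (F.map (αₗ c c' d).hom) =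
        (αₗ c c' (R.obj (F.obj d))).hom ≫ c ⊴ₗ (μₗ R c' (F.obj d) ≫ R.map (μₗ F c' d)) ≫
          μₗ R c (F.obj (c' ⊙ₗ d)) ≫ R.map (μₗ F c (c' ⊙ₗ d))
      rw [Category.assoc, ← R.map_comp, μₗ_associativity, R.map_comp, μₗ_associativity_assoc,
        MonoidalLeftAction.actionHomRight_comp, Category.assoc, μₗ_naturality_right_assoc,
        R.map_comp]
    μₗ_unitality := fun d => by
      change (λₗ (R.obj (F.obj d))).hom =
        (μₗ R (𝟙_ C) (F.obj d) ≫ R.map (μₗ F (𝟙_ C) d)) ≫ R.map (F.map (λₗ d).hom)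
      rw [Category.assoc, ← R.map_comp, ← μₗ_unitality, ← μₗ_unitality]
    actionHomRight_η_comp_μₗ := fun c d => by
      change c ⊴ₗ adj.unit.app d ≫ μₗ R c (F.obj d) ≫ R.map (μₗ F c d) = adj.unit.app (c ⊙ₗ d)
      apply (adj.homEquiv _ _).symm.injective
      have key : F.map (μₗ R c (F.obj d)) ≫ adj.counit.app (c ⊙ₗ F.obj d) =
          δₗ F c (R.obj (F.obj d)) ≫ c ⊴ₗ adj.counit.app (F.obj d) :=
        (adj.homEquiv_counit _ _ _).symm.trans ((adj.homEquiv _ _).symm_apply_apply _)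
      have nat : F.map (c ⊴ₗ adj.unit.app d) ≫ δₗ F c (R.obj (F.obj d)) =
          δₗ F c d ≫ c ⊴ₗ F.map (adj.unit.app d) :=
        δₗ_naturality_right F c (adj.unit.app d)
      rw [adj.homEquiv_counit, adj.homEquiv_counit, F.map_comp, F.map_comp, Category.assoc,
        Category.assoc, adj.counit_naturality, reassoc_of% key, reassoc_of% nat,
        ← MonoidalLeftAction.actionHomRight_comp_assoc, adj.left_triangle_components,
        MonoidalLeftAction.actionHomRight_id, Category.id_comp]
      exact (δₗ_comp_μₗ F c d).trans (adj.left_triangle_components _).symm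
    actionHomRight_μ_comp_μₗ := fun c d => by
      change c ⊴ₗ R.map (adj.counit.app (F.obj d)) ≫ μₗ R c (F.obj d) ≫ R.map (μₗ F c d) =
        (μₗ R c (F.obj (R.obj (F.obj d))) ≫ R.map (μₗ F c (R.obj (F.obj d)))) ≫
          R.map (F.map (μₗ R c (F.obj d) ≫ R.map (μₗ F c d))) ≫
            R.map (adj.counit.app (F.obj (c ⊙ₗ d)))
      apply (adj.homEquiv _ _).symm.injective
      have key (x : M) : F.map (μₗ R c x) ≫ adj.counit.app (c ⊙ₗ x) =
          δₗ F c (R.obj x) ≫ c ⊴ₗ adj.counit.app x :=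
        (adj.homEquiv_counit _ _ _).symm.trans ((adj.homEquiv _ _).symm_apply_apply _)
      simp only [adj.homEquiv_counit, F.map_comp, R.map_comp, Category.assoc,
        adj.counit_naturality, adj.counit_naturality_assoc, reassoc_of% key]
      have e₁ : F.map (c ⊴ₗ R.map (adj.counit.app (F.obj d))) ≫ δₗ F c (R.obj (F.obj d)) =
          δₗ F c (R.obj (F.obj (R.obj (F.obj d)))) ≫ c ⊴ₗ F.map (R.map (adj.counit.app (F.obj d))) :=
        δₗ_naturality_right F c _
      have e₂ : μₗ F c (R.obj (F.obj d)) ≫ δₗ F c (R.obj (F.obj d)) = 𝟙 _ := μₗ_comp_δₗ F c _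
      have e₃ : F.map (R.map (adj.counit.app (F.obj d))) ≫ adj.counit.app (F.obj d) =
          adj.counit.app (F.obj (R.obj (F.obj d))) ≫ adj.counit.app (F.obj d) :=
        adj.counit_naturality _
      rw [reassoc_of% e₁, reassoc_of% e₂, ← MonoidalLeftAction.actionHomRight_comp_assoc, e₃,
        MonoidalLeftAction.actionHomRight_comp_assoc] }

/-- The comonad of an adjunction whose right adjoint is a strong `C`-module functor is an oplax
`C`-module comonad. -/
@[reducible]
def adjunctionOplaxComonad {L : M ⥤ D} {G : D ⥤ M} (adj : L ⊣ G) [G.LeftLinear C] :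
    OplaxModuleComonad C adj.toComonad :=
  letI := leftAdjointOplax (C := C) adj
  { δₗ := fun c d => L.map (δₗ G c d) ≫ δₗ L c (G.obj d)
    δₗ_naturality_left := fun {c c'} f d => by
      change L.map (G.map (f ⊵ₗ d)) ≫ L.map (δₗ G c' d) ≫ δₗ L c' (G.obj d) =
        (L.map (δₗ G c d) ≫ δₗ L c (G.obj d)) ≫ f ⊵ₗ L.obj (G.obj d)
      rw [Category.assoc, ← δₗ_naturality_left, ← L.map_comp_assoc, ← L.map_comp_assoc,
        δₗ_naturality_left]
    δₗ_naturality_right := fun c {d d'} f => by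
      change L.map (G.map (c ⊴ₗ f)) ≫ L.map (δₗ G c d') ≫ δₗ L c (G.obj d') =
        (L.map (δₗ G c d) ≫ δₗ L c (G.obj d)) ≫ c ⊴ₗ L.map (G.map f)
      rw [Category.assoc, ← δₗ_naturality_right, ← L.map_comp_assoc, ← L.map_comp_assoc,
        δₗ_naturality_right]
    δₗ_associativity := fun c c' d => by
      change (L.map (δₗ G (c ⊗ c') d) ≫ δₗ L (c ⊗ c') (G.obj d)) ≫
          (αₗ c c' (L.obj (G.obj d))).hom =
        L.map (G.map (αₗ c c' d).hom) ≫
          (L.map (δₗ G c (c' ⊙ₗ d)) ≫ δₗ L c (G.obj (c' ⊙ₗ d))) ≫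
          c ⊴ₗ (L.map (δₗ G c' d) ≫ δₗ L c' (G.obj d))
      rw [Category.assoc, δₗ_associativity, ← L.map_comp_assoc, δₗ_associativity,
        MonoidalLeftAction.actionHomRight_comp, Category.assoc, ← δₗ_naturality_right_assoc]
      simp only [L.map_comp, Category.assoc]
    δₗ_unitality_inv := fun d => by
      change (λₗ (L.obj (G.obj d))).inv =
        L.map (G.map (λₗ d).inv) ≫ L.map (δₗ G (𝟙_ C) d) ≫ δₗ L (𝟙_ C) (G.obj d)
      rw [← L.map_comp_assoc, ← δₗ_unitality_inv, ← δₗ_unitality_inv]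
    δₗ_comp_actionHomRight_ε := fun c d => by
      change (L.map (δₗ G c d) ≫ δₗ L c (G.obj d)) ≫ c ⊴ₗ adj.counit.app d =
        adj.counit.app (c ⊙ₗ d)
      apply (adj.homEquiv _ _).injective
      have key : adj.unit.app (c ⊙ₗ G.obj d) ≫ G.map (δₗ L c (G.obj d)) =
          c ⊴ₗ adj.unit.app (G.obj d) ≫ μₗ G c (L.obj (G.obj d)) :=
        (adj.homEquiv_unit _ _ _).symm.trans ((adj.homEquiv _ _).apply_symm_apply _)
      rw [adj.homEquiv_unit, adj.homEquiv_unit, G.map_comp, G.map_comp, Category.assoc,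
        adj.unit_naturality_assoc, reassoc_of% key, ← μₗ_naturality_right,
        ← MonoidalLeftAction.actionHomRight_comp_assoc, adj.right_triangle_components,
        adj.right_triangle_components, MonoidalLeftAction.actionHomRight_id, Category.id_comp]
      exact δₗ_comp_μₗ G c d
    δₗ_comp_actionHomRight_δ := fun c d => by
      change (L.map (δₗ G c d) ≫ δₗ L c (G.obj d)) ≫ c ⊴ₗ L.map (adj.unit.app (G.obj d)) =
        L.map (adj.unit.app (G.obj (c ⊙ₗ d))) ≫
          L.map (G.map (L.map (δₗ G c d) ≫ δₗ L c (G.obj d))) ≫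
            L.map (δₗ G c (L.obj (G.obj d))) ≫ δₗ L c (G.obj (L.obj (G.obj d)))
      apply (adj.homEquiv _ _).injective
      have key (x : M) : adj.unit.app (c ⊙ₗ x) ≫ G.map (δₗ L c x) =
          c ⊴ₗ adj.unit.app x ≫ μₗ G c (L.obj x) :=
        (adj.homEquiv_unit _ _ _).symm.trans ((adj.homEquiv _ _).apply_symm_apply _)
      simp only [adj.homEquiv_unit, G.map_comp, L.map_comp, Category.assoc,
        adj.unit_naturality_assoc, reassoc_of% key, key, ← μₗ_naturality_right, μₗ_comp_δₗ_assoc]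
      simp only [← MonoidalLeftAction.actionHomRight_comp_assoc, adj.unit_naturality]
      rfl }

end Adj
section Tensor
variable {C : Type*} [Category* C] [MonoidalCategory C]
variable {M : Type*} [Category* M] [MonoidalLeftAction C M]
/-- `- ▷ ℓ : C ⥤ M` as a strong `C`-module functor. -/
instance actionRightLeftLinear (ℓ : M) :
    (MonoidalLeftAction.actionRight C ℓ).LeftLinear C where
  μₗ c d := (αₗ c d ℓ).inv
  μₗ_naturality_left {c c'} f d := by
    change f ⊵ₗ (d ⊙ₗ ℓ) ≫ (αₗ c' d ℓ).inv = (αₗ c d ℓ).inv ≫ (f ▷ d) ⊵ₗ ℓ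
    simp
  μₗ_naturality_right c d d' f := by
    change c ⊴ₗ (f ⊵ₗ ℓ) ≫ (αₗ c d' ℓ).inv = (αₗ c d ℓ).inv ≫ (c ◁ f) ⊵ₗ ℓ
    simp
  μₗ_associativity c c' d := by
    change (αₗ (c ⊗ c') d ℓ).inv ≫ (α_ c c' d).hom ⊵ₗ ℓ = (αₗ c c' (d ⊙ₗ ℓ)).hom ≫
      c ⊴ₗ (αₗ c' d ℓ).inv ≫ (αₗ c (c' ⊗ d) ℓ).inv
    rw [Iso.inv_comp_eq, ← cancel_mono (αₗ c (c' ⊗ d) ℓ).hom,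
      ← cancel_mono (c ⊴ₗ (αₗ c' d ℓ).hom)]
    simp only [Category.assoc, MonoidalLeftAction.associator_actionHom,
      ← MonoidalLeftAction.actionHomRight_comp, Iso.inv_hom_id,
      MonoidalLeftAction.actionHomRight_id, Category.comp_id]
  μₗ_unitality d := by
    change (λₗ (d ⊙ₗ ℓ)).hom = (αₗ (𝟙_ C) d ℓ).inv ≫ (λ_ d).hom ⊵ₗ ℓ
    rw [MonoidalLeftAction.leftUnitor_actionHom, Iso.inv_hom_id_assoc]
  δₗ c d := (αₗ c d ℓ).hom
  δₗ_naturality_left {c c'} f d := by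
    change (f ▷ d) ⊵ₗ ℓ ≫ (αₗ c' d ℓ).hom = (αₗ c d ℓ).hom ≫ f ⊵ₗ (d ⊙ₗ ℓ)
    simp
  δₗ_naturality_right c d d' f := by
    change (c ◁ f) ⊵ₗ ℓ ≫ (αₗ c d' ℓ).hom = (αₗ c d ℓ).hom ≫ c ⊴ₗ (f ⊵ₗ ℓ)
    simp
  δₗ_associativity c c' d := by
    change (αₗ (c ⊗ c') d ℓ).hom ≫ (αₗ c c' (d ⊙ₗ ℓ)).hom = (α_ c c' d).hom ⊵ₗ ℓ ≫
      (αₗ c (c' ⊗ d) ℓ).hom ≫ c ⊴ₗ (αₗ c' d ℓ).hom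
    exact (MonoidalLeftAction.associator_actionHom c c' d ℓ).symm
  δₗ_unitality_inv d := by
    change (λₗ (d ⊙ₗ ℓ)).inv = (λ_ d).inv ⊵ₗ ℓ ≫ (αₗ (𝟙_ C) d ℓ).hom
    rw [← cancel_mono (λₗ[C] (d ⊙ₗ ℓ)).hom, Category.assoc,
      ← MonoidalLeftAction.leftUnitor_actionHom, ← MonoidalLeftAction.comp_actionHomLeft]
    simp only [Iso.inv_hom_id, MonoidalLeftAction.id_actionHomLeft]
  μₗ_comp_δₗ c d := (αₗ c d ℓ).inv_hom_id
  δₗ_comp_μₗ c d := (αₗ c d ℓ).hom_inv_id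

end Tensor
section Extension

variable {C : Type*} [Category* C] [MonoidalCategory C]
variable {D : Type*} [Category* D]

/-- The comparison functor from the Kleisli category to the Eilenberg-Moore category, whose
essential image consists of the free algebras. -/
def kleisliToAlgebra (T : Monad D) : Kleisli T ⥤ T.Algebra where
  obj X := T.free.obj X.of
  map {X Y} f :=
    { f := T.map f.of ≫ T.μ.app Y.of
      h := by
        change T.map (T.map f.of ≫ T.μ.app Y.of) ≫ T.μ.app Y.of =
          T.μ.app X.of ≫ T.map f.of ≫ T.μ.app Y.of
        rw [T.map_comp, Category.assoc, T.assoc, ← T.μ.naturality_assoc]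
        rfl }
  map_id X := Monad.Algebra.Hom.ext (T.right_unit X.of)
  map_comp {X Y Z} f g := Monad.Algebra.Hom.ext (by
    change T.map (f.of ≫ T.map g.of ≫ T.μ.app Z.of) ≫ T.μ.app Z.of =
      (T.map f.of ≫ T.μ.app Y.of) ≫ T.map g.of ≫ T.μ.app Z.of
    have n : T.map (T.map g.of) ≫ T.μ.app (T.obj Z.of) = T.μ.app Y.of ≫ T.map g.of :=
      T.μ.naturality g.of
    simp only [T.map_comp, Category.assoc, T.assoc, reassoc_of% n])

/-- The comparison functor from the co-Kleisli category to the category of coalgebras, whose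
essential image consists of the cofree coalgebras. -/
def cokleisliToCoalgebra (S : Comonad D) : Cokleisli S ⥤ S.Coalgebra where
  obj X := S.cofree.obj X.of
  map {X Y} f :=
    { f := S.δ.app X.of ≫ S.map f.of
      h := by
        change S.δ.app X.of ≫ S.map (S.δ.app X.of ≫ S.map f.of) =
          (S.δ.app X.of ≫ S.map f.of) ≫ S.δ.app Y.of
        have n : S.map f.of ≫ S.δ.app Y.of = S.δ.app (S.obj X.of) ≫ S.map (S.map f.of) :=
          S.δ.naturality f.of
        rw [S.map_comp, Category.assoc, n, ← S.coassoc_assoc] }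
  map_id X := Comonad.Coalgebra.Hom.ext (S.right_counit X.of)
  map_comp {X Y Z} f g := Comonad.Coalgebra.Hom.ext (by
    change S.δ.app X.of ≫ S.map (S.δ.app X.of ≫ S.map f.of ≫ g.of) =
      (S.δ.app X.of ≫ S.map f.of) ≫ S.δ.app Y.of ≫ S.map g.of
    have n : S.map f.of ≫ S.δ.app Y.of = S.δ.app (S.obj X.of) ≫ S.map (S.map f.of) :=
      S.δ.naturality f.of
    simp only [S.map_comp, Category.assoc, reassoc_of% n, S.coassoc_assoc])

/-- The structure map of an algebra, as a morphism from a free algebra. -/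
def algebraCounit {T : Monad D} (m : T.Algebra) : T.free.obj m.A ⟶ m where
  f := m.a
  h := m.assoc.symm

/-- The structure map of a coalgebra, as a morphism to a cofree coalgebra. -/
def coalgebraUnit {S : Comonad D} (m : S.Coalgebra) : m ⟶ S.cofree.obj m.A where
  f := m.a
  h := m.coassoc.symm

variable (k : Type*) [Field k] [Preadditive C] [Linear k C] [Preadditive D] [Linear k D]
  [MonoidalLeftAction C D]

/-- A `k`-bilinear `C`-module structure on the Eilenberg-Moore category of a lax `C`-module monad
`T` which extends the one of the Kleisli category: the functor from the Kleisli category is a strong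
`C`-module functor, and `x ▷ (m, a)` is the Linton coequaliser of the two morphisms of algebras
`T (x ▷ T m) ⟶ T (x ▷ m)` given by the action `a` and by the lax structure of `T`. -/
structure ExtendedAction (T : Monad D) [LaxModuleMonad C T] [T.toFunctor.Additive]
    [T.toFunctor.Linear k] where
  [action : MonoidalLeftAction C T.Algebra]
  [bilinear : BilinearAction k C T.Algebra]
  [strong : (kleisliToAlgebra T).LeftLinear C]
  condition (x : C) (m : T.Algebra) :
    T.free.map (x ⊴ₗ m.a) ≫ Functor.OplaxLeftLinear.δₗ (kleisliToAlgebra T) x (.mk T m.A) ≫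
        x ⊴ₗ algebraCounit m =
      (kleisliToAlgebra T).map (X := .mk T (x ⊙ₗ T.obj m.A)) (Y := .mk T (x ⊙ₗ m.A))
          (.mk (Functor.LaxLeftLinear.μₗ T.toFunctor x m.A)) ≫
        Functor.OplaxLeftLinear.δₗ (kleisliToAlgebra T) x (.mk T m.A) ≫ x ⊴ₗ algebraCounit m
  isColimit (x : C) (m : T.Algebra) : Nonempty (IsColimit (Cofork.ofπ _ (condition x m)))

/-- A `k`-bilinear `C`-module structure on the category of coalgebras of an oplax `C`-module comonad
`S` which extends the one of the co-Kleisli category: the functor from the co-Kleisli category is a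
strong `C`-module functor, and `x ▷ (m, a)` is the equaliser of the two morphisms of coalgebras
`S (x ▷ m) ⟶ S (x ▷ S m)` given by the coaction `a` and by the oplax structure of `S`. -/
structure ExtendedCoaction (S : Comonad D) [OplaxModuleComonad C S] [S.toFunctor.Additive]
    [S.toFunctor.Linear k] where
  [action : MonoidalLeftAction C S.Coalgebra]
  [bilinear : BilinearAction k C S.Coalgebra]
  [strong : (cokleisliToCoalgebra S).LeftLinear C]
  condition (x : C) (m : S.Coalgebra) :
    (x ⊴ₗ coalgebraUnit m ≫ Functor.LaxLeftLinear.μₗ (cokleisliToCoalgebra S) x (.mk S m.A)) ≫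
        S.cofree.map (x ⊴ₗ m.a) =
      (x ⊴ₗ coalgebraUnit m ≫ Functor.LaxLeftLinear.μₗ (cokleisliToCoalgebra S) x (.mk S m.A)) ≫
        (cokleisliToCoalgebra S).map (X := .mk S (x ⊙ₗ m.A)) (Y := .mk S (x ⊙ₗ S.obj m.A))
          (.mk (Functor.OplaxLeftLinear.δₗ S.toFunctor x m.A))
  isLimit (x : C) (m : S.Coalgebra) : Nonempty (IsLimit (Fork.ofι _ (condition x m)))

end Extension

section AdjointLinear

variable {k : Type*} [Field k] {A : Type*} [Category* A] [Preadditive A] [Linear k A]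
  {B : Type*} [Category* B] [Preadditive B] [Linear k B] {F : A ⥤ B} {G : B ⥤ A}

theorem right_adjoint_linear (adj : F ⊣ G) [F.Linear k] : G.Linear k where
  map_smul f r := (adj.homEquiv _ _).symm.injective
    (by simp [Adjunction.homEquiv_counit, Functor.map_smul, Linear.smul_comp, Linear.comp_smul])

theorem left_adjoint_linear (adj : F ⊣ G) [G.Linear k] : F.Linear k where
  map_smul f r := (adj.homEquiv _ _).injective
    (by simp [Adjunction.homEquiv_unit, Functor.map_smul, Linear.smul_comp, Linear.comp_smul])

end AdjointLinear

section Bundled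

variable (k : Type*) [Field k] (C : Type u) [Category.{v} C] [Abelian C] [Linear k C]
  [MonoidalCategory C]

/-- An abelian `k`-linear `C`-module category. -/
structure ModCat where
  carrier : Type w₂
  [category : Category.{w₁} carrier]
  [abelian : Abelian carrier]
  [linear : Linear k carrier]
  [action : MonoidalLeftAction C carrier]
  [bilinear : BilinearAction k C carrier]

attribute [instance] ModCat.category ModCat.abelian ModCat.linear ModCat.action ModCat.bilinear

variable {k C}

namespace ModCat

/-- Equivalence of `k`-linear `C`-module categories. -/
def Equivalent (M : ModCat.{w₂, w₁} k C) (N : ModCat.{w₂', w₁'} k C) : Prop :=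
  ∃ e : M.carrier ≌ N.carrier,
    e.functor.Additive ∧ e.functor.Linear k ∧ Nonempty (e.functor.LeftLinear C)

variable (M : ModCat.{w₂, w₁} k C)

/-- Every `x ▷ -` is right exact. -/
def IsRightExact : Prop :=
  ∀ x : C, PreservesFiniteColimits (MonoidalLeftAction.actionLeft M.carrier x)

/-- Every `x ▷ -` is left exact. -/
def IsLeftExact : Prop :=
  ∀ x : C, PreservesFiniteLimits (MonoidalLeftAction.actionLeft M.carrier x)

variable {M} (ℓ : M.carrier)

/-- `- ▷ ℓ` has a right adjoint `[ℓ, -]`. -/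
def IsClosed : Prop := (MonoidalLeftAction.actionRight C ℓ).IsLeftAdjoint

/-- `- ▷ ℓ` has a left adjoint. -/
def IsCoclosed : Prop := (MonoidalLeftAction.actionRight C ℓ).IsRightAdjoint

/-- `- ▷ ℓ` sends projectives to projectives. -/
def IsCProjective : Prop := ∀ P : C, Projective P → Projective (P ⊙ₗ ℓ)

/-- `- ▷ ℓ` sends injectives to injectives. -/
def IsCInjective : Prop := ∀ I : C, Injective I → Injective (I ⊙ₗ ℓ)

/-- Every projective is a direct summand of `P ▷ ℓ` for a projective `P`. -/
def IsCGenerator : Prop :=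
  ∀ Q : M.carrier, Projective Q → ∃ P : C, Projective P ∧ Nonempty (Retract Q (P ⊙ₗ ℓ))

/-- Every injective is a direct summand of `I ▷ ℓ` for an injective `I`. -/
def IsCCogenerator : Prop :=
  ∀ J : M.carrier, Injective J → ∃ I : C, Injective I ∧ Nonempty (Retract J (I ⊙ₗ ℓ))

/-- `M` has enough projectives and right exact `x ▷ -`, and `ℓ` is a closed `C`-projective
`C`-generator. -/
structure IsProjectivePair : Prop where
  enoughProjectives : EnoughProjectives M.carrier
  isRightExact : M.IsRightExact
  isClosed : IsClosed ℓ
  isCProjective : IsCProjective ℓ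
  isCGenerator : IsCGenerator ℓ

/-- `M` has enough injectives and left exact `x ▷ -`, and `ℓ` is a coclosed `C`-injective
`C`-cogenerator. -/
structure IsInjectivePair : Prop where
  enoughInjectives : EnoughInjectives M.carrier
  isLeftExact : M.IsLeftExact
  isCoclosed : IsCoclosed ℓ
  isCInjective : IsCInjective ℓ
  isCCogenerator : IsCCogenerator ℓ

end ModCat

variable (k C)

/-- A pair `(M, ℓ)` of a `C`-module category and a closed `C`-projective `C`-generator. -/
structure ProjectivePair where
  cat : ModCat.{max u v, v} k C
  gen : cat.carrier
  prop : ModCat.IsProjectivePair gen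

/-- A pair `(M, ℓ)` of a `C`-module category and a coclosed `C`-injective `C`-cogenerator. -/
structure InjectivePair where
  cat : ModCat.{max u v, v} k C
  cogen : cat.carrier
  prop : ModCat.IsInjectivePair cogen

/-- A right exact `k`-linear lax `C`-module monad on `C`. -/
structure RightExactLaxMonad where
  monad : Monad C
  [lax : LaxModuleMonad C monad]
  [additive : monad.toFunctor.Additive]
  [linear : monad.toFunctor.Linear k]
  [rightExact : PreservesFiniteColimits monad.toFunctor]

attribute [instance] RightExactLaxMonad.lax RightExactLaxMonad.additive RightExactLaxMonad.linear
  RightExactLaxMonad.rightExact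

/-- A left exact `k`-linear oplax `C`-module comonad on `C`. -/
structure LeftExactOplaxComonad where
  comonad : Comonad C
  [oplax : OplaxModuleComonad C comonad]
  [additive : comonad.toFunctor.Additive]
  [linear : comonad.toFunctor.Linear k]
  [leftExact : PreservesFiniteLimits comonad.toFunctor]

attribute [instance] LeftExactOplaxComonad.oplax LeftExactOplaxComonad.additive
  LeftExactOplaxComonad.linear LeftExactOplaxComonad.leftExact

variable {k C}

/-- The `C`-module structures on the Eilenberg-Moore category that extend the Kleisli one. -/
abbrev RightExactLaxMonad.Extension (T : RightExactLaxMonad k C) :=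
  ExtendedAction (C := C) k T.monad

/-- The `C`-module structures on the category of coalgebras that extend the co-Kleisli one. -/
abbrev LeftExactOplaxComonad.Extension (S : LeftExactOplaxComonad k C) :=
  ExtendedCoaction (C := C) k S.comonad

/-- The Eilenberg-Moore category of a right exact lax `C`-module monad with an extended action. -/
@[reducible]
noncomputable def RightExactLaxMonad.algebras (T : RightExactLaxMonad k C)
    (E : T.Extension) : ModCat.{max u v, v} k C :=
  letI := algebraAbelian T.monad
  letI := E.action
  { carrier := T.monad.Algebra
    linear := algebraLinear (k := k) T.monad
    bilinear := E.bilinear }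

/-- The coalgebras of a left exact oplax `C`-module comonad with an extended action. -/
@[reducible]
noncomputable def LeftExactOplaxComonad.coalgebras (S : LeftExactOplaxComonad k C)
    (E : S.Extension) : ModCat.{max u v, v} k C :=
  letI := coalgebraAbelian S.comonad
  letI := E.action
  { carrier := S.comonad.Coalgebra
    linear := coalgebraLinear (k := k) S.comonad
    bilinear := E.bilinear }

section InternalHom

variable {M : ModCat.{w₂, w₁} k C} (ℓ : M.carrier)

instance actionRight_additive : (MonoidalLeftAction.actionRight C ℓ).Additive where
  map_add {_ _ f g} := BilinearAction.add_actionHomLeft k f g ℓ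

instance actionRight_linear : (MonoidalLeftAction.actionRight C ℓ).Linear k where
  map_smul f r := BilinearAction.smul_actionHomLeft r f ℓ

variable {ℓ}

/-- The lax `C`-module monad `[ℓ, - ▷ ℓ]`, for a right adjoint `R = [ℓ, -]` of `- ▷ ℓ`. -/
def internalHomMonad {R : M.carrier ⥤ C} (adj : MonoidalLeftAction.actionRight C ℓ ⊣ R)
    (h : PreservesFiniteColimits (MonoidalLeftAction.actionRight C ℓ ⋙ R)) :
    RightExactLaxMonad k C where
  monad := adj.toMonad
  lax := adjunctionLaxMonad adj
  additive :=
    have := adj.right_adjoint_additive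
    inferInstanceAs (MonoidalLeftAction.actionRight C ℓ ⋙ R).Additive
  linear :=
    have : R.Linear k := right_adjoint_linear adj
    inferInstanceAs ((MonoidalLeftAction.actionRight C ℓ ⋙ R).Linear k)
  rightExact := h

/-- The oplax `C`-module comonad on `C` induced by a left adjoint `L` of `- ▷ ℓ`. -/
def internalCohomComonad {L : M.carrier ⥤ C} (adj : L ⊣ MonoidalLeftAction.actionRight C ℓ)
    (h : PreservesFiniteLimits (MonoidalLeftAction.actionRight C ℓ ⋙ L)) :
    LeftExactOplaxComonad k C where
  comonad := adj.toComonad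
  oplax := adjunctionOplaxComonad adj
  additive :=
    have := adj.left_adjoint_additive
    inferInstanceAs (MonoidalLeftAction.actionRight C ℓ ⋙ L).Additive
  linear :=
    have : L.Linear k := left_adjoint_linear adj
    inferInstanceAs ((MonoidalLeftAction.actionRight C ℓ ⋙ L).Linear k)
  leftExact := h

end InternalHom

/-- `(M, ℓ)` and `(N, ℓ')` are identified when `M` and `N` are equivalent `C`-module categories. -/
def ProjectivePair.Rel (p q : ProjectivePair k C) : Prop := p.cat.Equivalent q.cat

/-- `(M, ℓ)` and `(N, ℓ')` are identified when `M` and `N` are equivalent `C`-module categories. -/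
def InjectivePair.Rel (p q : InjectivePair k C) : Prop := p.cat.Equivalent q.cat

/-- Two monads are identified when their categories of algebras, with the extended actions, are
equivalent `C`-module categories. -/
def RightExactLaxMonad.Rel (T S : RightExactLaxMonad k C) : Prop :=
  ∃ (E : T.Extension) (F : S.Extension),
    (T.algebras E).Equivalent (S.algebras F)

/-- Two comonads are identified when their categories of coalgebras, with the extended actions, are
equivalent `C`-module categories. -/
def LeftExactOplaxComonad.Rel (T S : LeftExactOplaxComonad k C) : Prop :=
  ∃ (E : T.Extension) (F : S.Extension),
    (T.coalgebras E).Equivalent (S.coalgebras F)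

end Bundled

end ModuleReconstruction

open ModuleReconstruction

/-! The two parts are dual, so consider projective pairs. Write `F = - ▷ ℓ`, `R = [ℓ, -]` and `T = R
F`. Since `F` preserves projectives and `C` has enough of them, `R` preserves epimorphisms; being a
right adjoint between abelian categories, it is then exact. It is also faithful: every object of `M`
is a quotient of a summand of some `P ▷ ℓ`, and morphisms out of `P ▷ ℓ` are morphisms from `P` to
values of `R`. An exact faithful right adjoint between abelian categories is monadic
(`isEquivalence_comparison_of_exact`), which gives `M ≃ C^T` as categories.

The module structures are controlled by the Kleisli category. Every algebra is the coequaliser of a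
pair of morphisms of free algebras that comes from Kleisli arrows. Hence transformations between
right exact functors on algebras are the same as transformations between their restrictions
(`kleisliToAlgebra_restrictsFullyFaithfully`), and a functor on the Kleisli category that is right
exact on the base extends to a right exact functor on algebras (`exists_extension`). Extending first
the functors `x ▷ -` and then the coherence maps yields an action on algebras (`ActionLift.action`);
its axioms need only be checked on free algebras.

For an action extending the Kleisli one, the Linton condition is equivalent to right exactness of
every `x ▷ -`. So all extended actions lie in the class where restriction is fully faithful, and a
functor that is strong on free algebras becomes strong on all algebras
(`exists_leftLinear_of_restrictsFullyFaithfully`). Applied to the identity functor this shows that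
the extended action is essentially unique; applied to a quasi-inverse of the comparison functor it
makes `M ≃ C^T` an equivalence of module categories.

Conversely `T x ≅ T (x ⊗ 1) ≅ x ▷ T 1`, so acting on `T 1` is the free functor, with the forgetful
functor as right adjoint. The latter is exact, so free algebras on projectives are projective; they
cover all algebras, and projective algebras split off from them. The bijection is then formal: both
composites are instances of the reconstruction equivalence. -/

namespace ModuleReconstruction

/-! ### Extending natural transformations along a functor -/

section Restriction

variable {K E B : Type*} [Category* K] [Category* E] [Category* B]

/-- Restriction along `J` is fully faithful on the functors with the property `P`. -/
def RestrictsFullyFaithfully (J : K ⥤ E) (P : ObjectProperty (E ⥤ B)) : Prop :=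
  ∀ ⦃G H : E ⥤ B⦄, P G → P H →
    Function.Bijective (fun α : G ⟶ H => Functor.whiskerLeft J α)

namespace RestrictsFullyFaithfully

variable {J : K ⥤ E} {P : ObjectProperty (E ⥤ B)} (hJ : RestrictsFullyFaithfully J P)
include hJ

theorem hom_ext {G H : E ⥤ B} (hG : P G) (hH : P H) {α β : G ⟶ H}
    (h : ∀ X, α.app (J.obj X) = β.app (J.obj X)) : α = β :=
  (hJ hG hH).1 (by ext X; exact h X)

theorem exists_hom {G H : E ⥤ B} (hG : P G) (hH : P H)
    (α : ∀ X, G.obj (J.obj X) ⟶ H.obj (J.obj X))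
    (hα : ∀ {X Y : K} (f : X ⟶ Y), G.map (J.map f) ≫ α Y = α X ≫ H.map (J.map f)) :
    ∃ β : G ⟶ H, ∀ X, β.app (J.obj X) = α X := by
  obtain ⟨β, hβ⟩ := (hJ hG hH).2 { app := α, naturality := fun _ _ f => hα f }
  exact ⟨β, fun X => congr_app hβ X⟩

/-- The family and the family of inverses extend separately; the composites of the two extensions
are identities because they are so after restriction. -/
theorem exists_iso {G H : E ⥤ B} (hG : P G) (hH : P H)
    (α : ∀ X, G.obj (J.obj X) ≅ H.obj (J.obj X))
    (hα : ∀ {X Y : K} (f : X ⟶ Y), G.map (J.map f) ≫ (α Y).hom = (α X).hom ≫ H.map (J.map f)) :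
    ∃ β : G ≅ H, ∀ X, β.hom.app (J.obj X) = (α X).hom := by
  obtain ⟨β, hβ⟩ := hJ.exists_hom hG hH (fun X => (α X).hom) hα
  obtain ⟨γ, hγ⟩ := hJ.exists_hom hH hG (fun X => (α X).inv) fun {X Y} f => by
    rw [Iso.comp_inv_eq, Category.assoc, hα, Iso.inv_hom_id_assoc]
  exact ⟨⟨β, γ, hJ.hom_ext hG hG fun X => by simp [hβ, hγ],
    hJ.hom_ext hH hH fun X => by simp [hβ, hγ]⟩, hβ⟩

end RestrictsFullyFaithfully

end Restriction

/-! ### Operations on strong module functors -/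

section LeftLinear

variable {C : Type*} [Category* C] [MonoidalCategory C]
variable {D : Type*} [Category* D] [MonoidalLeftAction C D]
variable {E : Type*} [Category* E] [MonoidalLeftAction C E]
variable {B : Type*} [Category* B] [MonoidalLeftAction C B]

open Functor.LaxLeftLinear Functor.OplaxLeftLinear Functor.LeftLinear

/-- A lax `C`-module functor whose structure morphisms are isomorphisms is strong. -/
@[reducible]
def leftLinearOfIso {F : D ⥤ E} (l : F.LaxLeftLinear C)
    (e : ∀ (c : C) (d : D), c ⊙ₗ F.obj d ≅ F.obj (c ⊙ₗ d))
    (he : ∀ (c : C) (d : D), (e c d).hom = μₗ F c d) : F.LeftLinear C where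
  __ := l
  δₗ c d := (e c d).inv
  δₗ_naturality_left f d := by
    rw [Iso.comp_inv_eq, Category.assoc, he, μₗ_naturality_left, ← he, Iso.inv_hom_id_assoc]
  δₗ_naturality_right c _ _ f := by
    rw [Iso.comp_inv_eq, Category.assoc, he, μₗ_naturality_right, ← he, Iso.inv_hom_id_assoc]
  δₗ_associativity c c' d := by
    rw [Iso.inv_comp_eq, he, reassoc_of% (μₗ_associativity F c c' d), ← he, ← he,
      Iso.hom_inv_id_assoc, ← MonoidalLeftAction.actionHomRight_comp, Iso.hom_inv_id,
      MonoidalLeftAction.actionHomRight_id, Category.comp_id]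
  δₗ_unitality_inv d := by
    rw [Iso.eq_comp_inv, he, Iso.inv_comp_eq, μₗ_unitality F d, Category.assoc, ← F.map_comp]
    simp
  μₗ_comp_δₗ c d := by rw [← he, Iso.hom_inv_id]
  δₗ_comp_μₗ c d := by rw [← he, Iso.inv_hom_id]

/-- A functor isomorphic to a strong `C`-module functor is a strong `C`-module functor. -/
@[reducible]
noncomputable def leftLinearOfNatIso {F G : D ⥤ E} [F.LeftLinear C] (e : F ≅ G) : G.LeftLinear C :=
  leftLinearOfIso
    { μₗ := fun c d => c ⊴ₗ e.inv.app d ≫ μₗ F c d ≫ e.hom.app (c ⊙ₗ d)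
      μₗ_naturality_left := fun f d => by
        rw [← MonoidalLeftAction.action_exchange_assoc, μₗ_naturality_left_assoc]
        simp
      μₗ_naturality_right := fun c d d' f => by
        rw [← MonoidalLeftAction.actionHomRight_comp_assoc, e.inv.naturality,
          MonoidalLeftAction.actionHomRight_comp_assoc, μₗ_naturality_right_assoc]
        simp
      μₗ_associativity := fun c c' d => by
        simp only [Category.assoc, ← e.hom.naturality, μₗ_associativity_assoc,
          MonoidalLeftAction.tensor_actionHomRight, Iso.inv_hom_id_assoc,
          MonoidalLeftAction.actionHomRight_comp]
        rw [← MonoidalLeftAction.actionHomRight_comp_assoc c (e.hom.app (c' ⊙ₗ d))]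
        simp
      μₗ_unitality := fun d => by
        rw [Category.assoc, Category.assoc, ← e.hom.naturality, ← μₗ_unitality_assoc,
          ← MonoidalLeftAction.actionUnitIso_hom_naturality_assoc]
        simp }
    (fun c d => asIso (c ⊴ₗ e.inv.app d ≫ μₗ F c d ≫ e.hom.app (c ⊙ₗ d))) fun _ _ => rfl

/-- The composite of strong `C`-module functors is a strong `C`-module functor. -/
@[reducible]
def leftLinearComp (F : D ⥤ E) (G : E ⥤ B) [F.LeftLinear C] [G.LeftLinear C] :
    (F ⋙ G).LeftLinear C :=
  leftLinearOfIso
    { μₗ := fun c d => μₗ G c (F.obj d) ≫ G.map (μₗ F c d)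
      μₗ_naturality_left := fun f d => by
        dsimp
        rw [μₗ_naturality_left_assoc, ← G.map_comp, μₗ_naturality_left]
        simp
      μₗ_naturality_right := fun c d d' f => by
        dsimp
        rw [μₗ_naturality_right_assoc, ← G.map_comp, μₗ_naturality_right]
        simp
      μₗ_associativity := fun c c' d => by
        dsimp
        rw [Category.assoc, ← G.map_comp, μₗ_associativity, G.map_comp, μₗ_associativity_assoc,
          MonoidalLeftAction.actionHomRight_comp, Category.assoc, μₗ_naturality_right_assoc,
          G.map_comp]
      μₗ_unitality := fun d => by
        dsimp
        rw [Category.assoc, ← G.map_comp, ← μₗ_unitality, ← μₗ_unitality] }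
    (fun c d => μₗIso G c (F.obj d) ≪≫ G.mapIso (μₗIso F c d)) fun _ _ => rfl

/-- The identity functor is a strong `C`-module functor. -/
@[reducible]
def leftLinearId : (𝟭 D).LeftLinear C :=
  leftLinearOfIso
    { μₗ := fun c d => 𝟙 (c ⊙ₗ d)
      μₗ_naturality_left := fun f d => by simp
      μₗ_naturality_right := fun c d d' f => by simp
      μₗ_associativity := fun c c' d => by simp
      μₗ_unitality := fun d => by simp }
    (fun c d => Iso.refl _) fun _ _ => rfl

/-- A quasi-inverse of a strong `C`-module equivalence is a strong `C`-module functor. -/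
@[reducible]
noncomputable def leftLinearInverse (e : D ≌ E) [e.functor.LeftLinear C] : e.inverse.LeftLinear C :=
  letI l := rightAdjointLax (C := C) e.toAdjunction
  -- The lax structure of the quasi-inverse is a transpose built from the unit, the counit and `δₗ`
  -- of `e.functor`, all of which are invertible.
  have h (c : C) (m : E) : IsIso (μₗ e.inverse c m) := by
    change IsIso (e.toAdjunction.homEquiv _ _
      (δₗ e.functor c (e.inverse.obj m) ≫ c ⊴ₗ e.toAdjunction.counit.app m))
    rw [Adjunction.homEquiv_unit]
    infer_instance
  leftLinearOfIso l (fun c m => asIso (μₗ e.inverse c m)) fun _ _ => rfl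

end LeftLinear

/-! ### Extending an action along a functor -/

section ActionLift

variable {C : Type*} [Category* C] [MonoidalCategory C]
variable {K E : Type*} [Category* K] [Category* E] [MonoidalLeftAction C K]

variable (C) in
/-- Functors `A x : E ⥤ E` which extend the action of `C` on `K` along `J : K ⥤ E`, and belong to
a class of functors on which restriction along `J` is fully faithful. -/
structure ActionLift (J : K ⥤ E) (P : ObjectProperty (E ⥤ E)) where
  restricts : RestrictsFullyFaithfully J P
  prop_id : P (𝟭 E)
  prop_comp {G H : E ⥤ E} : P G → P H → P (G ⋙ H)
  A : C → E ⥤ E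
  prop (x : C) : P (A x)
  s (x : C) (X : K) : (A x).obj (J.obj X) ≅ J.obj (x ⊙ₗ X)
  s_naturality (x : C) {X Y : K} (f : X ⟶ Y) :
    (A x).map (J.map f) ≫ (s x Y).hom = (s x X).hom ≫ J.map (x ⊴ₗ f)

namespace ActionLift

variable {J : K ⥤ E} {P : ObjectProperty (E ⥤ E)} (Λ : ActionLift C J P)

theorem s_inv_naturality (x : C) {X Y : K} (f : X ⟶ Y) :
    J.map (x ⊴ₗ f) ≫ (Λ.s x Y).inv = (Λ.s x X).inv ≫ (Λ.A x).map (J.map f) := by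
  rw [Iso.comp_inv_eq, Category.assoc, s_naturality, Iso.inv_hom_id_assoc]

/-- Conjugation by the isomorphisms `s` prescribes the structure maps on the image of `J`, and
fullness of restriction extends them. By faithfulness the extension is unique, so choosing one costs
nothing. The associativity and unit isomorphisms arise in the same way. -/
theorem exists_homLeft {x y : C} (f : x ⟶ y) :
    ∃ α : Λ.A x ⟶ Λ.A y, ∀ X, α.app (J.obj X) ≫ (Λ.s y X).hom =
      (Λ.s x X).hom ≫ J.map (f ⊵ₗ X) := by
  obtain ⟨α, hα⟩ := Λ.restricts.exists_hom (Λ.prop x) (Λ.prop y)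
    (fun X => (Λ.s x X).hom ≫ J.map (f ⊵ₗ X) ≫ (Λ.s y X).inv) fun {X Y} g => by
      simp only [Category.assoc, reassoc_of% Λ.s_naturality, ← s_inv_naturality, ← J.map_comp_assoc,
        MonoidalLeftAction.action_exchange]
  exact ⟨α, fun X => by simp [hα]⟩

theorem exists_assocIso (x y : C) :
    ∃ α : Λ.A (x ⊗ y) ≅ Λ.A y ⋙ Λ.A x, ∀ X, α.hom.app (J.obj X) ≫
      (Λ.A x).map (Λ.s y X).hom ≫ (Λ.s x (y ⊙ₗ X)).hom =
      (Λ.s (x ⊗ y) X).hom ≫ J.map (αₗ x y X).hom := by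
  obtain ⟨α, hα⟩ := Λ.restricts.exists_iso (Λ.prop _) (Λ.prop_comp (Λ.prop y) (Λ.prop x))
    (fun X => Λ.s (x ⊗ y) X ≪≫ J.mapIso (αₗ x y X) ≪≫ (Λ.s x (y ⊙ₗ X)).symm ≪≫
      (Λ.A x).mapIso (Λ.s y X).symm) (fun {X Y} f => by
        simp only [Iso.trans_hom, Iso.symm_hom, Functor.mapIso_hom, Category.assoc,
          Functor.comp_map, reassoc_of% Λ.s_naturality, ← Functor.map_comp, ← s_inv_naturality]
        rw [(Λ.A x).map_comp, ← reassoc_of% Λ.s_inv_naturality, ← J.map_comp_assoc,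
          ← J.map_comp_assoc,
          MonoidalLeftAction.tensor_actionHomRight]
        simp only [Category.assoc, Iso.inv_hom_id, Category.comp_id])
  refine ⟨α, fun X => ?_⟩
  simp only [hα, Iso.trans_hom, Iso.symm_hom, Functor.mapIso_hom, Category.assoc,
    ← Functor.map_comp_assoc, Iso.inv_hom_id]
  simp

theorem exists_unitIso :
    ∃ α : Λ.A (𝟙_ C) ≅ 𝟭 E, ∀ X, α.hom.app (J.obj X) =
      (Λ.s (𝟙_ C) X).hom ≫ J.map (λₗ X).hom := by
  obtain ⟨α, hα⟩ := Λ.restricts.exists_iso (Λ.prop _) Λ.prop_id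
    (fun X => Λ.s (𝟙_ C) X ≪≫ J.mapIso (λₗ X)) (fun {X Y} f => by
      simp only [Iso.trans_hom, Functor.mapIso_hom, reassoc_of% Λ.s_naturality, Functor.id_map,
        Category.assoc, ← J.map_comp, MonoidalLeftAction.actionUnitIso_hom_naturality])
  exact ⟨α, fun X => hα X⟩

/-- The natural transformation of action functors given by a morphism of `C`. -/
noncomputable def L {x y : C} (f : x ⟶ y) : Λ.A x ⟶ Λ.A y := (Λ.exists_homLeft f).choose

@[simp]
theorem L_app {x y : C} (f : x ⟶ y) (X : K) : (Λ.L f).app (J.obj X) ≫ (Λ.s y X).hom =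
    (Λ.s x X).hom ≫ J.map (f ⊵ₗ X) := (Λ.exists_homLeft f).choose_spec X

@[simp]
theorem L_app_assoc {x y : C} (f : x ⟶ y) (X : K) {Z : E} (h : J.obj (y ⊙ₗ X) ⟶ Z) :
    (Λ.L f).app (J.obj X) ≫ (Λ.s y X).hom ≫ h = (Λ.s x X).hom ≫ J.map (f ⊵ₗ X) ≫ h := by
  rw [reassoc_of% (Λ.L_app f X)]

/-- The associativity isomorphism of the action functors. -/
noncomputable def a (x y : C) : Λ.A (x ⊗ y) ≅ Λ.A y ⋙ Λ.A x := (Λ.exists_assocIso x y).choose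

@[simp]
theorem a_app (x y : C) (X : K) : (Λ.a x y).hom.app (J.obj X) ≫
      (Λ.A x).map (Λ.s y X).hom ≫ (Λ.s x (y ⊙ₗ X)).hom =
      (Λ.s (x ⊗ y) X).hom ≫ J.map (αₗ x y X).hom := (Λ.exists_assocIso x y).choose_spec X

@[simp]
theorem a_app_assoc (x y : C) (X : K) {Z : E} (h : J.obj (x ⊙ₗ y ⊙ₗ X) ⟶ Z) :
    (Λ.a x y).hom.app (J.obj X) ≫ (Λ.A x).map (Λ.s y X).hom ≫ (Λ.s x (y ⊙ₗ X)).hom ≫ h =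
      (Λ.s (x ⊗ y) X).hom ≫ J.map (αₗ x y X).hom ≫ h := by
  rw [reassoc_of% (Λ.a_app x y X)]

/-- The unit isomorphism of the action functors. -/
noncomputable def unitIso : Λ.A (𝟙_ C) ≅ 𝟭 E := Λ.exists_unitIso.choose

@[simp]
theorem unitIso_app (X : K) : Λ.unitIso.hom.app (J.obj X) =
      (Λ.s (𝟙_ C) X).hom ≫ J.map (λₗ X).hom := Λ.exists_unitIso.choose_spec X

/-- In this law and the following ones both sides are transformations between functors satisfying
`P`, so they may be compared on the image of `J`. Composing with the isomorphisms `s` then leaves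
the corresponding law for the action on `K`. -/
theorem L_id (x : C) : Λ.L (𝟙 x) = 𝟙 _ :=
  Λ.restricts.hom_ext (Λ.prop x) (Λ.prop x) fun X => by
    rw [← cancel_mono ((Λ.s x X).hom)]
    simp

theorem L_comp {x y z : C} (f : x ⟶ y) (g : y ⟶ z) : Λ.L (f ≫ g) = Λ.L f ≫ Λ.L g :=
  Λ.restricts.hom_ext (Λ.prop x) (Λ.prop z) fun X => by
    rw [← cancel_mono (Λ.s z X).hom]
    simp

theorem L_whiskerLeft (x : C) {y z : C} (f : y ⟶ z) :
    Λ.L (x ◁ f) ≫ (Λ.a x z).hom = (Λ.a x y).hom ≫ Functor.whiskerRight (Λ.L f) (Λ.A x) :=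
  Λ.restricts.hom_ext (Λ.prop _) (Λ.prop_comp (Λ.prop _) (Λ.prop _)) fun X => by
    rw [← cancel_mono ((Λ.A x).map (Λ.s z X).hom ≫ (Λ.s x (z ⊙ₗ X)).hom)]
    dsimp
    simp only [Category.assoc, a_app, L_app_assoc]
    rw [← (Λ.A x).map_comp_assoc, L_app, (Λ.A x).map_comp_assoc, s_naturality, a_app_assoc,
      ← J.map_comp, ← J.map_comp]
    simp

theorem L_whiskerRight {x y : C} (z : C) (f : x ⟶ y) :
    Λ.L (f ▷ z) ≫ (Λ.a y z).hom = (Λ.a x z).hom ≫ Functor.whiskerLeft (Λ.A z) (Λ.L f) :=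
  Λ.restricts.hom_ext (Λ.prop _) (Λ.prop_comp (Λ.prop _) (Λ.prop _)) fun X => by
    rw [← cancel_mono ((Λ.A y).map (Λ.s z X).hom ≫ (Λ.s y (z ⊙ₗ X)).hom)]
    dsimp
    simp only [Category.assoc, a_app, L_app_assoc]
    rw [← NatTrans.naturality_assoc, L_app, a_app_assoc, ← J.map_comp, ← J.map_comp]
    simp

theorem L_associator (x y z : C) :
    Λ.L (α_ x y z).hom ≫ (Λ.a x (y ⊗ z)).hom ≫ Functor.whiskerRight (Λ.a y z).hom (Λ.A x) =
      (Λ.a (x ⊗ y) z).hom ≫ Functor.whiskerLeft (Λ.A z) (Λ.a x y).hom :=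
  Λ.restricts.hom_ext (Λ.prop _)
      (Λ.prop_comp (Λ.prop z) (Λ.prop_comp (Λ.prop y) (Λ.prop x))) fun X => by
    rw [← cancel_mono ((Λ.A x).map ((Λ.A y).map (Λ.s z X).hom ≫
      (Λ.s y (z ⊙ₗ X)).hom) ≫ (Λ.s x (y ⊙ₗ z ⊙ₗ X)).hom)]
    dsimp
    simp only [Category.assoc]
    rw [← (Λ.A x).map_comp_assoc, a_app, (Λ.A x).map_comp_assoc, (Λ.A x).map_comp_assoc,
      s_naturality, a_app_assoc, L_app_assoc]
    -- `Λ.a x y` is prescribed only on the image of `J`. Naturality along `Λ.s z X` moves its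
    -- component at `(Λ.A z).obj (J.obj X)` to one there.
    have h := (Λ.a x y).hom.naturality (Λ.s z X).hom
    dsimp at h
    rw [← reassoc_of% h, a_app, a_app_assoc, ← J.map_comp, ← J.map_comp, ← J.map_comp,
      ← MonoidalLeftAction.associator_actionHom]

theorem L_leftUnitor (x : C) :
    Λ.L (λ_ x).hom = (Λ.a (𝟙_ C) x).hom ≫ Functor.whiskerLeft (Λ.A x) Λ.unitIso.hom :=
  Λ.restricts.hom_ext (Λ.prop _) (Λ.prop _) fun X => by
    rw [← cancel_mono ((Λ.s x X).hom)]
    have h := Λ.unitIso.hom.naturality ((Λ.s x X).hom)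
    dsimp at h ⊢
    rw [Category.assoc, ← h, unitIso_app, a_app_assoc, L_app, ← J.map_comp]
    simp

theorem L_rightUnitor (x : C) :
    Λ.L (ρ_ x).hom = (Λ.a x (𝟙_ C)).hom ≫ Functor.whiskerRight Λ.unitIso.hom (Λ.A x) :=
  Λ.restricts.hom_ext (Λ.prop _) (Λ.prop _) fun X => by
    rw [← cancel_mono ((Λ.s x X).hom)]
    dsimp
    rw [Category.assoc, unitIso_app, (Λ.A x).map_comp_assoc, s_naturality, a_app_assoc, L_app,
      ← J.map_comp]
    simp

/-- The `C`-module structure on `E` given by an extension of the action functors. -/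
@[reducible]
noncomputable def action : MonoidalLeftAction C E where
  actionObj x m := (Λ.A x).obj m
  actionHomLeft f m := (Λ.L f).app m
  actionHomRight x _ _ f := (Λ.A x).map f
  actionAssocIso x y m := (Λ.a x y).app m
  actionUnitIso m := Λ.unitIso.app m
  actionHom_def _ _ := rfl
  actionHomRight_id x _ := (Λ.A x).map_id _
  id_actionHomLeft x m := congr_app (Λ.L_id x) m
  actionHom_comp f₁ f₂ g₁ g₂ := by simp [L_comp]
  actionAssocIso_hom_naturality {c₁ c₂ c₃ c₄ m n} f g h := by
    have h₁ := congr_app (Λ.L_whiskerRight c₃ f) m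
    have h₂ := congr_app (Λ.L_whiskerLeft c₂ g) m
    have h₃ := (Λ.a c₂ c₄).hom.naturality h
    dsimp at h₁ h₂ h₃ ⊢
    rw [MonoidalCategory.tensorHom_def, L_comp, NatTrans.comp_app, Category.assoc, Category.assoc, h₃,
      reassoc_of% h₂, reassoc_of% h₁, (Λ.A c₂).map_comp]
  actionUnitIso_hom_naturality f := (Λ.unitIso.hom.naturality f).symm
  whiskerLeft_actionHomLeft x y z f m := by
    have h₂ := congr_app (Λ.L_whiskerLeft x f) m
    dsimp at h₂ ⊢
    rw [← reassoc_of% h₂]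
    simp
  whiskerRight_actionHomLeft {x y} z f m := by
    have h₂ := congr_app (Λ.L_whiskerRight z f) m
    dsimp at h₂ ⊢
    rw [← reassoc_of% h₂]
    simp
  associator_actionHom x y z m := congr_app (Λ.L_associator x y z) m
  leftUnitor_actionHom x m := congr_app (Λ.L_leftUnitor x) m
  rightUnitor_actionHom x m := congr_app (Λ.L_rightUnitor x) m

/-- The functor along which the action was extended is a strong `C`-module functor. -/
@[reducible]
noncomputable def leftLinear : letI := Λ.action; J.LeftLinear C :=
  letI := Λ.action
  leftLinearOfIso {
    μₗ := fun x X => (Λ.s x X).hom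
    μₗ_naturality_left := fun f X => Λ.L_app f X
    μₗ_naturality_right := fun x _ _ f => Λ.s_naturality x f
    μₗ_associativity := fun x y X => (Λ.a_app x y X).symm
    μₗ_unitality := fun X => Λ.unitIso_app X }
    (fun x X => Λ.s x X) fun _ _ => rfl

end ActionLift

end ActionLift

/-! ### Extending strong module structures on functors -/

section ExtendLinear

variable {C : Type*} [Category* C] [MonoidalCategory C]
variable {K : Type*} [Category* K] [MonoidalLeftAction C K]
variable {E : Type*} [Category* E] [MonoidalLeftAction C E]
variable {B : Type*} [Category* B] [MonoidalLeftAction C B]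

open Functor.LaxLeftLinear Functor.OplaxLeftLinear Functor.LeftLinear

/-- If restriction along the strong `C`-module functor `J` is fully faithful on a suitable class of
functors containing `Φ`, then a strong `C`-module structure on `J ⋙ Φ` extends to `Φ`. -/
theorem exists_leftLinear_of_restrictsFullyFaithfully (J : K ⥤ E) (Φ : E ⥤ B)
    [J.LeftLinear C] (l : (J ⋙ Φ).LeftLinear C) {P : ObjectProperty (E ⥤ B)}
    (hJ : RestrictsFullyFaithfully J P) (h₀ : P Φ)
    (h₁ : ∀ x : C, P (Φ ⋙ MonoidalLeftAction.actionLeft B x))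
    (h₂ : ∀ x : C, P (MonoidalLeftAction.actionLeft E x ⋙ Φ))
    (h₃ : ∀ x y : C, P (MonoidalLeftAction.actionLeft E y ⋙
      MonoidalLeftAction.actionLeft E x ⋙ Φ)) :
    Nonempty (Φ.LeftLinear C) := by
  -- On the image of `J` the structure map of `Φ` is forced: it is that of `J ⋙ Φ` followed by `Φ`
  -- of the inverse structure map of `J`.
  have key (x : C) : ∃ α : Φ ⋙ MonoidalLeftAction.actionLeft B x ≅
      MonoidalLeftAction.actionLeft E x ⋙ Φ,
      ∀ X, α.hom.app (J.obj X) = μₗ (J ⋙ Φ) x X ≫ Φ.map (δₗ J x X) := by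
    refine hJ.exists_iso (h₁ x) (h₂ x)
      (fun X => μₗIso (J ⋙ Φ) x X ≪≫ Φ.mapIso (μₗIso J x X).symm) fun {X Y} f => ?_
    change x ⊴ₗ (J ⋙ Φ).map f ≫ μₗ (J ⋙ Φ) x Y ≫ Φ.map (δₗ J x Y) =
      (μₗ (J ⋙ Φ) x X ≫ Φ.map (δₗ J x X)) ≫ Φ.map (x ⊴ₗ J.map f)
    rw [μₗ_naturality_right_assoc, Category.assoc, Functor.comp_map, ← Φ.map_comp, ← Φ.map_comp,
      δₗ_naturality_right]
  choose α hα using key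
  let m (x : C) (e : E) : x ⊙ₗ Φ.obj e ≅ Φ.obj (x ⊙ₗ e) := (α x).app e
  have hm (x : C) (X : K) : (m x (J.obj X)).hom ≫ Φ.map (μₗ J x X) = μₗ (J ⋙ Φ) x X := by
    have h := hα x X
    change (m x (J.obj X)).hom = _ at h
    rw [h, Category.assoc, ← Φ.map_comp]
    simp
  have nat (x : C) {e e' : E} (f : e ⟶ e') :
      x ⊴ₗ Φ.map f ≫ (m x e').hom = (m x e).hom ≫ Φ.map (x ⊴ₗ f) := (α x).hom.naturality f
  -- Natural families between functors in `P` that agree on the image of `J` agree everywhere.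
  -- Naturality in the `C` variable, associativity and unitality all reduce through this to the same
  -- law for `J ⋙ Φ`.
  have ext {G H : E ⥤ B} (hG : P G) (hH : P H) (β γ : ∀ e, G.obj e ⟶ H.obj e)
      (hβ : ∀ {e e' : E} (f : e ⟶ e'), G.map f ≫ β e' = β e ≫ H.map f)
      (hγ : ∀ {e e' : E} (f : e ⟶ e'), G.map f ≫ γ e' = γ e ≫ H.map f)
      (h : ∀ X, β (J.obj X) = γ (J.obj X)) (e : E) : β e = γ e :=
    congr_app (hJ.hom_ext hG hH (α := ⟨β, fun _ _ f => hβ f⟩) (β := ⟨γ, fun _ _ f => hγ f⟩) h) e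
  refine ⟨leftLinearOfIso (F := Φ)
    { μₗ := fun x e => (m x e).hom
      μₗ_naturality_left := fun {x y} f e => ?_
      μₗ_naturality_right := fun x _ _ f => nat x f
      μₗ_associativity := fun x y e => ?_
      μₗ_unitality := fun e => ?_ } m fun _ _ => rfl⟩
  · refine ext (h₁ x) (h₂ y) (fun e => f ⊵ₗ Φ.obj e ≫ (m y e).hom)
      (fun e => (m x e).hom ≫ Φ.map (f ⊵ₗ e)) (fun {e e'} g => ?_) (fun {e e'} g => ?_)
      (fun X => ?_) e
    · change x ⊴ₗ Φ.map g ≫ f ⊵ₗ Φ.obj e' ≫ (m y e').hom =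
        (f ⊵ₗ Φ.obj e ≫ (m y e).hom) ≫ Φ.map (y ⊴ₗ g)
      rw [MonoidalLeftAction.action_exchange_assoc, nat, Category.assoc]
    · change x ⊴ₗ Φ.map g ≫ (m x e').hom ≫ Φ.map (f ⊵ₗ e') =
        ((m x e).hom ≫ Φ.map (f ⊵ₗ e)) ≫ Φ.map (y ⊴ₗ g)
      rw [reassoc_of% (nat x g), Category.assoc, ← Φ.map_comp, ← Φ.map_comp,
        MonoidalLeftAction.action_exchange]
    · change f ⊵ₗ Φ.obj (J.obj X) ≫ (m y (J.obj X)).hom =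
        (m x (J.obj X)).hom ≫ Φ.map (f ⊵ₗ J.obj X)
      rw [← cancel_mono (Φ.map (μₗ J y X)), Category.assoc, Category.assoc, hm, ← Φ.map_comp,
        μₗ_naturality_left, Φ.map_comp, reassoc_of% (hm x X)]
      exact μₗ_naturality_left (J ⋙ Φ) f X
  -- The common target of the two sides is the twofold action followed by `Φ`; this is the role of
  -- `h₃`.
  · refine ext (h₁ (x ⊗ y)) (h₃ x y) (fun e => (m (x ⊗ y) e).hom ≫ Φ.map (αₗ x y e).hom)
      (fun e => (αₗ x y (Φ.obj e)).hom ≫ x ⊴ₗ (m y e).hom ≫ (m x (y ⊙ₗ e)).hom)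
      (fun {e e'} g => ?_) (fun {e e'} g => ?_) (fun X => ?_) e
    · change (x ⊗ y) ⊴ₗ Φ.map g ≫ (m (x ⊗ y) e').hom ≫ Φ.map (αₗ x y e').hom =
        ((m (x ⊗ y) e).hom ≫ Φ.map (αₗ x y e).hom) ≫ Φ.map (x ⊴ₗ y ⊴ₗ g)
      rw [reassoc_of% (nat (x ⊗ y) g), Category.assoc, ← Φ.map_comp, ← Φ.map_comp,
        MonoidalLeftAction.tensor_actionHomRight]
      simp
    · change (x ⊗ y) ⊴ₗ Φ.map g ≫ (αₗ x y (Φ.obj e')).hom ≫ x ⊴ₗ (m y e').hom ≫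
          (m x (y ⊙ₗ e')).hom =
        ((αₗ x y (Φ.obj e)).hom ≫ x ⊴ₗ (m y e).hom ≫ (m x (y ⊙ₗ e)).hom) ≫ Φ.map (x ⊴ₗ y ⊴ₗ g)
      rw [MonoidalLeftAction.tensor_actionHomRight, Category.assoc, Category.assoc,
        Category.assoc, Iso.inv_hom_id_assoc, Category.assoc, ← nat x (y ⊴ₗ g),
        ← MonoidalLeftAction.actionHomRight_comp_assoc,
        ← MonoidalLeftAction.actionHomRight_comp_assoc, nat]
    · change (m (x ⊗ y) (J.obj X)).hom ≫ Φ.map (αₗ x y (J.obj X)).hom =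
        (αₗ x y (Φ.obj (J.obj X))).hom ≫ x ⊴ₗ (m y (J.obj X)).hom ≫ (m x (y ⊙ₗ J.obj X)).hom
      rw [← cancel_mono (Φ.map (x ⊴ₗ μₗ J y X ≫ μₗ J x (y ⊙ₗ X))), Category.assoc,
        ← Φ.map_comp, ← μₗ_associativity, Φ.map_comp, reassoc_of% (hm (x ⊗ y) X),
        Category.assoc, Category.assoc, Φ.map_comp, ← reassoc_of% (nat x (μₗ J y X)), hm,
        ← MonoidalLeftAction.actionHomRight_comp_assoc, hm]
      exact μₗ_associativity (J ⋙ Φ) x y X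
  · refine ext (h₁ (𝟙_ C)) h₀ (fun e => (λₗ[C] (Φ.obj e)).hom)
      (fun e => (m (𝟙_ C) e).hom ≫ Φ.map (λₗ e).hom)
      (fun {e e'} g => ?_) (fun {e e'} g => ?_) (fun X => ?_) e
    · exact (MonoidalLeftAction.actionUnitIso_hom_naturality _).symm
    · change 𝟙_ C ⊴ₗ Φ.map g ≫ (m (𝟙_ C) e').hom ≫ Φ.map (λₗ e').hom =
        ((m (𝟙_ C) e).hom ≫ Φ.map (λₗ e).hom) ≫ Φ.map g
      rw [reassoc_of% (nat (𝟙_ C) g), Category.assoc, ← Φ.map_comp, ← Φ.map_comp,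
        MonoidalLeftAction.actionUnitIso_hom_naturality]
    · change (λₗ[C] (Φ.obj (J.obj X))).hom = (m (𝟙_ C) (J.obj X)).hom ≫ Φ.map (λₗ (J.obj X)).hom
      rw [μₗ_unitality J X, Φ.map_comp, reassoc_of% (hm (𝟙_ C) X)]
      exact μₗ_unitality (J ⋙ Φ) X

end ExtendLinear

/-! ### Equivalence of module categories is an equivalence relation -/

section Equivalent

variable {k : Type*} [Field k] {C : Type u} [Category.{v} C] [Abelian C] [Linear k C]
  [MonoidalCategory C]

namespace ModCat

theorem Equivalent.refl (M : ModCat.{w₂, w₁} k C) : M.Equivalent M :=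
  ⟨CategoryTheory.Equivalence.refl, inferInstanceAs (𝟭 M.carrier).Additive,
    inferInstanceAs ((𝟭 M.carrier).Linear k), ⟨leftLinearId⟩⟩

theorem Equivalent.symm {M : ModCat.{w₂, w₁} k C} {N : ModCat.{w₂', w₁'} k C}
    (h : M.Equivalent N) : N.Equivalent M := by
  obtain ⟨e, _, _, ⟨_⟩⟩ := h
  exact ⟨e.symm, inferInstanceAs e.inverse.Additive, inferInstanceAs (e.inverse.Linear k),
    ⟨leftLinearInverse e⟩⟩

theorem Equivalent.trans {M : ModCat.{w₂, w₁} k C} {N : ModCat.{w₂', w₁'} k C} {L : ModCat k C}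
    (h : M.Equivalent N) (h' : N.Equivalent L) : M.Equivalent L := by
  obtain ⟨e, _, _, ⟨_⟩⟩ := h
  obtain ⟨f, _, _, ⟨_⟩⟩ := h'
  exact ⟨e.trans f, inferInstanceAs (e.functor ⋙ f.functor).Additive,
    inferInstanceAs ((e.functor ⋙ f.functor).Linear k), ⟨leftLinearComp e.functor f.functor⟩⟩

end ModCat

end Equivalent

/-! ### Colimits of right exact functors -/

section PreservesColimit

variable {K J E B : Type*} [Category* K] [Category* J] [Category* E] [Category* B]

/-- Linton pairs occur in two forms, as images of Kleisli arrows and as explicit morphisms of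
algebras. This transports a coequaliser from one form to the other. -/
theorem nonempty_isColimit_cofork_congr {X Y Z : E} {f f' g g' : X ⟶ Y} {π : Y ⟶ Z} (hf : f = f')
    (hg : g = g') {w : f ≫ π = g ≫ π} (h : IsColimit (Cofork.ofπ π w)) (w' : f' ≫ π = g' ≫ π) :
    Nonempty (IsColimit (Cofork.ofπ π w')) := by
  subst hf hg
  exact ⟨h⟩

/-- A colimit of functors which preserve colimits of shape `K` preserves colimits of shape `K`. -/
theorem preservesColimitsOfShape_of_isColimit [HasColimitsOfShape J B] {F : J ⥤ E ⥤ B}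
    {c : Cocone F} (hc : IsColimit c) [∀ j, PreservesColimitsOfShape K (F.obj j)] :
    PreservesColimitsOfShape K c.pt := by
  -- The colimit is `F.flip` followed by `colim`. The first preserves colimits of shape `K` because
  -- each `F.obj j` does, the second because it is a left adjoint.
  have : PreservesColimitsOfShape K F.flip := ⟨fun {_} => ⟨fun {_} hd =>
    ⟨evaluationJointlyReflectsColimits _ fun j => isColimitOfPreserves (F.obj j) hd⟩⟩⟩
  let e : F.flip ⋙ colim ≅ c.pt := NatIso.ofComponents (fun X =>
    (colimit.isColimit (F.flip.obj X)).coconePointUniqueUpToIso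
      (isColimitOfPreserves ((evaluation E B).obj X) hc)) (fun {X Y} f => by
    apply colimit.hom_ext
    intro j
    simp [IsColimit.coconePointUniqueUpToIso])
  exact preservesColimitsOfShape_of_natIso e

/-- A pointwise coequaliser of right exact functors is right exact. -/
theorem preservesFiniteColimits_of_isColimit_cofork [HasCoequalizers B] {F G A : E ⥤ B}
    {α β : F ⟶ G} {π : G ⟶ A} (w : α ≫ π = β ≫ π)
    (h : ∀ m, Nonempty (IsColimit (Cofork.ofπ (π.app m) (congr_app w m))))
    (hF : PreservesFiniteColimits F) (hG : PreservesFiniteColimits G) :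
    PreservesFiniteColimits A where
  preservesFiniteColimits K _ _ := by
    have (j : WalkingParallelPair) : PreservesColimitsOfShape K ((parallelPair α β).obj j) := by
      cases j
      · exact inferInstanceAs (PreservesColimitsOfShape K F)
      · exact inferInstanceAs (PreservesColimitsOfShape K G)
    have hc : IsColimit (Cofork.ofπ π w) := evaluationJointlyReflectsColimits _ fun m =>
      (isColimitMapCoconeCoforkEquiv ((evaluation E B).obj m) w).symm (h m).some
    exact preservesColimitsOfShape_of_isColimit hc

end PreservesColimit

/-! ### Algebras as coequalisers of Kleisli arrows -/

section AlgebraExtension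

variable {D : Type*} [Category* D] (T : Monad D) {B : Type*} [Category* B]

/-- The morphism of the Kleisli category given by a morphism of the base category. -/
def kleisliMap {X Y : D} (f : X ⟶ Y) : Kleisli.mk T X ⟶ Kleisli.mk T Y :=
  (Kleisli.Adjunction.toKleisli T).map f

/-- The morphism `T X ⟶ X` of the Kleisli category given by the identity of `T X`. -/
def kleisliCounit (X : D) : Kleisli.mk T (T.obj X) ⟶ Kleisli.mk T X := .mk (𝟙 (T.obj X))

@[simp]
theorem kleisliMap_id (X : D) : kleisliMap T (𝟙 X) = 𝟙 _ :=
  (Kleisli.Adjunction.toKleisli T).map_id X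

theorem kleisliMap_comp {X Y Z : D} (f : X ⟶ Y) (g : Y ⟶ Z) :
    kleisliMap T (f ≫ g) = kleisliMap T f ≫ kleisliMap T g :=
  (Kleisli.Adjunction.toKleisli T).map_comp f g

theorem kleisliToAlgebra_map_kleisliMap {X Y : D} (f : X ⟶ Y) :
    (kleisliToAlgebra T).map (kleisliMap T f) = T.free.map f := by
  ext
  change T.map (f ≫ T.η.app Y) ≫ T.μ.app Y = T.map f
  rw [T.map_comp, Category.assoc, T.right_unit]
  exact Category.comp_id _

/-- The structure map of an algebra, as a morphism from the image of the Kleisli category. -/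
def presentation (m : T.Algebra) : (kleisliToAlgebra T).obj (.mk T m.A) ⟶ m := algebraCounit m

/-- With this, the multiplication leg of the canonical presentation comes from a Kleisli arrow; the
other leg comes from the base category. -/
theorem kleisliToAlgebra_map_kleisliCounit (X : D) :
    (kleisliToAlgebra T).map (kleisliCounit T X) =
      presentation T ((kleisliToAlgebra T).obj (.mk T X)) := by
  ext
  change T.map (𝟙 _) ≫ T.μ.app X = T.μ.app X
  rw [T.map_id, Category.id_comp]

theorem kleisliMap_comp_kleisliCounit {X : D} {Y : Kleisli T} (f : X ⟶ T.obj Y.of) :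
    kleisliMap T f ≫ kleisliCounit T Y.of = (Kleisli.Hom.mk f : Kleisli.mk T X ⟶ Y) :=
  Kleisli.hom_ext ((toKleisli_map_comp_of T f (kleisliCounit T Y.of)).trans (Category.comp_id f))

theorem kleisliCounit_naturality {X Y : D} (f : X ⟶ Y) :
    kleisliMap T (T.map f) ≫ kleisliCounit T Y = kleisliCounit T X ≫ kleisliMap T f := by
  apply Kleisli.hom_ext
  refine (toKleisli_map_comp_of T (T.map f) (kleisliCounit T Y)).trans
    (Eq.trans ?_ (comp_toKleisli_map_of T (kleisliCounit T X) f).symm)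
  exact (Category.comp_id _).trans (Category.id_comp _).symm

/-- Needed to make the isomorphism of `exists_extension` natural: the counit is compatible with
every Kleisli arrow, not only with those from the base, once `f` acts on `T X` through its morphism
of free algebras. -/
theorem kleisliCounit_comp {X Y : Kleisli T} (f : X ⟶ Y) :
    kleisliMap T (T.map f.of ≫ T.μ.app Y.of) ≫ kleisliCounit T Y.of = kleisliCounit T X.of ≫ f := by
  refine (kleisliMap_comp_kleisliCounit T _).trans (Kleisli.hom_ext ?_)
  exact (Category.id_comp (T.map f.of ≫ T.μ.app Y.of)).symm

theorem kleisliToAlgebra_map_comp_presentation {m n : T.Algebra} (f : m ⟶ n) :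
    (kleisliToAlgebra T).map (kleisliMap T f.f) ≫ presentation T n = presentation T m ≫ f := by
  rw [kleisliToAlgebra_map_kleisliMap]
  exact Monad.Algebra.Hom.ext f.h

theorem presentation_condition (m : T.Algebra) :
    (kleisliToAlgebra T).map (kleisliMap T m.a) ≫ presentation T m =
      (kleisliToAlgebra T).map (kleisliCounit T m.A) ≫ presentation T m := by
  rw [kleisliToAlgebra_map_kleisliMap, kleisliToAlgebra_map_kleisliCounit]
  exact Monad.FreeCoequalizer.condition m

/-- Every algebra is the coequaliser of free algebras. -/
theorem nonempty_isColimit_presentation (m : T.Algebra) :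
    Nonempty (IsColimit (Cofork.ofπ (presentation T m) (presentation_condition T m))) :=
  nonempty_isColimit_cofork_congr (kleisliToAlgebra_map_kleisliMap T m.a).symm
    (kleisliToAlgebra_map_kleisliCounit T m.A).symm (Monad.beckAlgebraCoequalizer m) _

/-- A natural transformation between functors on the Eilenberg-Moore category whose source is right
exact is determined by its restriction to the Kleisli category, which is arbitrary. -/
theorem kleisliToAlgebra_restrictsFullyFaithfully :
    RestrictsFullyFaithfully (kleisliToAlgebra T)
      (fun G : T.Algebra ⥤ B => PreservesFiniteColimits G) := by
  intro G H hG _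
  -- Right exactness of the source `G` keeps the presentation of `m` a coequaliser, so `G.map
  -- (presentation T m)` detects equality and allows descent.
  have hc (m : T.Algebra) :=
    isColimitCoforkMapOfIsColimit G _ (nonempty_isColimit_presentation T m).some
  have epi (m : T.Algebra) : Epi (G.map (presentation T m)) :=
    Cofork.IsColimit.epi (hc m)
  constructor
  · intro α β h
    ext m
    rw [← cancel_epi (G.map (presentation T m)), α.naturality, β.naturality]
    exact congrArg (· ≫ H.map _) (congr_app h (Kleisli.mk T m.A))
  · intro α
    let a (X : Kleisli T) :
      G.obj ((kleisliToAlgebra T).obj X) ⟶ H.obj ((kleisliToAlgebra T).obj X) := α.app X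
    have w {X Y : Kleisli T} (f : X ⟶ Y) :
        G.map ((kleisliToAlgebra T).map f) ≫ a Y =
          a X ≫ H.map ((kleisliToAlgebra T).map f) := α.naturality f
    -- Both legs of the pair are images of Kleisli arrows, where `α` is natural; they become equal
    -- after `H` of the presentation.
    have hw (m : T.Algebra) : G.map ((kleisliToAlgebra T).map (kleisliMap T m.a)) ≫
        a (.mk T m.A) ≫ H.map (presentation T m) =
        G.map ((kleisliToAlgebra T).map (kleisliCounit T m.A)) ≫
          a (.mk T m.A) ≫ H.map (presentation T m) := by
      rw [reassoc_of% (w (kleisliMap T m.a)), reassoc_of% (w (kleisliCounit T m.A)),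
        ← H.map_comp, ← H.map_comp, presentation_condition]
    have hβ' (m : T.Algebra) : ∃ β, G.map (presentation T m) ≫ β =
        a (.mk T m.A) ≫ H.map (presentation T m) :=
      ⟨_, (Cofork.IsColimit.desc' (hc m) _ (hw m)).2⟩
    choose β hβ using hβ'
    refine ⟨{ app := β, naturality := fun m n f => ?_ }, ?_⟩
    · rw [← cancel_epi (G.map (presentation T m)), ← G.map_comp_assoc,
        ← kleisliToAlgebra_map_comp_presentation, G.map_comp_assoc, hβ, reassoc_of% (hβ m),
        ← H.map_comp, ← kleisliToAlgebra_map_comp_presentation, H.map_comp, reassoc_of% w]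
    · ext X
      -- The presentation of a free algebra is the image of a counit, so naturality of `α` there
      -- identifies the descended component with the given one.
      have h := w (kleisliCounit T X.of)
      rw [kleisliToAlgebra_map_kleisliCounit] at h
      exact (cancel_epi (G.map (presentation T ((kleisliToAlgebra T).obj X)))).1
        ((hβ ((kleisliToAlgebra T).obj X)).trans h.symm)

end AlgebraExtension

/-! ### Extending functors from the Kleisli category to algebras -/

section AlgebraFunctor

variable {D : Type*} [Category* D] (T : Monad D) {B : Type*} [Category* B]
  (G : Kleisli T ⥤ B)

/-- The composite of `G` with the functor to the Kleisli category, on algebras. -/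
def onCarrier : T.Algebra ⥤ B where
  obj m := G.obj (.mk T m.A)
  map f := G.map (kleisliMap T f.f)
  map_id _ := (congrArg G.map (kleisliMap_id T _)).trans (G.map_id _)
  map_comp f g := (congrArg G.map (kleisliMap_comp T f.f g.f)).trans (G.map_comp _ _)

/-- The composite of `G` with the functor to the Kleisli category and `T`, on algebras. -/
def onFreeCarrier : T.Algebra ⥤ B where
  obj m := G.obj (.mk T (T.obj m.A))
  map f := G.map (kleisliMap T (T.map f.f))
  map_id m := (congrArg (fun t => G.map (kleisliMap T t)) (T.map_id m.A)).trans
    ((congrArg G.map (kleisliMap_id T _)).trans (G.map_id _))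
  map_comp f g := (congrArg (fun t => G.map (kleisliMap T t)) (T.map_comp f.f g.f)).trans
    ((congrArg G.map (kleisliMap_comp T _ _)).trans (G.map_comp _ _))

/-- The first of the two natural transformations whose coequaliser extends `G` to algebras. -/
def lintonLeft : onFreeCarrier T G ⟶ onCarrier T G where
  app m := G.map (kleisliMap T m.a)
  naturality m n f := by
    change G.map (kleisliMap T (T.map f.f)) ≫ G.map (kleisliMap T n.a) =
      G.map (kleisliMap T m.a) ≫ G.map (kleisliMap T f.f)
    rw [← G.map_comp, ← kleisliMap_comp, ← G.map_comp, ← kleisliMap_comp, f.h]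

/-- The second of the two natural transformations whose coequaliser extends `G` to algebras. -/
def lintonRight : onFreeCarrier T G ⟶ onCarrier T G where
  app m := G.map (kleisliCounit T m.A)
  naturality m n f := by
    change G.map (kleisliMap T (T.map f.f)) ≫ G.map (kleisliCounit T n.A) =
      G.map (kleisliCounit T m.A) ≫ G.map (kleisliMap T f.f)
    rw [← G.map_comp, kleisliCounit_naturality, G.map_comp]

variable {T G}

/-- `T.forget` creates the colimits that `T` preserves, so it is right exact, and the functor is
`T.forget` followed by a right exact one. -/
theorem onCarrier_preservesFiniteColimits [PreservesFiniteColimits T.toFunctor] [HasFiniteColimits D]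
    (hG : PreservesFiniteColimits (Kleisli.Adjunction.toKleisli T ⋙ G)) :
    PreservesFiniteColimits (onCarrier T G) :=
  have : PreservesFiniteColimits T.forget := ⟨fun _ _ _ => inferInstance⟩
  inferInstanceAs (PreservesFiniteColimits (T.forget ⋙ Kleisli.Adjunction.toKleisli T ⋙ G))

theorem onFreeCarrier_preservesFiniteColimits [PreservesFiniteColimits T.toFunctor]
    [HasFiniteColimits D] (hG : PreservesFiniteColimits (Kleisli.Adjunction.toKleisli T ⋙ G)) :
    PreservesFiniteColimits (onFreeCarrier T G) :=
  have : PreservesFiniteColimits T.forget := ⟨fun _ _ _ => inferInstance⟩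
  inferInstanceAs (PreservesFiniteColimits
    (T.forget ⋙ T.toFunctor ⋙ Kleisli.Adjunction.toKleisli T ⋙ G))

/-- A functor on algebras given by Linton coequalisers is right exact. -/
theorem preservesFiniteColimits_of_linton [PreservesFiniteColimits T.toFunctor]
    [HasFiniteColimits D] [HasCoequalizers B]
    (hG : PreservesFiniteColimits (Kleisli.Adjunction.toKleisli T ⋙ G)) {A : T.Algebra ⥤ B}
    {π : onCarrier T G ⟶ A} (w : lintonLeft T G ≫ π = lintonRight T G ≫ π)
    (h : ∀ m, Nonempty (IsColimit (Cofork.ofπ (π.app m) (congr_app w m)))) :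
    PreservesFiniteColimits A :=
  preservesFiniteColimits_of_isColimit_cofork w h (onFreeCarrier_preservesFiniteColimits hG)
    (onCarrier_preservesFiniteColimits hG)

/-- This is `kleisliCounit_comp` for the arrow `kleisliCounit` itself; it makes the cofork on a free
algebra commute. -/
theorem kleisliMap_μ_comp_kleisliCounit (T : Monad D) (X : Kleisli T) :
    kleisliMap T (T.μ.app X.of) ≫ kleisliCounit T X.of =
      kleisliCounit T (T.obj X.of) ≫ kleisliCounit T X.of :=
  Eq.trans (congrArg (kleisliMap T · ≫ kleisliCounit T X.of)
    ((Category.id_comp _).symm.trans (congrArg (· ≫ T.μ.app X.of) (T.map_id _).symm)))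
    (kleisliCounit_comp T (kleisliCounit T X.of))

/-- The coequaliser which defines an extension to algebras is split on free algebras. -/
def isColimitKleisliCounit (G : Kleisli T ⥤ B) (X : Kleisli T)
    (w : G.map (kleisliMap T (T.μ.app X.of)) ≫ G.map (kleisliCounit T X.of) =
      G.map (kleisliCounit T (T.obj X.of)) ≫ G.map (kleisliCounit T X.of)) :
    IsColimit (Cofork.ofπ (G.map (kleisliCounit T X.of)) w) :=
  -- The splitting data: `η` is a section of the counit (`h₁`), and `T η` is a section of the leg
  -- `μ` (`h₃`), compatible with the other leg (`h₂`).
  have h₁ : kleisliMap T (T.η.app X.of) ≫ kleisliCounit T X.of = 𝟙 X :=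
    kleisliMap_comp_kleisliCounit T (Y := X) _
  have h₂ : kleisliMap T (T.map (T.η.app X.of)) ≫ kleisliCounit T (T.obj X.of) =
      kleisliCounit T X.of ≫ kleisliMap T (T.η.app X.of) :=
    kleisliCounit_naturality T (T.η.app X.of)
  have h₃ : kleisliMap T (T.map (T.η.app X.of)) ≫ kleisliMap T (T.μ.app X.of) = 𝟙 _ :=
    (kleisliMap_comp T _ _).symm.trans
      ((congrArg (kleisliMap T) (T.right_unit X.of)).trans (kleisliMap_id T _))
  Cofork.IsColimit.mk _ (fun s => G.map (kleisliMap T (T.η.app X.of)) ≫ s.π)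
    (fun s => by
      change G.map (kleisliCounit T X.of) ≫ G.map (kleisliMap T (T.η.app X.of)) ≫ s.π = s.π
      rw [← G.map_comp_assoc, ← h₂, G.map_comp_assoc, ← s.condition, ← G.map_comp_assoc, h₃]
      exact (congrArg (· ≫ s.π) (G.map_id _)).trans (Category.id_comp _))
    (fun s m hm => by
      change G.map (kleisliCounit T X.of) ≫ m = s.π at hm
      rw [← hm, ← G.map_comp_assoc]
      exact ((congrArg (G.map · ≫ m) h₁).trans (by simp)).symm)

/-- A functor on the Kleisli category which is right exact on the base category extends to a right
exact functor on algebras. -/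
theorem exists_extension [PreservesFiniteColimits T.toFunctor] [HasFiniteColimits D]
    [HasCoequalizers B] (hG : PreservesFiniteColimits (Kleisli.Adjunction.toKleisli T ⋙ G)) :
    ∃ A : T.Algebra ⥤ B, PreservesFiniteColimits A ∧ Nonempty (kleisliToAlgebra T ⋙ A ≅ G) := by
  let c := coequalizer.π (lintonLeft T G) (lintonRight T G)
  have w := coequalizer.condition (lintonLeft T G) (lintonRight T G)
  -- The coequaliser of functors is computed pointwise, so its value at `m` is the coequaliser of
  -- the Linton pair.
  have hc (m : T.Algebra) : IsColimit (Cofork.ofπ (c.app m) (congr_app w m)) :=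
    isColimitCoforkMapOfIsColimit ((evaluation T.Algebra B).obj m) _
      (coequalizerIsCoequalizer (lintonLeft T G) (lintonRight T G))
  have w' (X : Kleisli T) := (G.map_comp _ _).symm.trans
    ((congrArg G.map (kleisliMap_μ_comp_kleisliCounit T X)).trans (G.map_comp _ _))
  -- At a free algebra the pair is the split one above, whose coequaliser is `G.obj X`.
  have he' (X : Kleisli T) : ∃ e : (coequalizer (lintonLeft T G) (lintonRight T G)).obj
      ((kleisliToAlgebra T).obj X) ≅ G.obj X,
      c.app ((kleisliToAlgebra T).obj X) ≫ e.hom = G.map (kleisliCounit T X.of) :=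
    ⟨(hc ((kleisliToAlgebra T).obj X)).coconePointUniqueUpToIso
      (isColimitKleisliCounit G X (w' X)),
      (hc ((kleisliToAlgebra T).obj X)).comp_coconePointUniqueUpToIso_hom
        (isColimitKleisliCounit G X (w' X)) .one⟩
  choose e he using he'
  refine ⟨coequalizer (lintonLeft T G) (lintonRight T G),
    preservesFiniteColimits_of_linton hG w fun m => ⟨hc m⟩,
    ⟨NatIso.ofComponents e fun {X Y} f => ?_⟩⟩
  have : Epi (c.app ((kleisliToAlgebra T).obj X)) := Cofork.IsColimit.epi (hc _)
  rw [← cancel_epi (c.app ((kleisliToAlgebra T).obj X)), reassoc_of% (he X)]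
  refine (c.naturality_assoc ((kleisliToAlgebra T).map f) (e Y).hom).symm.trans ?_
  rw [he Y]
  exact (G.map_comp _ _).symm.trans
    ((congrArg G.map (kleisliCounit_comp T f)).trans (G.map_comp _ _))

end AlgebraFunctor

/-! ### Linton coequalisers and right exact actions on algebras -/

section AlgebraAction

variable {C : Type*} [Category* C] [MonoidalCategory C] {D : Type*} [Category* D]
  [MonoidalLeftAction C D] (T : Monad D) [LaxModuleMonad C T]

open Functor.LaxLeftLinear Functor.OplaxLeftLinear Functor.LeftLinear

/-- The functor `X ↦ T (x ▷ X)` from the Kleisli category to algebras. -/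
abbrev kleisliAct (x : C) : Kleisli T ⥤ T.Algebra :=
  MonoidalLeftAction.actionLeft (Kleisli T) x ⋙ kleisliToAlgebra T

theorem kleisliAct_map_kleisliMap (x : C) {X Y : D} (f : X ⟶ Y) :
    (kleisliAct T x).map (kleisliMap T f) = T.free.map (x ⊴ₗ f) :=
  (congrArg (kleisliToAlgebra T).map (kleisli_actionHomRight_toKleisli_map T x f)).trans
    (kleisliToAlgebra_map_kleisliMap T (x ⊴ₗ f))

theorem kleisliToAlgebra_map_actionHomLeft {x y : C} (f : x ⟶ y) (X : D) :
    (kleisliToAlgebra T).map (f ⊵ₗ Kleisli.mk T X) = T.free.map (f ⊵ₗ X) :=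
  kleisliToAlgebra_map_kleisliMap T (f ⊵ₗ X)

/-- Links the two descriptions of the second Linton arrow: `x ▷ -` of a leg of the presentation, and
the lax structure of `T` followed by the multiplication. -/
theorem kleisliAct_map_kleisliCounit (x : C) (X : D) :
    (kleisliAct T x).map (kleisliCounit T X) =
      (kleisliToAlgebra T).map (X := .mk T (x ⊙ₗ T.obj X)) (Y := .mk T (x ⊙ₗ X))
        (.mk (μₗ T.toFunctor x X)) := by
  refine congrArg (kleisliToAlgebra T).map (Kleisli.hom_ext ?_)
  change x ⊴ₗ 𝟙 (T.obj X) ≫ μₗ T.toFunctor x X = μₗ T.toFunctor x X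
  rw [MonoidalLeftAction.actionHomRight_id, Category.id_comp]

/-- On base arrows the Kleisli action is the action on `D`, so the composite is `x ▷ -` followed by
the free functor, a left adjoint. -/
theorem toKleisli_comp_kleisliAct_preservesFiniteColimits (x : C)
    (hx : PreservesFiniteColimits (MonoidalLeftAction.actionLeft D x)) :
    PreservesFiniteColimits (Kleisli.Adjunction.toKleisli T ⋙ kleisliAct T x) := by
  have : PreservesFiniteColimits T.free :=
    ⟨fun _ _ _ => have := T.adj.leftAdjoint_preservesColimits; inferInstance⟩
  let e : MonoidalLeftAction.actionLeft D x ⋙ T.free ≅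
      Kleisli.Adjunction.toKleisli T ⋙ kleisliAct T x :=
    NatIso.ofComponents (fun X => Iso.refl (T.free.obj (x ⊙ₗ X))) fun f =>
      (Category.comp_id _).trans ((kleisliAct_map_kleisliMap T x f).symm.trans
        (Category.id_comp _).symm)
  exact ⟨fun _ _ _ => preservesColimitsOfShape_of_natIso e⟩

variable [MonoidalLeftAction C T.Algebra] [(kleisliToAlgebra T).LeftLinear C]

/-- The canonical morphism `T (x ▷ m) ≅ x ▷ T m ⟶ x ▷ m`. -/
def actionPresentation (x : C) (m : T.Algebra) :
    (kleisliToAlgebra T).obj (x ⊙ₗ Kleisli.mk T m.A) ⟶ x ⊙ₗ m :=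
  δₗ (kleisliToAlgebra T) x (.mk T m.A) ≫ x ⊴ₗ presentation T m

theorem actionPresentation_naturality_left {x y : C} (f : x ⟶ y) (m : T.Algebra) :
    (kleisliToAlgebra T).map (f ⊵ₗ Kleisli.mk T m.A) ≫ actionPresentation T y m =
      actionPresentation T x m ≫ f ⊵ₗ m := by
  rw [actionPresentation, actionPresentation, δₗ_naturality_left_assoc, Category.assoc,
    MonoidalLeftAction.action_exchange]

theorem actionPresentation_naturality_right (x : C) {m n : T.Algebra} (f : m ⟶ n) :
    (kleisliToAlgebra T).map (x ⊴ₗ kleisliMap T f.f) ≫ actionPresentation T x n =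
      actionPresentation T x m ≫ x ⊴ₗ f := by
  rw [actionPresentation, actionPresentation, δₗ_naturality_right_assoc, Category.assoc,
    ← MonoidalLeftAction.actionHomRight_comp, ← MonoidalLeftAction.actionHomRight_comp,
    kleisliToAlgebra_map_comp_presentation]

theorem actionPresentation_condition (x : C) (m : T.Algebra) :
    (kleisliToAlgebra T).map (x ⊴ₗ kleisliMap T m.a) ≫ actionPresentation T x m =
      (kleisliToAlgebra T).map (x ⊴ₗ kleisliCounit T m.A) ≫ actionPresentation T x m := by
  rw [actionPresentation, δₗ_naturality_right_assoc, δₗ_naturality_right_assoc,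
    ← MonoidalLeftAction.actionHomRight_comp, ← MonoidalLeftAction.actionHomRight_comp,
    presentation_condition]

/-- The canonical morphisms are Linton coequalisers when the action is right exact. -/
theorem nonempty_isColimit_actionPresentation (x : C)
    (hx : PreservesFiniteColimits (MonoidalLeftAction.actionLeft T.Algebra x)) (m : T.Algebra) :
    Nonempty (IsColimit (Cofork.ofπ (actionPresentation T x m)
      (actionPresentation_condition T x m))) := by
  obtain ⟨h⟩ := nonempty_isColimit_presentation T m
  -- A right exact `x ▷ -` preserves the presentation of `m`; the strong structure of the Kleisli
  -- functor turns the resulting coequaliser into the Linton one.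
  have hc := isColimitCoforkMapOfIsColimit (MonoidalLeftAction.actionLeft T.Algebra x) _ h
  let e (X : Kleisli T) := μₗIso (kleisliToAlgebra T) x X
  refine ⟨Cofork.IsColimit.mk _
    (fun s => Cofork.IsColimit.desc hc ((e (.mk T m.A)).hom ≫ s.π) ?_) (fun s => ?_)
    (fun s t ht => ?_)⟩
  · change x ⊴ₗ (kleisliToAlgebra T).map (kleisliMap T m.a) ≫ _ ≫ s.π =
      x ⊴ₗ (kleisliToAlgebra T).map (kleisliCounit T m.A) ≫ _ ≫ s.π
    rw [μₗ_naturality_right_assoc, μₗ_naturality_right_assoc, s.condition]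
  · have := Cofork.IsColimit.π_desc' hc ((e (.mk T m.A)).hom ≫ s.π) (by
      change x ⊴ₗ (kleisliToAlgebra T).map (kleisliMap T m.a) ≫ _ ≫ s.π =
        x ⊴ₗ (kleisliToAlgebra T).map (kleisliCounit T m.A) ≫ _ ≫ s.π
      rw [μₗ_naturality_right_assoc, μₗ_naturality_right_assoc, s.condition])
    refine (Category.assoc _ _ _).trans ((congrArg (δₗ _ _ _ ≫ ·) this).trans ?_)
    exact δₗ_comp_μₗ_assoc (kleisliToAlgebra T) x (.mk T m.A) s.π
  · refine Cofork.IsColimit.hom_ext hc ?_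
    refine Eq.trans ?_ (Cofork.IsColimit.π_desc' hc _ _).symm
    rw [← ht]
    change _ = (μₗ _ _ _) ≫ (_ ≫ _) ≫ _
    rw [Category.assoc, μₗ_comp_δₗ_assoc]
    rfl

variable {T}

/-- An action whose values are Linton coequalisers is right exact. -/
theorem preservesFiniteColimits_actionLeft_of_linton [PreservesFiniteColimits T.toFunctor]
    [HasFiniteColimits D] [HasCoequalizers T.Algebra] (x : C)
    (hx : PreservesFiniteColimits (MonoidalLeftAction.actionLeft D x))
    (h : ∀ m, Nonempty (IsColimit (Cofork.ofπ (actionPresentation T x m)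
      (actionPresentation_condition T x m)))) :
    PreservesFiniteColimits (MonoidalLeftAction.actionLeft T.Algebra x) :=
  preservesFiniteColimits_of_linton (G := kleisliAct T x)
    (π := ⟨fun m => actionPresentation T x m, fun _ _ f => actionPresentation_naturality_right T x f⟩)
    (toKleisli_comp_kleisliAct_preservesFiniteColimits T x hx)
    (by ext1; ext1 m; exact actionPresentation_condition T x m) h

/-- These epimorphisms are natural in both variables, so identities between action maps can be
tested on free algebras. -/
theorem epi_actionPresentation (x : C)
    (hx : PreservesFiniteColimits (MonoidalLeftAction.actionLeft T.Algebra x)) (m : T.Algebra) :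
    Epi (actionPresentation T x m) :=
  Cofork.IsColimit.epi (nonempty_isColimit_actionPresentation T x hx m).some

variable {k : Type*} [Field k] [Preadditive C] [Linear k C] [Preadditive D] [Linear k D]
  [BilinearAction k C D] [T.toFunctor.Additive] [T.toFunctor.Linear k]

variable (k) in
/-- A right exact action on algebras which extends the one on the Kleisli category is bilinear. -/
theorem bilinearAction_algebra
    (h : ∀ x : C, PreservesFiniteColimits (MonoidalLeftAction.actionLeft T.Algebra x)) :
    BilinearAction k C T.Algebra where
  add_actionHomLeft {x y} f g m := by
    -- Cancelling the epimorphism at the source leaves the same law for the action on `D`, carried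
    -- to algebras by the linear functor `T.free`. The other three laws go the same way.
    have := epi_actionPresentation x (h x) m
    have e : (kleisliToAlgebra T).map ((f + g) ⊵ₗ Kleisli.mk T m.A) =
        (kleisliToAlgebra T).map (f ⊵ₗ Kleisli.mk T m.A) +
          (kleisliToAlgebra T).map (g ⊵ₗ Kleisli.mk T m.A) := by
      simp only [kleisliToAlgebra_map_actionHomLeft]
      exact (congrArg T.free.map (BilinearAction.add_actionHomLeft k f g m.A)).trans
        (Monad.Algebra.Hom.ext T.map_add)
    rw [← cancel_epi (actionPresentation T x m), Preadditive.comp_add,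
      ← actionPresentation_naturality_left, ← actionPresentation_naturality_left,
      ← actionPresentation_naturality_left, ← Preadditive.add_comp, e]
  smul_actionHomLeft {x y} r f m := by
    have := epi_actionPresentation x (h x) m
    have e : (kleisliToAlgebra T).map ((r • f) ⊵ₗ Kleisli.mk T m.A) =
        r • (kleisliToAlgebra T).map (f ⊵ₗ Kleisli.mk T m.A) := by
      simp only [kleisliToAlgebra_map_actionHomLeft]
      exact (congrArg T.free.map (BilinearAction.smul_actionHomLeft r f m.A)).trans
        (Monad.Algebra.Hom.ext (T.map_smul _ _))
    rw [← cancel_epi (actionPresentation T x m), Linear.comp_smul,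
      ← actionPresentation_naturality_left, ← actionPresentation_naturality_left,
      ← Linear.smul_comp, e]
  actionHomRight_add x m n f g := by
    have := epi_actionPresentation x (h x) m
    have e : (kleisliToAlgebra T).map (x ⊴ₗ kleisliMap T (f + g).f) =
        (kleisliToAlgebra T).map (x ⊴ₗ kleisliMap T f.f) +
          (kleisliToAlgebra T).map (x ⊴ₗ kleisliMap T g.f) := by
      have e (f : m ⟶ n) := kleisliAct_map_kleisliMap T x f.f
      refine (e (f + g)).trans (Eq.trans ?_ (congrArg₂ (· + ·) (e f) (e g)).symm)
      exact (congrArg T.free.map (BilinearAction.actionHomRight_add k x f.f g.f)).trans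
        (Monad.Algebra.Hom.ext T.map_add)
    rw [← cancel_epi (actionPresentation T x m), Preadditive.comp_add,
      ← actionPresentation_naturality_right, ← actionPresentation_naturality_right,
      ← actionPresentation_naturality_right, ← Preadditive.add_comp, e]
  actionHomRight_smul x m n r f := by
    have := epi_actionPresentation x (h x) m
    have e : (kleisliToAlgebra T).map (x ⊴ₗ kleisliMap T (r • f).f) =
        r • (kleisliToAlgebra T).map (x ⊴ₗ kleisliMap T f.f) := by
      have e (f : m ⟶ n) := kleisliAct_map_kleisliMap T x f.f
      refine (e (r • f)).trans (Eq.trans ?_ (congrArg (r • ·) (e f)).symm)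
      exact (congrArg T.free.map (BilinearAction.actionHomRight_smul x r f.f)).trans
        (Monad.Algebra.Hom.ext (T.map_smul _ _))
    rw [← cancel_epi (actionPresentation T x m), Linear.comp_smul,
      ← actionPresentation_naturality_right, ← actionPresentation_naturality_right,
      ← Linear.smul_comp, e]

/-- A right exact action on algebras which extends the one on the Kleisli category is given by
Linton coequalisers. -/
@[reducible]
def extendedActionOfRightExact
    (h : ∀ x : C, PreservesFiniteColimits (MonoidalLeftAction.actionLeft T.Algebra x)) :
    ExtendedAction (C := C) k T where
  bilinear := bilinearAction_algebra k h
  condition x m := by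
    have := actionPresentation_condition T x m
    rwa [show (kleisliToAlgebra T).map (x ⊴ₗ kleisliMap T m.a) = _ from
      kleisliAct_map_kleisliMap T x m.a, show (kleisliToAlgebra T).map (x ⊴ₗ kleisliCounit T m.A) = _
      from kleisliAct_map_kleisliCounit T x m.A] at this
  isColimit x m := nonempty_isColimit_cofork_congr (kleisliAct_map_kleisliMap T x m.a)
    (kleisliAct_map_kleisliCounit T x m.A) (nonempty_isColimit_actionPresentation T x (h x) m).some _

end AlgebraAction

/-! ### Existence and right exactness of extended actions -/

section AlgebraExistence

variable {C : Type*} [Category* C] [MonoidalCategory C] {D : Type*} [Category* D]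
  [MonoidalLeftAction C D] (T : Monad D) [LaxModuleMonad C T]
  {k : Type*} [Field k] [Preadditive C] [Linear k C] [Preadditive D] [Linear k D]
  [T.toFunctor.Additive] [T.toFunctor.Linear k]

/-- Each `X ↦ T (x ▷ X)` is right exact on the base, hence extends to a right exact endofunctor of
the algebras. The extensions form an `ActionLift`, and right exactness supplies the Linton
coequalisers. -/
theorem nonempty_extendedAction [BilinearAction k C D]
    [PreservesFiniteColimits T.toFunctor] [HasFiniteColimits D]
    [HasCoequalizers T.Algebra]
    (h : ∀ x : C, PreservesFiniteColimits (MonoidalLeftAction.actionLeft D x)) :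
    Nonempty (ExtendedAction (C := C) k T) := by
  choose A hA s using fun x : C =>
    exists_extension (toKleisli_comp_kleisliAct_preservesFiniteColimits T x (h x))
  let Λ : ActionLift C (kleisliToAlgebra T) (fun G => PreservesFiniteColimits G) :=
    { restricts := kleisliToAlgebra_restrictsFullyFaithfully T
      prop_id := inferInstance
      prop_comp := fun _ _ => comp_preservesFiniteColimits _ _
      A := A
      prop := hA
      s := fun x X => (s x).some.app X
      s_naturality := fun x _ _ f => (s x).some.hom.naturality f }
  let _ := Λ.action
  let _ := Λ.leftLinear
  exact ⟨extendedActionOfRightExact fun x => hA x⟩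

variable {T}

/-- The Linton condition presents `x ▷ -` as a pointwise coequaliser of right exact functors. Thus
every extended action falls in the class where restriction to the Kleisli category is fully
faithful. -/
theorem ExtendedAction.preservesFiniteColimits_actionLeft [PreservesFiniteColimits T.toFunctor]
    [HasFiniteColimits D] [HasCoequalizers T.Algebra]
    (h : ∀ x : C, PreservesFiniteColimits (MonoidalLeftAction.actionLeft D x))
    (E : ExtendedAction (C := C) k T) (x : C) :
    letI := E.action
    PreservesFiniteColimits (MonoidalLeftAction.actionLeft T.Algebra x) :=
  letI := E.action
  letI := E.strong
  preservesFiniteColimits_actionLeft_of_linton x (h x) fun m =>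
    nonempty_isColimit_cofork_congr (kleisliAct_map_kleisliMap T x m.a).symm
      (kleisliAct_map_kleisliCounit T x m.A).symm (E.isColimit x m).some _

end AlgebraExistence

/-! ### The comparison functor from the Kleisli category -/

section KleisliComparison

variable {C : Type*} [Category* C] [MonoidalCategory C] {D : Type*} [Category* D]
  [MonoidalLeftAction C D] {M : Type*} [Category* M] [MonoidalLeftAction C M]
  {F : D ⥤ M} {R : M ⥤ D} (adj : F ⊣ R)

open Functor.LaxLeftLinear Functor.OplaxLeftLinear Functor.LeftLinear

/-- The comparison functor from the Kleisli category of the monad of an adjunction. -/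
def kleisliComparison : Kleisli adj.toMonad ⥤ M where
  obj X := F.obj X.of
  map {X Y} f := F.map f.of ≫ adj.counit.app (F.obj Y.of)
  map_id X := adj.left_triangle_components X.of
  map_comp {X Y Z} f g := by
    have h {X Y Z : D} (f : X ⟶ R.obj (F.obj Y)) (g : Y ⟶ R.obj (F.obj Z)) :
        F.map (f ≫ R.map (F.map g) ≫ R.map (adj.counit.app (F.obj Z))) ≫
          adj.counit.app (F.obj Z) = (F.map f ≫ adj.counit.app (F.obj Y)) ≫
            F.map g ≫ adj.counit.app (F.obj Z) := by simp
    exact h f.of g.of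

theorem kleisliComparison_map_kleisliMap {X Y : D} (f : X ⟶ Y) :
    (kleisliComparison adj).map (kleisliMap adj.toMonad f) = F.map f := by
  change F.map (f ≫ adj.unit.app Y) ≫ adj.counit.app (F.obj Y) = F.map f
  simp

/-- The comparison functors commute with the functor from the Kleisli category to algebras. -/
def kleisliComparisonCompIso :
    kleisliComparison adj ⋙ Monad.comparison adj ≅ kleisliToAlgebra adj.toMonad :=
  NatIso.ofComponents (fun X => Iso.refl (adj.toMonad.free.obj X.of)) fun {X Y} f => by
    refine (Category.comp_id _).trans (Eq.trans ?_ (Category.id_comp _).symm)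
    apply Monad.Algebra.Hom.ext
    exact R.map_comp _ _

variable [F.LeftLinear C]

/-- The comparison functor from the Kleisli category is a strong `C`-module functor. -/
@[reducible]
def kleisliComparisonLeftLinear :
    letI := adjunctionLaxMonad (C := C) adj
    (kleisliComparison adj).LeftLinear C :=
  letI := adjunctionLaxMonad (C := C) adj
  leftLinearOfIso (F := kleisliComparison adj)
    { μₗ := fun c X => μₗ F c X.of
      μₗ_naturality_left := fun {c c'} f X => by
        refine (μₗ_naturality_left F f X.of).trans (congrArg (μₗ F c X.of ≫ ·) ?_)
        exact (kleisliComparison_map_kleisliMap adj (f ⊵ₗ X.of)).symm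
      μₗ_naturality_right := fun c X Y f => by
        let _ := rightAdjointLax (C := C) adj
        -- The lax structure of the monad contains a transpose. Composing with the counit undoes it
        -- (`key`), after which `μₗ F` and `δₗ F` cancel.
        have h {X Y : D} (f : X ⟶ R.obj (F.obj Y)) :
            c ⊴ₗ (F.map f ≫ adj.counit.app (F.obj Y)) ≫ μₗ F c Y =
              μₗ F c X ≫ F.map (c ⊴ₗ f ≫ μₗ R c (F.obj Y) ≫ R.map (μₗ F c Y)) ≫
                adj.counit.app (F.obj (c ⊙ₗ Y)) := by
          have key : F.map (μₗ R c (F.obj Y)) ≫ adj.counit.app (c ⊙ₗ F.obj Y) =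
              δₗ F c (R.obj (F.obj Y)) ≫ c ⊴ₗ adj.counit.app (F.obj Y) :=
            (adj.homEquiv_counit _ _ _).symm.trans ((adj.homEquiv _ _).symm_apply_apply _)
          have nat : F.map (R.map (μₗ F c Y)) ≫ adj.counit.app (F.obj (c ⊙ₗ Y)) =
              adj.counit.app (c ⊙ₗ F.obj Y) ≫ μₗ F c Y := adj.counit_naturality _
          rw [F.map_comp, F.map_comp, Category.assoc, Category.assoc, nat,
            reassoc_of% key, δₗ_naturality_right_assoc, μₗ_comp_δₗ_assoc,
            MonoidalLeftAction.actionHomRight_comp, Category.assoc]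
        exact h f.of
      μₗ_associativity := fun c c' X => by
        refine Eq.trans (congrArg (μₗ F (c ⊗ c') X.of ≫ ·) ?_) (μₗ_associativity F c c' X.of)
        exact kleisliComparison_map_kleisliMap adj _
      μₗ_unitality := fun X => by
        refine (μₗ_unitality F X.of).trans (congrArg (μₗ F (𝟙_ C) X.of ≫ ·) ?_)
        exact (kleisliComparison_map_kleisliMap adj _).symm }
    (fun c X => μₗIso F c X.of) fun _ _ => rfl

/-- A monadic comparison functor is a strong `C`-module functor for every right exact action on
algebras that extends the action on the Kleisli category. -/
theorem nonempty_leftLinear_comparison_inverse [(Monad.comparison adj).IsEquivalence]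
    (l : MonoidalLeftAction C adj.toMonad.Algebra)
    (s : letI := adjunctionLaxMonad (C := C) adj; (kleisliToAlgebra adj.toMonad).LeftLinear C)
    (hl : ∀ x : C, PreservesFiniteColimits
      (MonoidalLeftAction.actionLeft adj.toMonad.Algebra x))
    (hM : ∀ x : C, PreservesFiniteColimits (MonoidalLeftAction.actionLeft M x)) :
    Nonempty ((Monad.comparison adj).asEquivalence.inverse.LeftLinear C) := by
  let Φ := (Monad.comparison adj).asEquivalence.inverse
  -- The two comparison functors compose to `kleisliToAlgebra`, so the restriction of `Φ` to free
  -- algebras is `kleisliComparison`, which is already strong.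
  let e : kleisliComparison adj ≅ kleisliToAlgebra adj.toMonad ⋙ Φ :=
    (Functor.rightUnitor _).symm ≪≫
      Functor.isoWhiskerLeft _ (Monad.comparison adj).asEquivalence.unitIso ≪≫
      (Functor.associator _ _ _).symm ≪≫
      Functor.isoWhiskerRight (kleisliComparisonCompIso adj) Φ
  let _ := adjunctionLaxMonad (C := C) adj
  let _ := kleisliComparisonLeftLinear (C := C) adj
  have hΦ : PreservesFiniteColimits Φ := ⟨fun _ _ _ => inferInstance⟩
  exact exists_leftLinear_of_restrictsFullyFaithfully (kleisliToAlgebra adj.toMonad) Φ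
    (leftLinearOfNatIso e) (kleisliToAlgebra_restrictsFullyFaithfully adj.toMonad) hΦ
    (fun _ => comp_preservesFiniteColimits _ _) (fun _ => comp_preservesFiniteColimits _ _)
    (fun _ _ => comp_preservesFiniteColimits _ (_ ⋙ Φ))

end KleisliComparison

/-! ### Monadicity of exact faithful right adjoints -/

section Comparison

variable {D : Type*} [Category* D] [Abelian D] {M : Type*} [Category* M] [Abelian M]
  {F : D ⥤ M} {R : M ⥤ D} (adj : F ⊣ R)

/-- As `R` is faithful, the counit is an epimorphism, hence the cokernel of its kernel. The
transpose of `g` kills that kernel, because it does so after `R`; so it descends to some `f`. That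
`R f = g` follows because `R` of the counit is split by the unit. -/
theorem exists_map_eq_of_comp_counit [R.Additive] [R.Faithful] {m n : M} (g : R.obj m ⟶ R.obj n)
    (hg : R.map (F.map g ≫ adj.counit.app n) = R.map (adj.counit.app m) ≫ g) :
    ∃ f : m ⟶ n, R.map f = g := by
  have w : kernel.ι (adj.counit.app m) ≫ F.map g ≫ adj.counit.app n = 0 := by
    apply R.map_injective
    rw [R.map_comp, hg, ← Category.assoc, ← R.map_comp, kernel.condition, R.map_zero, R.map_zero,
      zero_comp]
  have := adj.counit_epi_of_R_faithful m
  refine ⟨Abelian.epiDesc (adj.counit.app m) _ w, ?_⟩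
  have h : R.map (adj.counit.app m) ≫ R.map (Abelian.epiDesc (adj.counit.app m) _ w) =
      R.map (adj.counit.app m) ≫ g := by
    rw [← R.map_comp, Abelian.comp_epiDesc, hg]
  simpa using congrArg (adj.unit.app (R.obj m) ≫ ·) h

theorem full_comparison [R.Additive] [R.Faithful] : (Monad.comparison adj).Full where
  map_surjective {m n} g := by
    obtain ⟨f, hf⟩ := exists_map_eq_of_comp_counit adj g.f ((R.map_comp _ _).trans g.h)
    exact ⟨f, Monad.Algebra.Hom.ext hf⟩

-- The square making `φ` a morphism of algebras may be checked after the epimorphism `R F R π`,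
-- where it reduces to associativity of `a` and naturality of the counit.
omit [Abelian D] [Abelian M] in
theorem map_map_comp_of_comp_eq {A : D} (a : R.obj (F.obj A) ⟶ A) {n : M} (π : F.obj A ⟶ n)
    [Epi (R.map (F.map (R.map π)))] (φ : R.obj n ⟶ A) (hφ : R.map π ≫ φ = a)
    (ha : R.map (F.map a) ≫ a = R.map (adj.counit.app (F.obj A)) ≫ a) :
    R.map (F.map φ) ≫ a = R.map (adj.counit.app n) ≫ φ := by
  have hε : F.map (R.map π) ≫ adj.counit.app n = adj.counit.app (F.obj A) ≫ π :=
    adj.counit_naturality π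
  rw [← cancel_epi (R.map (F.map (R.map π))), ← R.map_comp_assoc, ← F.map_comp, hφ, ha,
    ← R.map_comp_assoc, hε, R.map_comp_assoc, hφ]

/-- The preimage of `A` is the coequaliser of `F a` and the counit. `R` preserves it, and Beck's
coequaliser identifies the result with the carrier of `A`. -/
theorem essSurj_comparison [PreservesFiniteColimits R] : (Monad.comparison adj).EssSurj where
  mem_essImage A := by
    have := Functor.preservesEpimorphisms_of_adjunction adj
    let a : R.obj (F.obj A.A) ⟶ A.A := A.a
    let π := coequalizer.π (F.map a) (adj.counit.app (F.obj A.A))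
    have : Epi π := coequalizer.π_epi
    have : Epi (R.map (F.map (R.map π))) := inferInstance
    let h := isColimitOfHasCoequalizerOfPreservesColimit R (F.map a) (adj.counit.app (F.obj A.A))
    let φ := h.coconePointUniqueUpToIso (Monad.beckCoequalizer A)
    have hφ : R.map π ≫ φ.hom = A.a :=
      h.comp_coconePointUniqueUpToIso_hom (Monad.beckCoequalizer A) WalkingParallelPair.one
    exact ⟨_, ⟨Monad.Algebra.isoMk φ (map_map_comp_of_comp_eq adj a π φ.hom hφ A.assoc.symm)⟩⟩

/-- Faithfulness of the comparison functor is inherited from `R`. -/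
theorem isEquivalence_comparison_of_exact [R.Additive] [R.Faithful] [PreservesFiniteColimits R] :
    (Monad.comparison adj).IsEquivalence where
  full := full_comparison adj
  essSurj := essSurj_comparison adj

end Comparison

/-! ### Projective algebras -/

section Free

variable {C : Type u} [Category.{v} C] [Abelian C] (T : Monad C)

theorem hasCoequalizers_algebra [T.toFunctor.Additive] [PreservesFiniteColimits T.toFunctor] :
    HasCoequalizers T.Algebra :=
  have := algebraAbelian T
  inferInstance

theorem preservesEpimorphisms_forget [PreservesFiniteColimits T.toFunctor] :
    T.forget.PreservesEpimorphisms :=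
  have : PreservesFiniteColimits T.forget := ⟨fun _ _ _ => inferInstance⟩
  inferInstance

theorem projective_free [PreservesFiniteColimits T.toFunctor] {P : C}
    (hP : Projective P) : Projective (T.free.obj P) :=
  have := preservesEpimorphisms_forget T
  T.adj.map_projective P hP

-- The structure map of `m` is a coequaliser, hence an epimorphism, and the free functor preserves
-- the epimorphism onto `m.A` from a projective because it is a left adjoint.
omit [Abelian C] in
theorem exists_projective_epi_free [EnoughProjectives C] (m : T.Algebra) :
    ∃ (P : C) (f : T.free.obj P ⟶ m), Projective P ∧ Epi f := by
  have := T.adj.leftAdjoint_preservesColimits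
  have : Epi (algebraCounit m) := Cofork.IsColimit.epi (Monad.beckAlgebraCoequalizer m)
  exact ⟨Projective.over m.A, T.free.map (Projective.π m.A) ≫ algebraCounit m, inferInstance,
    epi_comp _ _⟩

theorem enoughProjectives_algebra [PreservesFiniteColimits T.toFunctor] [EnoughProjectives C] :
    EnoughProjectives T.Algebra where
  presentation m := by
    obtain ⟨P, f, hP, hf⟩ := exists_projective_epi_free T m
    exact ⟨{ p := T.free.obj P, projective := projective_free T hP, f := f, epi := hf }⟩

end Free

/-! ### Projective pairs and right exact lax module monads -/

section Bundled

variable {k : Type*} [Field k] {C : Type u} [Category.{v} C] [Abelian C] [Linear k C]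
  [MonoidalCategory C]

instance bilinearActionSelf [MonoidalPreadditive C] [MonoidalLinear k C] :
    BilinearAction k C C where
  add_actionHomLeft _ _ _ := MonoidalPreadditive.add_whiskerRight _ _
  smul_actionHomLeft _ _ _ := MonoidalLinear.smul_whiskerRight _ _ _
  actionHomRight_add _ _ _ _ _ := MonoidalPreadditive.whiskerLeft_add _ _
  actionHomRight_smul _ _ _ _ _ := MonoidalLinear.whiskerLeft_smul _ _ _

theorem RightExactLaxMonad.nonempty_extension [MonoidalPreadditive C] [MonoidalLinear k C]
    (h : ∀ x : C, PreservesFiniteColimits (tensorLeft x)) (T : RightExactLaxMonad k C) :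
    Nonempty T.Extension :=
  have := hasCoequalizers_algebra T.monad
  nonempty_extendedAction T.monad h

theorem RightExactLaxMonad.preservesFiniteColimits_actionLeft
    (h : ∀ x : C, PreservesFiniteColimits (tensorLeft x)) (T : RightExactLaxMonad k C)
    (E : T.Extension) (x : C) :
    letI := E.action
    PreservesFiniteColimits (MonoidalLeftAction.actionLeft T.monad.Algebra x) :=
  have := hasCoequalizers_algebra T.monad
  E.preservesFiniteColimits_actionLeft h x

/-- Any two extended actions give equivalent `C`-module categories. -/
theorem RightExactLaxMonad.algebras_equivalent
    (h : ∀ x : C, PreservesFiniteColimits (tensorLeft x)) (T : RightExactLaxMonad k C)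
    (E E' : T.Extension) : (T.algebras E).Equivalent (T.algebras E') := by
  have hE := T.preservesFiniteColimits_actionLeft h E
  have hE' := T.preservesFiniteColimits_actionLeft h E'
  refine ⟨CategoryTheory.Equivalence.refl, inferInstanceAs (𝟭 (T.algebras E).carrier).Additive,
    inferInstanceAs ((𝟭 (T.algebras E).carrier).Linear k), ?_⟩
  -- The identity is regarded as a functor between two actions on one category, so the instances are
  -- explicit. Both actions are right exact and make the Kleisli functor strong.
  exact @exists_leftLinear_of_restrictsFullyFaithfully C _ _ (Kleisli T.monad) _ _
    T.monad.Algebra _ E.action T.monad.Algebra _ E'.action (kleisliToAlgebra T.monad) (𝟭 _)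
    E.strong E'.strong _ (kleisliToAlgebra_restrictsFullyFaithfully T.monad)
    (inferInstanceAs (PreservesFiniteColimits (𝟭 T.monad.Algebra))) hE' hE
    (fun x y => let _ := E.action; comp_preservesFiniteColimits
      (MonoidalLeftAction.actionLeft T.monad.Algebra y)
      (MonoidalLeftAction.actionLeft T.monad.Algebra x))

/-- The free algebra on the unit object represents the free algebra functor. -/
def freeIsoActionRight (T : Monad C) [LaxModuleMonad C T] [MonoidalLeftAction C T.Algebra]
    [(kleisliToAlgebra T).LeftLinear C] :
    T.free ≅ MonoidalLeftAction.actionRight C (T.free.obj (𝟙_ C)) :=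
  -- The isomorphism is `T x ≅ T (x ⊗ 1) ≅ x ▷ T 1`.
  NatIso.ofComponents (fun x => T.free.mapIso (ρ_ x).symm ≪≫
    (Functor.LeftLinear.μₗIso (kleisliToAlgebra T) x (.mk T (𝟙_ C))).symm) fun {x y} f => by
      have h := Functor.OplaxLeftLinear.δₗ_naturality_left (kleisliToAlgebra T) f
        (.mk T (𝟙_ C))
      have e : (kleisliToAlgebra T).map (f ⊵ₗ Kleisli.mk T (𝟙_ C)) = T.free.map (f ▷ 𝟙_ C) :=
        kleisliToAlgebra_map_actionHomLeft T f (𝟙_ C)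
      have e' : T.free.map f ≫ T.free.map (ρ_ y).inv =
          T.free.map (ρ_ x).inv ≫ T.free.map (f ▷ 𝟙_ C) := by
        rw [← T.free.map_comp, ← T.free.map_comp, rightUnitor_inv_naturality]
      refine (Category.assoc _ _ _).symm.trans ((congrArg (· ≫ _) e').trans ?_)
      refine (Category.assoc _ _ _).trans (Eq.trans ?_ (Category.assoc _ _ _).symm)
      rw [← e]
      exact congrArg (T.free.map (ρ_ x).inv ≫ ·) h

/-- By `freeIsoActionRight`, acting on `T 1` is the free functor: its right adjoint is forgetful, it
preserves projectives, and every projective algebra splits off from a free algebra on a projective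
that covers it. -/
theorem RightExactLaxMonad.isProjectivePair [EnoughProjectives C]
    (h : ∀ x : C, PreservesFiniteColimits (tensorLeft x)) (T : RightExactLaxMonad k C)
    (E : T.Extension) :
    ModCat.IsProjectivePair (M := T.algebras E) (T.monad.free.obj (𝟙_ C)) := by
  let _ := E.action
  let _ := E.strong
  let e := freeIsoActionRight T.monad
  have hP (P : C) (hP : Projective P) :
      Projective ((MonoidalLeftAction.actionRight C (T.monad.free.obj (𝟙_ C))).obj P) :=
    Projective.of_iso (e.app P) (projective_free T.monad hP)
  exact
    { enoughProjectives := enoughProjectives_algebra T.monad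
      isRightExact := T.preservesFiniteColimits_actionLeft h E
      isClosed := ⟨_, ⟨T.monad.adj.ofNatIsoLeft e⟩⟩
      isCProjective := hP
      isCGenerator := fun Q hQ => by
        obtain ⟨P, f, hP, hf⟩ := exists_projective_epi_free T.monad Q
        let r : Retract Q (T.monad.free.obj P) :=
          { i := @Projective.factorThru T.monad.Algebra _ _ _ _ hQ (𝟙 Q) f hf
            r := f
            retract := @Projective.factorThru_comp T.monad.Algebra _ _ _ _ hQ (𝟙 Q) f hf }
        exact ⟨P, hP, ⟨r.trans (.ofIso (e.app P))⟩⟩ }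

namespace ModCat.IsProjectivePair

variable {M : ModCat.{w₂, w₁} k C} {ℓ : M.carrier} (h : IsProjectivePair ℓ)
  {R : M.carrier ⥤ C} (adj : MonoidalLeftAction.actionRight C ℓ ⊣ R)
include h adj

/-- The right adjoint of `- ▷ ℓ` is exact. -/
theorem preservesFiniteColimits_rightAdjoint [EnoughProjectives C] :
    PreservesFiniteColimits R := by
  have : (MonoidalLeftAction.actionRight C ℓ).PreservesProjectiveObjects :=
    ⟨fun {P} hP => h.isCProjective P hP⟩
  -- Epimorphisms in `C` are detected by lifting from projectives `P`, and such lifting problems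
  -- transpose to lifting from the projective `P ▷ ℓ`. With left exactness this gives exactness.
  have := Functor.preservesEpimorphisms_of_adjunction_of_preservesProjectiveObjects adj
  have := adj.right_adjoint_additive
  have := adj.rightAdjoint_preservesLimits
  have := R.preservesHomology_of_preservesEpis_and_kernels
  exact R.preservesFiniteColimits_of_preservesHomology

/-- A projective covering `m` is a summand of some `P ▷ ℓ`. Morphisms from there to `n` correspond
to morphisms `P ⟶ R n`, so `R f = R g` forces `f` and `g` to agree on the cover. -/
theorem faithful_rightAdjoint : R.Faithful where
  map_injective {m n f g} hfg := by
    have := h.enoughProjectives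
    obtain ⟨P, -, ⟨r⟩⟩ := h.isCGenerator (Projective.over m) inferInstance
    have e (f : m ⟶ n) : adj.homEquiv _ _ ((r.r ≫ Projective.π m) ≫ f) =
        adj.homEquiv _ _ (r.r ≫ Projective.π m) ≫ R.map f := adj.homEquiv_naturality_right _ _
    have e' : (r.r ≫ Projective.π m) ≫ f = (r.r ≫ Projective.π m) ≫ g :=
      (adj.homEquiv _ _).injective ((e f).trans ((congrArg (_ ≫ ·) hfg).trans (e g).symm))
    rw [← cancel_epi (Projective.π m)]
    simpa using congrArg (r.i ≫ ·) e'

theorem isEquivalence_comparison [EnoughProjectives C] :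
    (Monad.comparison adj).IsEquivalence := by
  have := h.preservesFiniteColimits_rightAdjoint adj
  have := h.faithful_rightAdjoint adj
  have := adj.right_adjoint_additive
  exact isEquivalence_comparison_of_exact adj

theorem preservesFiniteColimits_comp [EnoughProjectives C] :
    PreservesFiniteColimits (MonoidalLeftAction.actionRight C ℓ ⋙ R) := by
  have := h.preservesFiniteColimits_rightAdjoint adj
  have := adj.leftAdjoint_preservesColimits
  have : PreservesFiniteColimits (MonoidalLeftAction.actionRight C ℓ) :=
    ⟨fun _ _ _ => inferInstance⟩
  exact comp_preservesFiniteColimits _ _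

theorem equivalent_algebras [EnoughProjectives C]
    (hC : ∀ x : C, PreservesFiniteColimits (tensorLeft x))
    (hR : PreservesFiniteColimits (MonoidalLeftAction.actionRight C ℓ ⋙ R))
    (E : (internalHomMonad adj hR).Extension) :
    M.Equivalent ((internalHomMonad adj hR).algebras E) := by
  have := h.isEquivalence_comparison adj
  have := adj.right_adjoint_additive
  have : R.Linear k := right_adjoint_linear adj
  let e : M.carrier ≌ ((internalHomMonad adj hR).algebras E).carrier :=
    (Monad.comparison adj).asEquivalence
  have h₁ : e.functor.Additive := ⟨Monad.Algebra.Hom.ext R.map_add⟩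
  have h₂ : e.functor.Linear k := ⟨fun f r => Monad.Algebra.Hom.ext (R.map_smul r f)⟩
  -- The strong structure is built on the quasi-inverse, whose source is the category of algebras,
  -- where extension from free algebras is available.
  refine Equivalent.symm ⟨e.symm, inferInstanceAs e.inverse.Additive,
    inferInstanceAs (e.inverse.Linear k), ?_⟩
  exact nonempty_leftLinear_comparison_inverse adj E.action E.strong
    ((internalHomMonad adj hR).preservesFiniteColimits_actionLeft hC E) h.isRightExact

end ModCat.IsProjectivePair

end Bundled

/-! ### Limits of left exact functors -/

section PreservesLimit

variable {K J E B : Type*} [Category* K] [Category* J] [Category* E] [Category* B]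

theorem nonempty_isLimit_fork_congr {X Y Z : E} {f f' g g' : X ⟶ Y} {ι : Z ⟶ X} (hf : f = f')
    (hg : g = g') {w : ι ≫ f = ι ≫ g} (h : IsLimit (Fork.ofι ι w)) (w' : ι ≫ f' = ι ≫ g') :
    Nonempty (IsLimit (Fork.ofι ι w')) := by
  subst hf hg
  exact ⟨h⟩

/-- A limit of functors which preserve limits of shape `K` preserves limits of shape `K`. -/
theorem preservesLimitsOfShape_of_isLimit [HasLimitsOfShape J B] {F : J ⥤ E ⥤ B}
    {c : Cone F} (hc : IsLimit c) [∀ j, PreservesLimitsOfShape K (F.obj j)] :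
    PreservesLimitsOfShape K c.pt := by
  -- The limit is `F.flip` followed by the right adjoint `lim`.
  have : PreservesLimitsOfShape K F.flip := ⟨fun {_} => ⟨fun {_} hd =>
    ⟨evaluationJointlyReflectsLimits _ fun j => isLimitOfPreserves (F.obj j) hd⟩⟩⟩
  let e : F.flip ⋙ lim ≅ c.pt := NatIso.ofComponents (fun X =>
    (limit.isLimit (F.flip.obj X)).conePointUniqueUpToIso
      (isLimitOfPreserves ((evaluation E B).obj X) hc)) (fun {X Y} f => by
    apply (isLimitOfPreserves ((evaluation E B).obj Y) hc).hom_ext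
    intro j
    have h (X : E) := (isLimitOfPreserves ((evaluation E B).obj X) hc).fac
      (limit.cone (F.flip.obj X)) j
    dsimp at h
    simp [IsLimit.conePointUniqueUpToIso, h, reassoc_of% h])
  exact preservesLimitsOfShape_of_natIso e

/-- A pointwise equaliser of left exact functors is left exact. -/
theorem preservesFiniteLimits_of_isLimit_fork [HasEqualizers B] {F G A : E ⥤ B}
    {α β : F ⟶ G} {ι : A ⟶ F} (w : ι ≫ α = ι ≫ β)
    (h : ∀ m, Nonempty (IsLimit (Fork.ofι (ι.app m) (congr_app w m))))
    (hF : PreservesFiniteLimits F) (hG : PreservesFiniteLimits G) :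
    PreservesFiniteLimits A where
  preservesFiniteLimits K _ _ := by
    have (j : WalkingParallelPair) : PreservesLimitsOfShape K ((parallelPair α β).obj j) := by
      cases j
      · exact inferInstanceAs (PreservesLimitsOfShape K F)
      · exact inferInstanceAs (PreservesLimitsOfShape K G)
    have hc : IsLimit (Fork.ofι ι w) := evaluationJointlyReflectsLimits _ fun m =>
      (isLimitMapConeForkEquiv ((evaluation E B).obj m) w).symm (h m).some
    exact preservesLimitsOfShape_of_isLimit hc

end PreservesLimit

/-! ### Coalgebras as equalisers of co-Kleisli arrows -/

section CoalgebraExtension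

variable {D : Type*} [Category* D] (S : Comonad D) {B : Type*} [Category* B]

/-- The morphism of the co-Kleisli category given by a morphism of the base category. -/
def cokleisliMap {X Y : D} (f : X ⟶ Y) : Cokleisli.mk S X ⟶ Cokleisli.mk S Y :=
  (Cokleisli.Adjunction.toCokleisli S).map f

/-- The morphism `X ⟶ S X` of the co-Kleisli category given by the identity of `S X`. -/
def cokleisliUnit (X : D) : Cokleisli.mk S X ⟶ Cokleisli.mk S (S.obj X) := .mk (𝟙 (S.obj X))

@[simp]
theorem cokleisliMap_id (X : D) : cokleisliMap S (𝟙 X) = 𝟙 _ :=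
  (Cokleisli.Adjunction.toCokleisli S).map_id X

theorem cokleisliMap_comp {X Y Z : D} (f : X ⟶ Y) (g : Y ⟶ Z) :
    cokleisliMap S (f ≫ g) = cokleisliMap S f ≫ cokleisliMap S g :=
  (Cokleisli.Adjunction.toCokleisli S).map_comp f g

theorem cokleisliToCoalgebra_map_cokleisliMap {X Y : D} (f : X ⟶ Y) :
    (cokleisliToCoalgebra S).map (cokleisliMap S f) = S.cofree.map f := by
  ext
  change S.δ.app X ≫ S.map (S.ε.app X ≫ f) = S.map f
  rw [S.map_comp, S.right_counit_assoc]

/-- The structure map of a coalgebra, as a morphism to the image of the co-Kleisli category. -/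
def copresentation (m : S.Coalgebra) : m ⟶ (cokleisliToCoalgebra S).obj (.mk S m.A) :=
  coalgebraUnit m

/-- With this, the comultiplication leg of the canonical copresentation comes from a co-Kleisli
arrow. -/
theorem cokleisliToCoalgebra_map_cokleisliUnit (X : D) :
    (cokleisliToCoalgebra S).map (cokleisliUnit S X) =
      copresentation S ((cokleisliToCoalgebra S).obj (.mk S X)) := by
  ext
  change S.δ.app X ≫ S.map (𝟙 _) = S.δ.app X
  rw [S.map_id]
  exact Category.comp_id _

theorem cokleisliUnit_comp_cokleisliMap {X : Cokleisli S} {Y : D} (f : S.obj X.of ⟶ Y) :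
    cokleisliUnit S X.of ≫ cokleisliMap S f = (Cokleisli.Hom.mk f : X ⟶ Cokleisli.mk S Y) :=
  Cokleisli.hom_ext _
    ((comp_toCokleisli_map_of S (cokleisliUnit S X.of) f).trans (Category.id_comp f))

theorem cokleisliUnit_naturality {X Y : D} (f : X ⟶ Y) :
    cokleisliMap S f ≫ cokleisliUnit S Y = cokleisliUnit S X ≫ cokleisliMap S (S.map f) := by
  apply Cokleisli.hom_ext
  refine (toCokleisli_map_comp_of S f (cokleisliUnit S Y)).trans
    (Eq.trans ?_ (comp_toCokleisli_map_of S (cokleisliUnit S X) (S.map f)).symm)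
  exact (Category.comp_id _).trans (Category.id_comp _).symm

theorem comp_cokleisliUnit {X Y : Cokleisli S} (f : X ⟶ Y) :
    cokleisliUnit S X.of ≫ cokleisliMap S (S.δ.app X.of ≫ S.map f.of) =
      f ≫ cokleisliUnit S Y.of := by
  refine (cokleisliUnit_comp_cokleisliMap S _).trans (Cokleisli.hom_ext _ ?_)
  exact congrArg (S.δ.app X.of ≫ ·) (Category.comp_id (S.map f.of)).symm

theorem copresentation_comp_cokleisliToCoalgebra_map {m n : S.Coalgebra} (f : m ⟶ n) :
    copresentation S m ≫ (cokleisliToCoalgebra S).map (cokleisliMap S f.f) =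
      f ≫ copresentation S n := by
  rw [cokleisliToCoalgebra_map_cokleisliMap]
  exact Comonad.Coalgebra.Hom.ext f.h

theorem copresentation_condition (m : S.Coalgebra) :
    copresentation S m ≫ (cokleisliToCoalgebra S).map (cokleisliMap S m.a) =
      copresentation S m ≫ (cokleisliToCoalgebra S).map (cokleisliUnit S m.A) := by
  rw [cokleisliToCoalgebra_map_cokleisliMap, cokleisliToCoalgebra_map_cokleisliUnit]
  exact Comonad.CofreeEqualizer.condition m

/-- Every coalgebra is the equaliser of cofree coalgebras. -/
theorem nonempty_isLimit_copresentation (m : S.Coalgebra) :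
    Nonempty (IsLimit (Fork.ofι (copresentation S m) (copresentation_condition S m))) :=
  nonempty_isLimit_fork_congr (cokleisliToCoalgebra_map_cokleisliMap S m.a).symm
    (cokleisliToCoalgebra_map_cokleisliUnit S m.A).symm (Comonad.beckCoalgebraEqualizer m) _

/-- A natural transformation between functors on the category of coalgebras whose target is left
exact is determined by its restriction to the co-Kleisli category, which is arbitrary. -/
theorem cokleisliToCoalgebra_restrictsFullyFaithfully :
    RestrictsFullyFaithfully (cokleisliToCoalgebra S)
      (fun G : S.Coalgebra ⥤ B => PreservesFiniteLimits G) := by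
  intro G H _ hH
  -- Here exactness of the target matters: `H` keeps the copresentation an equaliser, so components
  -- are lifted into it.
  have hc (m : S.Coalgebra) :=
    isLimitForkMapOfIsLimit H _ (nonempty_isLimit_copresentation S m).some
  have mono (m : S.Coalgebra) : Mono (H.map (copresentation S m)) :=
    Fork.IsLimit.mono (hc m)
  constructor
  · intro α β h
    ext m
    rw [← cancel_mono (H.map (copresentation S m)), ← α.naturality, ← β.naturality]
    exact congrArg (G.map _ ≫ ·) (congr_app h (Cokleisli.mk S m.A))
  · intro α
    let a (X : Cokleisli S) :
      G.obj ((cokleisliToCoalgebra S).obj X) ⟶ H.obj ((cokleisliToCoalgebra S).obj X) := α.app X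
    have w {X Y : Cokleisli S} (f : X ⟶ Y) :
        G.map ((cokleisliToCoalgebra S).map f) ≫ a Y =
          a X ≫ H.map ((cokleisliToCoalgebra S).map f) := α.naturality f
    have hw (m : S.Coalgebra) : (G.map (copresentation S m) ≫ a (.mk S m.A)) ≫
          H.map ((cokleisliToCoalgebra S).map (cokleisliMap S m.a)) =
        (G.map (copresentation S m) ≫ a (.mk S m.A)) ≫
          H.map ((cokleisliToCoalgebra S).map (cokleisliUnit S m.A)) := by
      rw [Category.assoc, Category.assoc, ← w (cokleisliMap S m.a), ← w (cokleisliUnit S m.A),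
        ← G.map_comp_assoc, ← G.map_comp_assoc, copresentation_condition]
    have hβ' (m : S.Coalgebra) : ∃ β, β ≫ H.map (copresentation S m) =
        G.map (copresentation S m) ≫ a (.mk S m.A) :=
      ⟨_, (Fork.IsLimit.lift' (hc m) _ (hw m)).2⟩
    choose β hβ using hβ'
    refine ⟨{ app := β, naturality := fun m n f => ?_ }, ?_⟩
    · rw [← cancel_mono (H.map (copresentation S n)), Category.assoc, Category.assoc,
        ← H.map_comp, ← copresentation_comp_cokleisliToCoalgebra_map, H.map_comp, hβ,
        reassoc_of% (hβ m), ← G.map_comp_assoc, ← copresentation_comp_cokleisliToCoalgebra_map,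
        G.map_comp_assoc, w]
    · ext X
      -- The copresentation of a cofree coalgebra is the image of `cokleisliUnit`, and `α` is
      -- natural with respect to it.
      have h := w (cokleisliUnit S X.of)
      rw [cokleisliToCoalgebra_map_cokleisliUnit] at h
      exact (cancel_mono (H.map (copresentation S ((cokleisliToCoalgebra S).obj X)))).1
        ((hβ ((cokleisliToCoalgebra S).obj X)).trans h)

end CoalgebraExtension

/-! ### Extending functors from the co-Kleisli category to coalgebras -/

section CoalgebraFunctor

variable {D : Type*} [Category* D] (S : Comonad D) {B : Type*} [Category* B]
  (G : Cokleisli S ⥤ B)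

/-- The composite of `G` with the functor to the co-Kleisli category, on coalgebras. -/
def coalgebraOnCarrier : S.Coalgebra ⥤ B where
  obj m := G.obj (.mk S m.A)
  map f := G.map (cokleisliMap S f.f)
  map_id _ := (congrArg G.map (cokleisliMap_id S _)).trans (G.map_id _)
  map_comp f g := (congrArg G.map (cokleisliMap_comp S f.f g.f)).trans (G.map_comp _ _)

/-- The composite of `G` with the functor to the co-Kleisli category and `S`, on coalgebras. -/
def coalgebraOnCofreeCarrier : S.Coalgebra ⥤ B where
  obj m := G.obj (.mk S (S.obj m.A))
  map f := G.map (cokleisliMap S (S.map f.f))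
  map_id m := (congrArg (fun t => G.map (cokleisliMap S t)) (S.map_id m.A)).trans
    ((congrArg G.map (cokleisliMap_id S _)).trans (G.map_id _))
  map_comp f g := (congrArg (fun t => G.map (cokleisliMap S t)) (S.map_comp f.f g.f)).trans
    ((congrArg G.map (cokleisliMap_comp S _ _)).trans (G.map_comp _ _))

/-- The first of the two natural transformations whose equaliser extends `G` to coalgebras. -/
def colintonLeft : coalgebraOnCarrier S G ⟶ coalgebraOnCofreeCarrier S G where
  app m := G.map (cokleisliMap S m.a)
  naturality m n f := by
    change G.map (cokleisliMap S f.f) ≫ G.map (cokleisliMap S n.a) =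
      G.map (cokleisliMap S m.a) ≫ G.map (cokleisliMap S (S.map f.f))
    rw [← G.map_comp, ← cokleisliMap_comp, ← G.map_comp, ← cokleisliMap_comp, f.h]

/-- The second of the two natural transformations whose equaliser extends `G` to coalgebras. -/
def colintonRight : coalgebraOnCarrier S G ⟶ coalgebraOnCofreeCarrier S G where
  app m := G.map (cokleisliUnit S m.A)
  naturality m n f := by
    change G.map (cokleisliMap S f.f) ≫ G.map (cokleisliUnit S n.A) =
      G.map (cokleisliUnit S m.A) ≫ G.map (cokleisliMap S (S.map f.f))
    rw [← G.map_comp, cokleisliUnit_naturality, G.map_comp]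

variable {S G}

theorem coalgebraOnCarrier_preservesFiniteLimits [PreservesFiniteLimits S.toFunctor]
    [HasFiniteLimits D] (hG : PreservesFiniteLimits (Cokleisli.Adjunction.toCokleisli S ⋙ G)) :
    PreservesFiniteLimits (coalgebraOnCarrier S G) :=
  have : PreservesFiniteLimits S.forget := ⟨fun _ _ _ => inferInstance⟩
  inferInstanceAs (PreservesFiniteLimits (S.forget ⋙ Cokleisli.Adjunction.toCokleisli S ⋙ G))

theorem coalgebraOnCofreeCarrier_preservesFiniteLimits [PreservesFiniteLimits S.toFunctor]
    [HasFiniteLimits D] (hG : PreservesFiniteLimits (Cokleisli.Adjunction.toCokleisli S ⋙ G)) :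
    PreservesFiniteLimits (coalgebraOnCofreeCarrier S G) :=
  have : PreservesFiniteLimits S.forget := ⟨fun _ _ _ => inferInstance⟩
  inferInstanceAs (PreservesFiniteLimits
    (S.forget ⋙ S.toFunctor ⋙ Cokleisli.Adjunction.toCokleisli S ⋙ G))

/-- A functor on coalgebras given by Linton equalisers is left exact. -/
theorem preservesFiniteLimits_of_colinton [PreservesFiniteLimits S.toFunctor]
    [HasFiniteLimits D] [HasEqualizers B]
    (hG : PreservesFiniteLimits (Cokleisli.Adjunction.toCokleisli S ⋙ G)) {A : S.Coalgebra ⥤ B}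
    {ι : A ⟶ coalgebraOnCarrier S G} (w : ι ≫ colintonLeft S G = ι ≫ colintonRight S G)
    (h : ∀ m, Nonempty (IsLimit (Fork.ofι (ι.app m) (congr_app w m)))) :
    PreservesFiniteLimits A :=
  preservesFiniteLimits_of_isLimit_fork w h (coalgebraOnCarrier_preservesFiniteLimits hG)
    (coalgebraOnCofreeCarrier_preservesFiniteLimits hG)

theorem cokleisliUnit_comp_cokleisliMap_δ (S : Comonad D) (X : Cokleisli S) :
    cokleisliUnit S X.of ≫ cokleisliMap S (S.δ.app X.of) =
      cokleisliUnit S X.of ≫ cokleisliUnit S (S.obj X.of) :=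
  Eq.trans (congrArg (cokleisliUnit S X.of ≫ cokleisliMap S ·)
    ((Category.comp_id _).symm.trans (congrArg (S.δ.app X.of ≫ ·) (S.map_id _).symm)))
    (comp_cokleisliUnit S (cokleisliUnit S X.of))

/-- The equaliser which defines an extension to coalgebras is split on cofree coalgebras. -/
def isLimitCokleisliUnit (G : Cokleisli S ⥤ B) (X : Cokleisli S)
    (w : G.map (cokleisliUnit S X.of) ≫ G.map (cokleisliMap S (S.δ.app X.of)) =
      G.map (cokleisliUnit S X.of) ≫ G.map (cokleisliUnit S (S.obj X.of))) :
    IsLimit (Fork.ofι (G.map (cokleisliUnit S X.of)) w) :=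
  -- The splitting data: `ε` is a retraction of `cokleisliUnit` (`h₁`), and `S ε` is a retraction of
  -- the leg `δ` (`h₃`), compatible with the other leg (`h₂`).
  have h₁ : cokleisliUnit S X.of ≫ cokleisliMap S (S.ε.app X.of) = 𝟙 X :=
    cokleisliUnit_comp_cokleisliMap S (X := X) _
  have h₂ : cokleisliMap S (S.ε.app X.of) ≫ cokleisliUnit S X.of =
      cokleisliUnit S (S.obj X.of) ≫ cokleisliMap S (S.map (S.ε.app X.of)) :=
    cokleisliUnit_naturality S (S.ε.app X.of)
  have h₃ : cokleisliMap S (S.δ.app X.of) ≫ cokleisliMap S (S.map (S.ε.app X.of)) = 𝟙 _ :=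
    (cokleisliMap_comp S _ _).symm.trans
      ((congrArg (cokleisliMap S) (S.right_counit X.of)).trans (cokleisliMap_id S _))
  Fork.IsLimit.mk _ (fun s => s.ι ≫ G.map (cokleisliMap S (S.ε.app X.of)))
    (fun s => by
      change (s.ι ≫ G.map (cokleisliMap S (S.ε.app X.of))) ≫ G.map (cokleisliUnit S X.of) = s.ι
      rw [Category.assoc, ← G.map_comp, h₂, G.map_comp, ← reassoc_of% s.condition, ← G.map_comp,
        h₃]
      exact (congrArg (s.ι ≫ ·) (G.map_id _)).trans (Category.comp_id _))
    (fun s m hm => by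
      change m ≫ G.map (cokleisliUnit S X.of) = s.ι at hm
      rw [← hm, Category.assoc, ← G.map_comp]
      exact ((congrArg (m ≫ G.map ·) h₁).trans (by simp)).symm)

/-- A functor on the co-Kleisli category which is left exact on the base category extends to a left
exact functor on coalgebras. -/
theorem exists_coalgebra_extension [PreservesFiniteLimits S.toFunctor] [HasFiniteLimits D]
    [HasEqualizers B] (hG : PreservesFiniteLimits (Cokleisli.Adjunction.toCokleisli S ⋙ G)) :
    ∃ A : S.Coalgebra ⥤ B,
      PreservesFiniteLimits A ∧ Nonempty (cokleisliToCoalgebra S ⋙ A ≅ G) := by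
  let c := equalizer.ι (colintonLeft S G) (colintonRight S G)
  have w := equalizer.condition (colintonLeft S G) (colintonRight S G)
  have hc (m : S.Coalgebra) : IsLimit (Fork.ofι (c.app m) (congr_app w m)) :=
    isLimitForkMapOfIsLimit ((evaluation S.Coalgebra B).obj m) _
      (equalizerIsEqualizer (colintonLeft S G) (colintonRight S G))
  have w' (X : Cokleisli S) := (G.map_comp _ _).symm.trans
    ((congrArg G.map (cokleisliUnit_comp_cokleisliMap_δ S X)).trans (G.map_comp _ _))
  have he' (X : Cokleisli S) : ∃ e : (equalizer (colintonLeft S G) (colintonRight S G)).obj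
      ((cokleisliToCoalgebra S).obj X) ≅ G.obj X,
      e.hom ≫ G.map (cokleisliUnit S X.of) = c.app ((cokleisliToCoalgebra S).obj X) :=
    ⟨(hc ((cokleisliToCoalgebra S).obj X)).conePointUniqueUpToIso
      (isLimitCokleisliUnit G X (w' X)),
      (hc ((cokleisliToCoalgebra S).obj X)).conePointUniqueUpToIso_hom_comp
        (isLimitCokleisliUnit G X (w' X)) .zero⟩
  choose e he using he'
  refine ⟨equalizer (colintonLeft S G) (colintonRight S G),
    preservesFiniteLimits_of_colinton hG w fun m => ⟨hc m⟩,
    ⟨NatIso.ofComponents e fun {X Y} f => ?_⟩⟩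
  -- Naturality is tested after this monomorphism at the target, where it reduces to naturality of
  -- `c` and `comp_cokleisliUnit`.
  have : Mono (G.map (cokleisliUnit S Y.of)) :=
    Fork.IsLimit.mono (isLimitCokleisliUnit G Y (w' Y))
  rw [← cancel_mono (G.map (cokleisliUnit S Y.of)), Category.assoc, Category.assoc, he Y]
  refine (c.naturality ((cokleisliToCoalgebra S).map f)).trans ?_
  rw [← he X]
  refine (Category.assoc _ _ _).trans (congrArg ((e X).hom ≫ ·) ?_)
  exact (G.map_comp _ _).symm.trans
    ((congrArg G.map (comp_cokleisliUnit S f)).trans (G.map_comp _ _))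

end CoalgebraFunctor

/-! ### Linton equalisers and left exact actions on coalgebras -/

section CoalgebraAction

variable {C : Type*} [Category* C] [MonoidalCategory C] {D : Type*} [Category* D]
  [MonoidalLeftAction C D] (S : Comonad D) [OplaxModuleComonad C S]

open Functor.LaxLeftLinear Functor.OplaxLeftLinear Functor.LeftLinear

/-- The functor `X ↦ S (x ▷ X)` from the co-Kleisli category to coalgebras. -/
abbrev cokleisliAct (x : C) : Cokleisli S ⥤ S.Coalgebra :=
  MonoidalLeftAction.actionLeft (Cokleisli S) x ⋙ cokleisliToCoalgebra S

theorem cokleisliAct_map_cokleisliMap (x : C) {X Y : D} (f : X ⟶ Y) :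
    (cokleisliAct S x).map (cokleisliMap S f) = S.cofree.map (x ⊴ₗ f) :=
  (congrArg (cokleisliToCoalgebra S).map (cokleisli_actionHomRight_toCokleisli_map S x f)).trans
    (cokleisliToCoalgebra_map_cokleisliMap S (x ⊴ₗ f))

theorem cokleisliToCoalgebra_map_actionHomLeft {x y : C} (f : x ⟶ y) (X : D) :
    (cokleisliToCoalgebra S).map (f ⊵ₗ Cokleisli.mk S X) = S.cofree.map (f ⊵ₗ X) :=
  cokleisliToCoalgebra_map_cokleisliMap S (f ⊵ₗ X)

/-- Links `x ▷ -` of a leg of the copresentation with the explicit Linton arrow given by the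
comultiplication followed by the oplax structure of `S`. -/
theorem cokleisliAct_map_cokleisliUnit (x : C) (X : D) :
    (cokleisliAct S x).map (cokleisliUnit S X) =
      (cokleisliToCoalgebra S).map (X := .mk S (x ⊙ₗ X)) (Y := .mk S (x ⊙ₗ S.obj X))
        (.mk (δₗ S.toFunctor x X)) := by
  refine congrArg (cokleisliToCoalgebra S).map (Cokleisli.hom_ext _ ?_)
  change δₗ S.toFunctor x X ≫ x ⊴ₗ 𝟙 (S.obj X) = δₗ S.toFunctor x X
  rw [MonoidalLeftAction.actionHomRight_id]
  exact Category.comp_id _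

theorem toCokleisli_comp_cokleisliAct_preservesFiniteLimits (x : C)
    (hx : PreservesFiniteLimits (MonoidalLeftAction.actionLeft D x)) :
    PreservesFiniteLimits (Cokleisli.Adjunction.toCokleisli S ⋙ cokleisliAct S x) := by
  have : PreservesFiniteLimits S.cofree :=
    ⟨fun _ _ _ => have := S.adj.rightAdjoint_preservesLimits; inferInstance⟩
  let e : MonoidalLeftAction.actionLeft D x ⋙ S.cofree ≅
      Cokleisli.Adjunction.toCokleisli S ⋙ cokleisliAct S x :=
    NatIso.ofComponents (fun X => Iso.refl (S.cofree.obj (x ⊙ₗ X))) fun f =>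
      (Category.comp_id _).trans ((cokleisliAct_map_cokleisliMap S x f).symm.trans
        (Category.id_comp _).symm)
  exact ⟨fun _ _ _ => preservesLimitsOfShape_of_natIso e⟩

variable [MonoidalLeftAction C S.Coalgebra] [(cokleisliToCoalgebra S).LeftLinear C]

/-- The canonical morphism `x ▷ m ⟶ x ▷ S m ≅ S (x ▷ m)`. -/
def actionCopresentation (x : C) (m : S.Coalgebra) :
    x ⊙ₗ m ⟶ (cokleisliToCoalgebra S).obj (x ⊙ₗ Cokleisli.mk S m.A) :=
  x ⊴ₗ copresentation S m ≫ μₗ (cokleisliToCoalgebra S) x (.mk S m.A)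

theorem actionCopresentation_naturality_left {x y : C} (f : x ⟶ y) (m : S.Coalgebra) :
    actionCopresentation S x m ≫ (cokleisliToCoalgebra S).map (f ⊵ₗ Cokleisli.mk S m.A) =
      f ⊵ₗ m ≫ actionCopresentation S y m := by
  rw [actionCopresentation, actionCopresentation, Category.assoc, ← μₗ_naturality_left,
    MonoidalLeftAction.action_exchange_assoc]

theorem actionCopresentation_naturality_right (x : C) {m n : S.Coalgebra} (f : m ⟶ n) :
    actionCopresentation S x m ≫ (cokleisliToCoalgebra S).map (x ⊴ₗ cokleisliMap S f.f) =
      x ⊴ₗ f ≫ actionCopresentation S x n := by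
  rw [actionCopresentation, actionCopresentation, Category.assoc, ← μₗ_naturality_right,
    ← MonoidalLeftAction.actionHomRight_comp_assoc, ← MonoidalLeftAction.actionHomRight_comp_assoc,
    copresentation_comp_cokleisliToCoalgebra_map]

theorem actionCopresentation_condition (x : C) (m : S.Coalgebra) :
    actionCopresentation S x m ≫ (cokleisliToCoalgebra S).map (x ⊴ₗ cokleisliMap S m.a) =
      actionCopresentation S x m ≫ (cokleisliToCoalgebra S).map (x ⊴ₗ cokleisliUnit S m.A) := by
  rw [actionCopresentation, Category.assoc, Category.assoc, ← μₗ_naturality_right,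
    ← μₗ_naturality_right, ← MonoidalLeftAction.actionHomRight_comp_assoc,
    ← MonoidalLeftAction.actionHomRight_comp_assoc, copresentation_condition]

/-- The canonical morphisms are Linton equalisers when the action is left exact. -/
theorem nonempty_isLimit_actionCopresentation (x : C)
    (hx : PreservesFiniteLimits (MonoidalLeftAction.actionLeft S.Coalgebra x)) (m : S.Coalgebra) :
    Nonempty (IsLimit (Fork.ofι (actionCopresentation S x m)
      (actionCopresentation_condition S x m))) := by
  obtain ⟨h⟩ := nonempty_isLimit_copresentation S m
  -- A left exact `x ▷ -` preserves the copresentation of `m`; conjugation by the strong structure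
  -- of the co-Kleisli functor gives the Linton equaliser.
  have hc := isLimitForkMapOfIsLimit (MonoidalLeftAction.actionLeft S.Coalgebra x) _ h
  let d (X : Cokleisli S) := δₗ (cokleisliToCoalgebra S) x X
  have w {Z : S.Coalgebra} (t : Z ⟶ (cokleisliToCoalgebra S).obj (x ⊙ₗ Cokleisli.mk S m.A))
      (ht : t ≫ (cokleisliToCoalgebra S).map (x ⊴ₗ cokleisliMap S m.a) =
        t ≫ (cokleisliToCoalgebra S).map (x ⊴ₗ cokleisliUnit S m.A)) :
      (t ≫ d _) ≫ x ⊴ₗ (cokleisliToCoalgebra S).map (cokleisliMap S m.a) =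
        (t ≫ d _) ≫ x ⊴ₗ (cokleisliToCoalgebra S).map (cokleisliUnit S m.A) := by
    have h₁ := δₗ_naturality_right (cokleisliToCoalgebra S) x (cokleisliMap S m.a)
    have h₂ := δₗ_naturality_right (cokleisliToCoalgebra S) x (cokleisliUnit S m.A)
    rw [Category.assoc, Category.assoc, ← h₁, ← h₂, reassoc_of% ht]
  refine ⟨Fork.IsLimit.mk _
    (fun s => Fork.IsLimit.lift hc (s.ι ≫ d (.mk S m.A)) (w s.ι s.condition)) (fun s => ?_)
    (fun s t ht => ?_)⟩
  · have := Fork.IsLimit.lift_ι' hc (s.ι ≫ d (.mk S m.A)) (w s.ι s.condition)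
    refine (Category.assoc _ _ _).symm.trans ((congrArg (· ≫ μₗ _ _ _) this).trans ?_)
    exact (Category.assoc _ _ _).trans ((congrArg (s.ι ≫ ·)
      (δₗ_comp_μₗ (cokleisliToCoalgebra S) x (.mk S m.A))).trans (Category.comp_id _))
  · refine Fork.IsLimit.hom_ext hc ?_
    refine Eq.trans ?_ (Fork.IsLimit.lift_ι' hc _ _).symm
    rw [← ht]
    change _ = (t ≫ _ ≫ μₗ _ _ _) ≫ δₗ _ _ _
    rw [Category.assoc, Category.assoc, μₗ_comp_δₗ, Category.comp_id]
    rfl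

variable {S}

/-- An action whose values are Linton equalisers is left exact. -/
theorem preservesFiniteLimits_actionLeft_of_colinton [PreservesFiniteLimits S.toFunctor]
    [HasFiniteLimits D] [HasEqualizers S.Coalgebra] (x : C)
    (hx : PreservesFiniteLimits (MonoidalLeftAction.actionLeft D x))
    (h : ∀ m, Nonempty (IsLimit (Fork.ofι (actionCopresentation S x m)
      (actionCopresentation_condition S x m)))) :
    PreservesFiniteLimits (MonoidalLeftAction.actionLeft S.Coalgebra x) :=
  preservesFiniteLimits_of_colinton (G := cokleisliAct S x)
    (ι := ⟨fun m => actionCopresentation S x m,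
      fun _ _ f => (actionCopresentation_naturality_right S x f).symm⟩)
    (toCokleisli_comp_cokleisliAct_preservesFiniteLimits S x hx)
    (by ext1; ext1 m; exact actionCopresentation_condition S x m) h

/-- These natural monomorphisms into cofree coalgebras allow identities between action maps to be
tested on the base category. -/
theorem mono_actionCopresentation (x : C)
    (hx : PreservesFiniteLimits (MonoidalLeftAction.actionLeft S.Coalgebra x)) (m : S.Coalgebra) :
    Mono (actionCopresentation S x m) :=
  Fork.IsLimit.mono (nonempty_isLimit_actionCopresentation S x hx m).some

variable {k : Type*} [Field k] [Preadditive C] [Linear k C] [Preadditive D] [Linear k D]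
  [BilinearAction k C D] [S.toFunctor.Additive] [S.toFunctor.Linear k]

variable (k) in
/-- A left exact action on coalgebras which extends the one on the co-Kleisli category is
bilinear. -/
theorem bilinearAction_coalgebra
    (h : ∀ x : C, PreservesFiniteLimits (MonoidalLeftAction.actionLeft S.Coalgebra x)) :
    BilinearAction k C S.Coalgebra where
  add_actionHomLeft {x y} f g m := by
    -- The monomorphism to cancel sits at the target: over `y` for the left variable and over `n`
    -- for the right one.
    have := mono_actionCopresentation y (h y) m
    have e : (cokleisliToCoalgebra S).map ((f + g) ⊵ₗ Cokleisli.mk S m.A) =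
        (cokleisliToCoalgebra S).map (f ⊵ₗ Cokleisli.mk S m.A) +
          (cokleisliToCoalgebra S).map (g ⊵ₗ Cokleisli.mk S m.A) := by
      simp only [cokleisliToCoalgebra_map_actionHomLeft]
      exact (congrArg S.cofree.map (BilinearAction.add_actionHomLeft k f g m.A)).trans
        (Comonad.Coalgebra.Hom.ext S.map_add)
    rw [← cancel_mono (actionCopresentation S y m), Preadditive.add_comp,
      ← actionCopresentation_naturality_left, ← actionCopresentation_naturality_left,
      ← actionCopresentation_naturality_left, ← Preadditive.comp_add, e]
  smul_actionHomLeft {x y} r f m := by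
    have := mono_actionCopresentation y (h y) m
    have e : (cokleisliToCoalgebra S).map ((r • f) ⊵ₗ Cokleisli.mk S m.A) =
        r • (cokleisliToCoalgebra S).map (f ⊵ₗ Cokleisli.mk S m.A) := by
      simp only [cokleisliToCoalgebra_map_actionHomLeft]
      exact (congrArg S.cofree.map (BilinearAction.smul_actionHomLeft r f m.A)).trans
        (Comonad.Coalgebra.Hom.ext (S.map_smul _ _))
    rw [← cancel_mono (actionCopresentation S y m), Linear.smul_comp,
      ← actionCopresentation_naturality_left, ← actionCopresentation_naturality_left,
      ← Linear.comp_smul, e]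
  actionHomRight_add x m n f g := by
    have := mono_actionCopresentation x (h x) n
    have e : (cokleisliToCoalgebra S).map (x ⊴ₗ cokleisliMap S (f + g).f) =
        (cokleisliToCoalgebra S).map (x ⊴ₗ cokleisliMap S f.f) +
          (cokleisliToCoalgebra S).map (x ⊴ₗ cokleisliMap S g.f) := by
      have e (f : m ⟶ n) := cokleisliAct_map_cokleisliMap S x f.f
      refine (e (f + g)).trans (Eq.trans ?_ (congrArg₂ (· + ·) (e f) (e g)).symm)
      exact (congrArg S.cofree.map (BilinearAction.actionHomRight_add k x f.f g.f)).trans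
        (Comonad.Coalgebra.Hom.ext S.map_add)
    rw [← cancel_mono (actionCopresentation S x n), Preadditive.add_comp,
      ← actionCopresentation_naturality_right, ← actionCopresentation_naturality_right,
      ← actionCopresentation_naturality_right, ← Preadditive.comp_add, e]
  actionHomRight_smul x m n r f := by
    have := mono_actionCopresentation x (h x) n
    have e : (cokleisliToCoalgebra S).map (x ⊴ₗ cokleisliMap S (r • f).f) =
        r • (cokleisliToCoalgebra S).map (x ⊴ₗ cokleisliMap S f.f) := by
      have e (f : m ⟶ n) := cokleisliAct_map_cokleisliMap S x f.f
      refine (e (r • f)).trans (Eq.trans ?_ (congrArg (r • ·) (e f)).symm)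
      exact (congrArg S.cofree.map (BilinearAction.actionHomRight_smul x r f.f)).trans
        (Comonad.Coalgebra.Hom.ext (S.map_smul _ _))
    rw [← cancel_mono (actionCopresentation S x n), Linear.smul_comp,
      ← actionCopresentation_naturality_right, ← actionCopresentation_naturality_right,
      ← Linear.comp_smul, e]

/-- A left exact action on coalgebras which extends the one on the co-Kleisli category is given by
Linton equalisers. -/
@[reducible]
def extendedCoactionOfLeftExact
    (h : ∀ x : C, PreservesFiniteLimits (MonoidalLeftAction.actionLeft S.Coalgebra x)) :
    ExtendedCoaction (C := C) k S where
  bilinear := bilinearAction_coalgebra k h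
  condition x m := by
    have := actionCopresentation_condition S x m
    rwa [show (cokleisliToCoalgebra S).map (x ⊴ₗ cokleisliMap S m.a) = _ from
      cokleisliAct_map_cokleisliMap S x m.a,
      show (cokleisliToCoalgebra S).map (x ⊴ₗ cokleisliUnit S m.A) = _
      from cokleisliAct_map_cokleisliUnit S x m.A] at this
  isLimit x m := nonempty_isLimit_fork_congr (cokleisliAct_map_cokleisliMap S x m.a)
    (cokleisliAct_map_cokleisliUnit S x m.A)
    (nonempty_isLimit_actionCopresentation S x (h x) m).some _

end CoalgebraAction

/-! ### Existence and left exactness of extended coactions -/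

section CoalgebraExistence

variable {C : Type*} [Category* C] [MonoidalCategory C] {D : Type*} [Category* D]
  [MonoidalLeftAction C D] (S : Comonad D) [OplaxModuleComonad C S]
  {k : Type*} [Field k] [Preadditive C] [Linear k C] [Preadditive D] [Linear k D]
  [S.toFunctor.Additive] [S.toFunctor.Linear k]

/-- The functors `X ↦ S (x ▷ X)` extend to left exact endofunctors of the coalgebras, which form an
`ActionLift`; left exactness supplies the Linton equalisers. -/
theorem nonempty_extendedCoaction [BilinearAction k C D]
    [PreservesFiniteLimits S.toFunctor] [HasFiniteLimits D]
    [HasEqualizers S.Coalgebra]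
    (h : ∀ x : C, PreservesFiniteLimits (MonoidalLeftAction.actionLeft D x)) :
    Nonempty (ExtendedCoaction (C := C) k S) := by
  choose A hA s using fun x : C =>
    exists_coalgebra_extension (toCokleisli_comp_cokleisliAct_preservesFiniteLimits S x (h x))
  let Λ : ActionLift C (cokleisliToCoalgebra S) (fun G => PreservesFiniteLimits G) :=
    { restricts := cokleisliToCoalgebra_restrictsFullyFaithfully S
      prop_id := inferInstance
      prop_comp := fun _ _ => comp_preservesFiniteLimits _ _
      A := A
      prop := hA
      s := fun x X => (s x).some.app X
      s_naturality := fun x _ _ f => (s x).some.hom.naturality f }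
  let _ := Λ.action
  let _ := Λ.leftLinear
  exact ⟨extendedCoactionOfLeftExact fun x => hA x⟩

variable {S}

/-- The Linton condition presents `x ▷ -` as a pointwise equaliser of left exact functors. -/
theorem ExtendedCoaction.preservesFiniteLimits_actionLeft [PreservesFiniteLimits S.toFunctor]
    [HasFiniteLimits D] [HasEqualizers S.Coalgebra]
    (h : ∀ x : C, PreservesFiniteLimits (MonoidalLeftAction.actionLeft D x))
    (E : ExtendedCoaction (C := C) k S) (x : C) :
    letI := E.action
    PreservesFiniteLimits (MonoidalLeftAction.actionLeft S.Coalgebra x) :=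
  letI := E.action
  letI := E.strong
  preservesFiniteLimits_actionLeft_of_colinton x (h x) fun m =>
    nonempty_isLimit_fork_congr (cokleisliAct_map_cokleisliMap S x m.a).symm
      (cokleisliAct_map_cokleisliUnit S x m.A).symm (E.isLimit x m).some _

end CoalgebraExistence

/-! ### The comparison functor from the co-Kleisli category -/

section CokleisliComparison

variable {C : Type*} [Category* C] [MonoidalCategory C] {D : Type*} [Category* D]
  [MonoidalLeftAction C D] {M : Type*} [Category* M] [MonoidalLeftAction C M]
  {L : M ⥤ D} {G : D ⥤ M} (adj : L ⊣ G)

open Functor.LaxLeftLinear Functor.OplaxLeftLinear Functor.LeftLinear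

/-- The comparison functor from the co-Kleisli category of the comonad of an adjunction. -/
def cokleisliComparison : Cokleisli adj.toComonad ⥤ M where
  obj X := G.obj X.of
  map {X Y} f := adj.unit.app (G.obj X.of) ≫ G.map f.of
  map_id X := adj.right_triangle_components X.of
  map_comp {X Y Z} f g := by
    have h {X Y Z : D} (f : L.obj (G.obj X) ⟶ Y) (g : L.obj (G.obj Y) ⟶ Z) :
        adj.unit.app (G.obj X) ≫ G.map (L.map (adj.unit.app (G.obj X)) ≫ L.map (G.map f) ≫ g) =
          (adj.unit.app (G.obj X) ≫ G.map f) ≫ adj.unit.app (G.obj Y) ≫ G.map g := by simp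
    exact h f.of g.of

theorem cokleisliComparison_map_cokleisliMap {X Y : D} (f : X ⟶ Y) :
    (cokleisliComparison adj).map (cokleisliMap adj.toComonad f) = G.map f := by
  change adj.unit.app (G.obj X) ≫ G.map (adj.counit.app X ≫ f) = G.map f
  simp

/-- The comparison functors commute with the functor from the co-Kleisli category to coalgebras. -/
def cokleisliComparisonCompIso :
    cokleisliComparison adj ⋙ Comonad.comparison adj ≅ cokleisliToCoalgebra adj.toComonad :=
  NatIso.ofComponents (fun X => Iso.refl (adj.toComonad.cofree.obj X.of)) fun {X Y} f => by
    refine (Category.comp_id _).trans (Eq.trans ?_ (Category.id_comp _).symm)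
    apply Comonad.Coalgebra.Hom.ext
    exact L.map_comp _ _

variable [G.LeftLinear C]

/-- The comparison functor from the co-Kleisli category is a strong `C`-module functor. -/
@[reducible]
def cokleisliComparisonLeftLinear :
    letI := adjunctionOplaxComonad (C := C) adj
    (cokleisliComparison adj).LeftLinear C :=
  letI := adjunctionOplaxComonad (C := C) adj
  leftLinearOfIso (F := cokleisliComparison adj)
    { μₗ := fun c X => μₗ G c X.of
      μₗ_naturality_left := fun {c c'} f X => by
        refine (μₗ_naturality_left G f X.of).trans (congrArg (μₗ G c X.of ≫ ·) ?_)
        exact (cokleisliComparison_map_cokleisliMap adj (f ⊵ₗ X.of)).symm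
      μₗ_naturality_right := fun c X Y f => by
        let _ := leftAdjointOplax (C := C) adj
        have h {X Y : D} (f : L.obj (G.obj X) ⟶ Y) :
            c ⊴ₗ (adj.unit.app (G.obj X) ≫ G.map f) ≫ μₗ G c Y =
              μₗ G c X ≫ adj.unit.app (G.obj (c ⊙ₗ X)) ≫
                G.map ((L.map (δₗ G c X) ≫ δₗ L c (G.obj X)) ≫ c ⊴ₗ f) := by
          have key : adj.unit.app (c ⊙ₗ G.obj X) ≫ G.map (δₗ L c (G.obj X)) =
              c ⊴ₗ adj.unit.app (G.obj X) ≫ μₗ G c (L.obj (G.obj X)) :=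
            (adj.homEquiv_unit _ _ _).symm.trans ((adj.homEquiv _ _).apply_symm_apply _)
          have nat : adj.unit.app (G.obj (c ⊙ₗ X)) ≫ G.map (L.map (δₗ G c X)) =
              δₗ G c X ≫ adj.unit.app (c ⊙ₗ G.obj X) := (adj.unit.naturality _).symm
          rw [G.map_comp, G.map_comp, Category.assoc, reassoc_of% nat, μₗ_comp_δₗ_assoc,
            reassoc_of% key, ← μₗ_naturality_right, MonoidalLeftAction.actionHomRight_comp,
            Category.assoc]
        exact h f.of
      μₗ_associativity := fun c c' X => by
        refine Eq.trans (congrArg (μₗ G (c ⊗ c') X.of ≫ ·) ?_) (μₗ_associativity G c c' X.of)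
        exact cokleisliComparison_map_cokleisliMap adj _
      μₗ_unitality := fun X => by
        refine (μₗ_unitality G X.of).trans (congrArg (μₗ G (𝟙_ C) X.of ≫ ·) ?_)
        exact (cokleisliComparison_map_cokleisliMap adj _).symm }
    (fun c X => μₗIso G c X.of) fun _ _ => rfl

/-- A comonadic comparison functor is a strong `C`-module functor for every left exact action on
coalgebras that extends the action on the co-Kleisli category. -/
theorem nonempty_leftLinear_coalgebra_comparison_inverse [(Comonad.comparison adj).IsEquivalence]
    (l : MonoidalLeftAction C adj.toComonad.Coalgebra)
    (s : letI := adjunctionOplaxComonad (C := C) adj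
      (cokleisliToCoalgebra adj.toComonad).LeftLinear C)
    (hl : ∀ x : C, PreservesFiniteLimits
      (MonoidalLeftAction.actionLeft adj.toComonad.Coalgebra x))
    (hM : ∀ x : C, PreservesFiniteLimits (MonoidalLeftAction.actionLeft M x)) :
    Nonempty ((Comonad.comparison adj).asEquivalence.inverse.LeftLinear C) := by
  let Φ := (Comonad.comparison adj).asEquivalence.inverse
  -- The restriction of `Φ` to cofree coalgebras is `cokleisliComparison`, which is already strong.
  let e : cokleisliComparison adj ≅ cokleisliToCoalgebra adj.toComonad ⋙ Φ :=
    (Functor.rightUnitor _).symm ≪≫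
      Functor.isoWhiskerLeft _ (Comonad.comparison adj).asEquivalence.unitIso ≪≫
      (Functor.associator _ _ _).symm ≪≫
      Functor.isoWhiskerRight (cokleisliComparisonCompIso adj) Φ
  let _ := adjunctionOplaxComonad (C := C) adj
  let _ := cokleisliComparisonLeftLinear (C := C) adj
  have hΦ : PreservesFiniteLimits Φ := ⟨fun _ _ _ => inferInstance⟩
  exact exists_leftLinear_of_restrictsFullyFaithfully (cokleisliToCoalgebra adj.toComonad) Φ
    (leftLinearOfNatIso e) (cokleisliToCoalgebra_restrictsFullyFaithfully adj.toComonad) hΦ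
    (fun _ => comp_preservesFiniteLimits _ _) (fun _ => comp_preservesFiniteLimits _ _)
    (fun _ _ => comp_preservesFiniteLimits _ (_ ⋙ Φ))

end CokleisliComparison

/-! ### Comonadicity of exact faithful left adjoints -/

section CoalgebraComparison

variable {D : Type*} [Category* D] [Abelian D] {M : Type*} [Category* M] [Abelian M]
  {L : M ⥤ D} {G : D ⥤ M} (adj : L ⊣ G)

/-- As `L` is faithful, the unit is a monomorphism, hence the kernel of its cokernel. The transpose
of `g` composes to zero with that cokernel, because it does so after `L`, and therefore factors
through the unit. -/
theorem exists_map_eq_of_unit_comp [L.Additive] [L.Faithful] {m n : M} (g : L.obj m ⟶ L.obj n)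
    (hg : L.map (adj.unit.app m ≫ G.map g) = g ≫ L.map (adj.unit.app n)) :
    ∃ f : m ⟶ n, L.map f = g := by
  have w : (adj.unit.app m ≫ G.map g) ≫ cokernel.π (adj.unit.app n) = 0 := by
    apply L.map_injective
    rw [L.map_comp, hg, Category.assoc, ← L.map_comp, cokernel.condition, L.map_zero, L.map_zero,
      comp_zero]
  have := adj.unit_mono_of_L_faithful n
  refine ⟨Abelian.monoLift (adj.unit.app n) _ w, ?_⟩
  have h : L.map (Abelian.monoLift (adj.unit.app n) _ w) ≫ L.map (adj.unit.app n) =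
      g ≫ L.map (adj.unit.app n) := by
    rw [← L.map_comp, Abelian.monoLift_comp, hg]
  simpa using congrArg (· ≫ adj.counit.app (L.obj n)) h

theorem full_coalgebra_comparison [L.Additive] [L.Faithful] : (Comonad.comparison adj).Full where
  map_surjective {m n} g := by
    obtain ⟨f, hf⟩ := exists_map_eq_of_unit_comp adj g.f ((L.map_comp _ _).trans g.h)
    exact ⟨f, Comonad.Coalgebra.Hom.ext hf⟩

omit [Abelian D] [Abelian M] in
theorem comp_map_map_of_comp_eq {A : D} (a : A ⟶ L.obj (G.obj A)) {n : M} (ι : n ⟶ G.obj A)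
    [Mono (L.map (G.map (L.map ι)))] (φ : A ⟶ L.obj n) (hφ : φ ≫ L.map ι = a)
    (ha : a ≫ L.map (G.map a) = a ≫ L.map (adj.unit.app (G.obj A))) :
    a ≫ L.map (G.map φ) = φ ≫ L.map (adj.unit.app n) := by
  have hη : adj.unit.app n ≫ G.map (L.map ι) = ι ≫ adj.unit.app (G.obj A) :=
    adj.unit_naturality ι
  rw [← cancel_mono (L.map (G.map (L.map ι))), Category.assoc, Category.assoc, ← L.map_comp,
    ← G.map_comp, hφ, ha, ← L.map_comp, hη, L.map_comp, reassoc_of% hφ]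

-- The preimage of `A` is the equaliser of `G a` and the unit; `L` preserves it, and Beck's
-- equaliser identifies the result with the carrier of `A`.
omit [Abelian D] in
theorem essSurj_coalgebra_comparison [PreservesFiniteLimits L] :
    (Comonad.comparison adj).EssSurj where
  mem_essImage A := by
    have := Functor.preservesMonomorphisms_of_adjunction adj
    let a : A.A ⟶ L.obj (G.obj A.A) := A.a
    let ι := equalizer.ι (G.map a) (adj.unit.app (G.obj A.A))
    have : Mono ι := equalizer.ι_mono
    have : Mono (L.map (G.map (L.map ι))) := inferInstance
    let h := isLimitOfHasEqualizerOfPreservesLimit L (G.map a) (adj.unit.app (G.obj A.A))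
    let φ := h.conePointUniqueUpToIso (Comonad.beckEqualizer A)
    have hφ : φ.inv ≫ L.map ι = A.a :=
      h.conePointUniqueUpToIso_inv_comp (Comonad.beckEqualizer A) WalkingParallelPair.zero
    exact ⟨_, ⟨(Comonad.Coalgebra.isoMk φ.symm
      (comp_map_map_of_comp_eq adj a ι φ.inv hφ A.coassoc.symm)).symm⟩⟩

theorem isEquivalence_coalgebra_comparison_of_exact [L.Additive] [L.Faithful]
    [PreservesFiniteLimits L] : (Comonad.comparison adj).IsEquivalence where
  full := full_coalgebra_comparison adj
  essSurj := essSurj_coalgebra_comparison adj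

end CoalgebraComparison

/-! ### Injective coalgebras -/

section Cofree

variable {C : Type u} [Category.{v} C] [Abelian C] (S : Comonad C)

theorem hasEqualizers_coalgebra [S.toFunctor.Additive] [PreservesFiniteLimits S.toFunctor] :
    HasEqualizers S.Coalgebra :=
  have := coalgebraAbelian S
  inferInstance

theorem injective_cofree [PreservesFiniteLimits S.toFunctor] {I : C} (hI : Injective I) :
    Injective (S.cofree.obj I) :=
  have : PreservesFiniteLimits S.forget := ⟨fun _ _ _ => inferInstance⟩
  S.adj.map_injective I hI

-- The structure map of `m` is an equaliser, hence a monomorphism, and the cofree functor preserves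
-- monomorphisms because it is a right adjoint.
omit [Abelian C] in
theorem exists_injective_mono_cofree [EnoughInjectives C] (m : S.Coalgebra) :
    ∃ (I : C) (f : m ⟶ S.cofree.obj I), Injective I ∧ Mono f := by
  have := Functor.preservesMonomorphisms_of_adjunction S.adj
  have : Mono (coalgebraUnit m) := Fork.IsLimit.mono (Comonad.beckCoalgebraEqualizer m)
  exact ⟨Injective.under m.A, coalgebraUnit m ≫ S.cofree.map (Injective.ι m.A), inferInstance,
    mono_comp _ _⟩

theorem enoughInjectives_coalgebra [PreservesFiniteLimits S.toFunctor] [EnoughInjectives C] :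
    EnoughInjectives S.Coalgebra where
  presentation m := by
    obtain ⟨I, f, hI, hf⟩ := exists_injective_mono_cofree S m
    exact ⟨{ J := S.cofree.obj I, injective := injective_cofree S hI, f := f, mono := hf }⟩

end Cofree

/-! ### Injective pairs and left exact oplax module comonads -/

section Bundled

variable {k : Type*} [Field k] {C : Type u} [Category.{v} C] [Abelian C] [Linear k C]
  [MonoidalCategory C]

theorem LeftExactOplaxComonad.nonempty_extension [MonoidalPreadditive C] [MonoidalLinear k C]
    (h : ∀ x : C, PreservesFiniteLimits (tensorLeft x)) (S : LeftExactOplaxComonad k C) :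
    Nonempty S.Extension :=
  have := hasEqualizers_coalgebra S.comonad
  nonempty_extendedCoaction S.comonad h

theorem LeftExactOplaxComonad.preservesFiniteLimits_actionLeft
    (h : ∀ x : C, PreservesFiniteLimits (tensorLeft x)) (S : LeftExactOplaxComonad k C)
    (E : S.Extension) (x : C) :
    letI := E.action
    PreservesFiniteLimits (MonoidalLeftAction.actionLeft S.comonad.Coalgebra x) :=
  have := hasEqualizers_coalgebra S.comonad
  E.preservesFiniteLimits_actionLeft h x

/-- Any two extended actions give equivalent `C`-module categories. -/
theorem LeftExactOplaxComonad.coalgebras_equivalent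
    (h : ∀ x : C, PreservesFiniteLimits (tensorLeft x)) (S : LeftExactOplaxComonad k C)
    (E E' : S.Extension) : (S.coalgebras E).Equivalent (S.coalgebras E') := by
  have hE := S.preservesFiniteLimits_actionLeft h E
  have hE' := S.preservesFiniteLimits_actionLeft h E'
  refine ⟨CategoryTheory.Equivalence.refl, inferInstanceAs (𝟭 (S.coalgebras E).carrier).Additive,
    inferInstanceAs ((𝟭 (S.coalgebras E).carrier).Linear k), ?_⟩
  exact @exists_leftLinear_of_restrictsFullyFaithfully C _ _ (Cokleisli S.comonad) _ _
    S.comonad.Coalgebra _ E.action S.comonad.Coalgebra _ E'.action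
    (cokleisliToCoalgebra S.comonad) (𝟭 _)
    E.strong E'.strong _ (cokleisliToCoalgebra_restrictsFullyFaithfully S.comonad)
    (inferInstanceAs (PreservesFiniteLimits (𝟭 S.comonad.Coalgebra))) hE' hE
    (fun x y => let _ := E.action; comp_preservesFiniteLimits
      (MonoidalLeftAction.actionLeft S.comonad.Coalgebra y)
      (MonoidalLeftAction.actionLeft S.comonad.Coalgebra x))

/-- The cofree coalgebra on the unit object represents the cofree coalgebra functor. -/
def cofreeIsoActionRight (S : Comonad C) [OplaxModuleComonad C S]
    [MonoidalLeftAction C S.Coalgebra] [(cokleisliToCoalgebra S).LeftLinear C] :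
    S.cofree ≅ MonoidalLeftAction.actionRight C (S.cofree.obj (𝟙_ C)) :=
  NatIso.ofComponents (fun x => S.cofree.mapIso (ρ_ x).symm ≪≫
    (Functor.LeftLinear.μₗIso (cokleisliToCoalgebra S) x (.mk S (𝟙_ C))).symm) fun {x y} f => by
      have h := Functor.OplaxLeftLinear.δₗ_naturality_left (cokleisliToCoalgebra S) f
        (.mk S (𝟙_ C))
      have e : (cokleisliToCoalgebra S).map (f ⊵ₗ Cokleisli.mk S (𝟙_ C)) =
          S.cofree.map (f ▷ 𝟙_ C) :=
        cokleisliToCoalgebra_map_actionHomLeft S f (𝟙_ C)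
      have e' : S.cofree.map f ≫ S.cofree.map (ρ_ y).inv =
          S.cofree.map (ρ_ x).inv ≫ S.cofree.map (f ▷ 𝟙_ C) := by
        rw [← S.cofree.map_comp, ← S.cofree.map_comp, rightUnitor_inv_naturality]
      refine (Category.assoc _ _ _).symm.trans ((congrArg (· ≫ _) e').trans ?_)
      refine (Category.assoc _ _ _).trans (Eq.trans ?_ (Category.assoc _ _ _).symm)
      rw [← e]
      exact congrArg (S.cofree.map (ρ_ x).inv ≫ ·) h

/-- By `cofreeIsoActionRight`, acting on `S 1` is the cofree functor: its left adjoint is forgetful,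
it preserves injectives, and every injective coalgebra splits off from a cofree one on an injective.
-/
theorem LeftExactOplaxComonad.isInjectivePair [EnoughInjectives C]
    (h : ∀ x : C, PreservesFiniteLimits (tensorLeft x)) (S : LeftExactOplaxComonad k C)
    (E : S.Extension) :
    ModCat.IsInjectivePair (M := S.coalgebras E) (S.comonad.cofree.obj (𝟙_ C)) := by
  let _ := E.action
  let _ := E.strong
  let e := cofreeIsoActionRight S.comonad
  have hI (I : C) (hI : Injective I) :
      Injective ((MonoidalLeftAction.actionRight C (S.comonad.cofree.obj (𝟙_ C))).obj I) :=
    Injective.of_iso (e.app I) (injective_cofree S.comonad hI)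
  exact
    { enoughInjectives := enoughInjectives_coalgebra S.comonad
      isLeftExact := S.preservesFiniteLimits_actionLeft h E
      isCoclosed := ⟨_, ⟨S.comonad.adj.ofNatIsoRight e⟩⟩
      isCInjective := hI
      isCCogenerator := fun Q hQ => by
        obtain ⟨I, f, hI, hf⟩ := exists_injective_mono_cofree S.comonad Q
        let r : Retract Q (S.comonad.cofree.obj I) :=
          { i := f
            r := @Injective.factorThru S.comonad.Coalgebra _ _ _ _ hQ (𝟙 Q) f hf
            retract := @Injective.comp_factorThru S.comonad.Coalgebra _ _ _ _ hQ (𝟙 Q) f hf }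
        exact ⟨I, hI, ⟨r.trans (.ofIso (e.app I))⟩⟩ }

namespace ModCat.IsInjectivePair

variable {M : ModCat.{w₂, w₁} k C} {ℓ : M.carrier} (h : IsInjectivePair ℓ)
  {L : M.carrier ⥤ C} (adj : L ⊣ MonoidalLeftAction.actionRight C ℓ)
include h adj

/-- The left adjoint of `- ▷ ℓ` is exact. -/
theorem preservesFiniteLimits_leftAdjoint [EnoughInjectives C] :
    PreservesFiniteLimits L := by
  have : (MonoidalLeftAction.actionRight C ℓ).PreservesInjectiveObjects :=
    ⟨fun {I} hI => h.isCInjective I hI⟩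
  -- Monomorphisms in `C` are detected by extending maps to injectives `I`; these problems transpose
  -- to the injective `I ▷ ℓ`. With right exactness this gives exactness.
  have := Functor.preservesMonomorphisms_of_adjunction_of_preservesInjectiveObjects adj
  have := adj.left_adjoint_additive
  have := adj.leftAdjoint_preservesColimits
  have := L.preservesHomology_of_preservesMonos_and_cokernels
  exact L.preservesFiniteLimits_of_preservesHomology

/-- An injective containing `m` is a summand of some `I ▷ ℓ`, and morphisms from `n` into `I ▷ ℓ`
correspond to morphisms `L n ⟶ I`. -/
theorem faithful_leftAdjoint : L.Faithful where
  map_injective {n m f g} hfg := by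
    have := h.enoughInjectives
    obtain ⟨I, -, ⟨r⟩⟩ := h.isCCogenerator (Injective.under m) inferInstance
    have e (f : n ⟶ m) : (adj.homEquiv _ _).symm (f ≫ Injective.ι m ≫ r.i) =
        L.map f ≫ (adj.homEquiv _ _).symm (Injective.ι m ≫ r.i) :=
      adj.homEquiv_naturality_left_symm _ _
    have e' : f ≫ Injective.ι m ≫ r.i = g ≫ Injective.ι m ≫ r.i :=
      (adj.homEquiv _ _).symm.injective ((e f).trans ((congrArg (· ≫ _) hfg).trans (e g).symm))
    rw [← cancel_mono (Injective.ι m)]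
    simpa using congrArg (· ≫ r.r) e'

theorem isEquivalence_comparison [EnoughInjectives C] :
    (Comonad.comparison adj).IsEquivalence := by
  have := h.preservesFiniteLimits_leftAdjoint adj
  have := h.faithful_leftAdjoint adj
  have := adj.left_adjoint_additive
  exact isEquivalence_coalgebra_comparison_of_exact adj

theorem preservesFiniteLimits_comp [EnoughInjectives C] :
    PreservesFiniteLimits (MonoidalLeftAction.actionRight C ℓ ⋙ L) := by
  have := h.preservesFiniteLimits_leftAdjoint adj
  have := adj.rightAdjoint_preservesLimits
  have : PreservesFiniteLimits (MonoidalLeftAction.actionRight C ℓ) :=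
    ⟨fun _ _ _ => inferInstance⟩
  exact comp_preservesFiniteLimits _ _

theorem equivalent_coalgebras [EnoughInjectives C]
    (hC : ∀ x : C, PreservesFiniteLimits (tensorLeft x))
    (hL : PreservesFiniteLimits (MonoidalLeftAction.actionRight C ℓ ⋙ L))
    (E : (internalCohomComonad adj hL).Extension) :
    M.Equivalent ((internalCohomComonad adj hL).coalgebras E) := by
  have := h.isEquivalence_comparison adj
  have := adj.left_adjoint_additive
  have : L.Linear k := left_adjoint_linear adj
  let e : M.carrier ≌ ((internalCohomComonad adj hL).coalgebras E).carrier :=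
    (Comonad.comparison adj).asEquivalence
  have h₁ : e.functor.Additive := ⟨Comonad.Coalgebra.Hom.ext L.map_add⟩
  have h₂ : e.functor.Linear k := ⟨fun f r => Comonad.Coalgebra.Hom.ext (L.map_smul r f)⟩
  refine Equivalent.symm ⟨e.symm, inferInstanceAs e.inverse.Additive,
    inferInstanceAs (e.inverse.Linear k), ?_⟩
  exact nonempty_leftLinear_coalgebra_comparison_inverse adj E.action E.strong
    ((internalCohomComonad adj hL).preservesFiniteLimits_actionLeft hC E) h.isLeftExact

end ModCat.IsInjectivePair

end Bundled

/-! ### The bijections between classes -/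

/-- Maps which are mutually inverse up to equivalence relations induce mutually inverse bijections
of the quotients. -/
def quotientEquivOfInverse {α β : Type*} (s : Setoid α) (t : Setoid β) (f : α → β) (g : β → α)
    (hf : ∀ a b, s a b → t (f a) (f b)) (hg : ∀ a b, t a b → s (g a) (g b))
    (hgf : ∀ a, s (g (f a)) a) (hfg : ∀ b, t (f (g b)) b) : Quotient s ≃ Quotient t where
  toFun := Quotient.map f (fun _ _ => hf _ _)
  invFun := Quotient.map g (fun _ _ => hg _ _)
  left_inv := by
    rintro ⟨a⟩
    exact Quotient.sound (hgf a)
  right_inv := by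
    rintro ⟨b⟩
    exact Quotient.sound (hfg b)

section Correspondence

variable {k : Type*} [Field k] {C : Type u} [Category.{v} C] [Abelian C] [Linear k C]
  [MonoidalCategory C]

theorem ProjectivePair.equivalence_rel : _root_.Equivalence (ProjectivePair.Rel (k := k) (C := C)) :=
  ⟨fun p => ModCat.Equivalent.refl p.cat, ModCat.Equivalent.symm, ModCat.Equivalent.trans⟩

theorem InjectivePair.equivalence_rel : _root_.Equivalence (InjectivePair.Rel (k := k) (C := C)) :=
  ⟨fun p => ModCat.Equivalent.refl p.cat, ModCat.Equivalent.symm, ModCat.Equivalent.trans⟩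

variable [MonoidalPreadditive C] [MonoidalLinear k C]

/-- The relation only asks for some extended actions. Reflexivity therefore needs their existence,
and transitivity needs that two of them on the middle monad give equivalent module categories. -/
theorem RightExactLaxMonad.equivalence_rel
    (hC : ∀ x : C, PreservesFiniteColimits (tensorLeft x)) :
    _root_.Equivalence (RightExactLaxMonad.Rel (k := k) (C := C)) where
  refl T := by
    obtain ⟨E⟩ := T.nonempty_extension hC
    exact ⟨E, E, .refl _⟩
  symm := fun ⟨E, F, h⟩ => ⟨F, E, h.symm⟩
  trans := fun {_ S _} ⟨E, F, h⟩ ⟨E', F', h'⟩ =>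
    ⟨E, F', h.trans ((S.algebras_equivalent hC F E').trans h')⟩

theorem LeftExactOplaxComonad.equivalence_rel
    (hC : ∀ x : C, PreservesFiniteLimits (tensorLeft x)) :
    _root_.Equivalence (LeftExactOplaxComonad.Rel (k := k) (C := C)) where
  refl S := by
    obtain ⟨E⟩ := S.nonempty_extension hC
    exact ⟨E, E, .refl _⟩
  symm := fun ⟨E, F, h⟩ => ⟨F, E, h.symm⟩
  trans := fun {_ S _} ⟨E, F, h⟩ ⟨E', F', h'⟩ =>
    ⟨E, F', h.trans ((S.coalgebras_equivalent hC F E').trans h')⟩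

/-- The maps of representatives depend on a chosen right adjoint and a chosen extended action. On
classes the choices disappear, by the reconstruction equivalence and by `algebras_equivalent`, so
the formulas hold for every choice. -/
theorem exists_projectivePair_equiv_rightExactLaxMonad [EnoughProjectives C]
    (hC : ∀ x : C, PreservesFiniteColimits (tensorLeft x)) :
    ∃ (h₁ : _root_.Equivalence (ProjectivePair.Rel (k := k) (C := C)))
      (h₂ : _root_.Equivalence (RightExactLaxMonad.Rel (k := k) (C := C)))
      (e : Quotient ⟨_, h₁⟩ ≃ Quotient ⟨_, h₂⟩),
      (∀ (p : ProjectivePair k C) (R : p.cat.carrier ⥤ C)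
        (adj : MonoidalLeftAction.actionRight C p.gen ⊣ R),
        ∃ h : PreservesFiniteColimits (MonoidalLeftAction.actionRight C p.gen ⋙ R),
          e (Quotient.mk ⟨_, h₁⟩ p) = Quotient.mk ⟨_, h₂⟩ (internalHomMonad adj h)) ∧
      (∀ (T : RightExactLaxMonad k C) (E : T.Extension),
        ∃ h : ModCat.IsProjectivePair (M := T.algebras E) (T.monad.free.obj (𝟙_ C)),
          e.symm (Quotient.mk ⟨_, h₂⟩ T) =
            Quotient.mk ⟨_, h₁⟩ ⟨T.algebras E, T.monad.free.obj (𝟙_ C), h⟩) := by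
  let E (T : RightExactLaxMonad k C) := (T.nonempty_extension hC).some
  let f (p : ProjectivePair k C) : RightExactLaxMonad k C :=
    have : (MonoidalLeftAction.actionRight C p.gen).IsLeftAdjoint := p.prop.isClosed
    let adj := Adjunction.ofIsLeftAdjoint (MonoidalLeftAction.actionRight C p.gen)
    internalHomMonad adj (p.prop.preservesFiniteColimits_comp adj)
  let g (T : RightExactLaxMonad k C) : ProjectivePair k C :=
    ⟨T.algebras (E T), T.monad.free.obj (𝟙_ C), T.isProjectivePair hC (E T)⟩
  have hf (p : ProjectivePair k C) (F : (f p).Extension) : p.cat.Equivalent ((f p).algebras F) :=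
    p.prop.equivalent_algebras _ hC _ F
  -- Reconstruction of the pair `(C^T, T 1)` is exactly the required relation, since monads are
  -- compared through their module categories of algebras.
  have hfg (T : RightExactLaxMonad k C) : RightExactLaxMonad.Rel (f (g T)) T :=
    ⟨E _, E T, (hf (g T) (E _)).symm⟩
  refine ⟨ProjectivePair.equivalence_rel, RightExactLaxMonad.equivalence_rel hC,
    quotientEquivOfInverse _ _ f g (fun p q h => ?_) (fun T S ⟨F, F', h⟩ => ?_)
      (fun p => (hf p (E _)).symm) hfg, fun p R adj => ?_, fun T F => ?_⟩
  · exact ⟨E _, E _, (hf p (E _)).symm.trans (ModCat.Equivalent.trans h (hf q (E _)))⟩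
  · exact (T.algebras_equivalent hC (E T) F).trans (h.trans (S.algebras_equivalent hC F' (E S)))
  · have h := p.prop.preservesFiniteColimits_comp adj
    exact ⟨h, Quotient.sound ⟨E _, E _, (hf p (E _)).symm.trans
      (p.prop.equivalent_algebras adj hC h (E _))⟩⟩
  · exact ⟨T.isProjectivePair hC F, Quotient.sound (T.algebras_equivalent hC (E T) F)⟩

theorem exists_injectivePair_equiv_leftExactOplaxComonad [EnoughInjectives C]
    (hC : ∀ x : C, PreservesFiniteLimits (tensorLeft x)) :
    ∃ (h₁ : _root_.Equivalence (InjectivePair.Rel (k := k) (C := C)))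
      (h₂ : _root_.Equivalence (LeftExactOplaxComonad.Rel (k := k) (C := C)))
      (e : Quotient ⟨_, h₁⟩ ≃ Quotient ⟨_, h₂⟩),
      (∀ (p : InjectivePair k C) (L : p.cat.carrier ⥤ C)
        (adj : L ⊣ MonoidalLeftAction.actionRight C p.cogen),
        ∃ h : PreservesFiniteLimits (MonoidalLeftAction.actionRight C p.cogen ⋙ L),
          e (Quotient.mk ⟨_, h₁⟩ p) = Quotient.mk ⟨_, h₂⟩ (internalCohomComonad adj h)) ∧
      (∀ (S : LeftExactOplaxComonad k C) (E : S.Extension),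
        ∃ h : ModCat.IsInjectivePair (M := S.coalgebras E) (S.comonad.cofree.obj (𝟙_ C)),
          e.symm (Quotient.mk ⟨_, h₂⟩ S) =
            Quotient.mk ⟨_, h₁⟩ ⟨S.coalgebras E, S.comonad.cofree.obj (𝟙_ C), h⟩) := by
  let E (S : LeftExactOplaxComonad k C) := (S.nonempty_extension hC).some
  let f (p : InjectivePair k C) : LeftExactOplaxComonad k C :=
    have : (MonoidalLeftAction.actionRight C p.cogen).IsRightAdjoint := p.prop.isCoclosed
    let adj := Adjunction.ofIsRightAdjoint (MonoidalLeftAction.actionRight C p.cogen)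
    internalCohomComonad adj (p.prop.preservesFiniteLimits_comp adj)
  let g (S : LeftExactOplaxComonad k C) : InjectivePair k C :=
    ⟨S.coalgebras (E S), S.comonad.cofree.obj (𝟙_ C), S.isInjectivePair hC (E S)⟩
  have hf (p : InjectivePair k C) (F : (f p).Extension) : p.cat.Equivalent ((f p).coalgebras F) :=
    p.prop.equivalent_coalgebras _ hC _ F
  -- Again this is reconstruction, now of the pair `(C^S, S 1)`.
  have hfg (S : LeftExactOplaxComonad k C) : LeftExactOplaxComonad.Rel (f (g S)) S :=
    ⟨E _, E S, (hf (g S) (E _)).symm⟩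
  refine ⟨InjectivePair.equivalence_rel, LeftExactOplaxComonad.equivalence_rel hC,
    quotientEquivOfInverse _ _ f g (fun p q h => ?_) (fun S S' ⟨F, F', h⟩ => ?_)
      (fun p => (hf p (E _)).symm) hfg, fun p L adj => ?_, fun S F => ?_⟩
  · exact ⟨E _, E _, (hf p (E _)).symm.trans (ModCat.Equivalent.trans h (hf q (E _)))⟩
  · exact (S.coalgebras_equivalent hC (E S) F).trans
      (h.trans (S'.coalgebras_equivalent hC F' (E S')))
  · have h := p.prop.preservesFiniteLimits_comp adj
    exact ⟨h, Quotient.sound ⟨E _, E _, (hf p (E _)).symm.trans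
      (p.prop.equivalent_coalgebras adj hC h (E _))⟩⟩
  · exact ⟨S.isInjectivePair hC F, Quotient.sound (S.coalgebras_equivalent hC (E S) F)⟩

end Correspondence

end ModuleReconstruction

theorem mainTheorem10 {k : Type*} [Field k] {C : Type u} [Category.{v} C] [Abelian C] [Linear k C]
    [MonoidalCategory C] [MonoidalPreadditive C] [MonoidalLinear k C] :
    -- Part 1: projective objects, right exact lax module monads and their algebras.
    (EnoughProjectives C → (∀ x : C, PreservesFiniteColimits (tensorLeft x)) →
      -- Reconstruction of `M` from `ℓ`.
      (∀ (M : ModCat.{w₂, w₁} k C) (ℓ : M.carrier), ModCat.IsProjectivePair ℓ →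
        ∀ (R : M.carrier ⥤ C) (adj : MonoidalLeftAction.actionRight C ℓ ⊣ R),
          ∃ h : PreservesFiniteColimits (MonoidalLeftAction.actionRight C ℓ ⋙ R),
            Nonempty (internalHomMonad adj h).Extension ∧
            ∀ E : (internalHomMonad adj h).Extension,
              M.Equivalent ((internalHomMonad adj h).algebras E)) ∧
      -- The algebra `T 1` in the category of algebras of `T`.
      (∀ T : RightExactLaxMonad k C,
        Nonempty T.Extension ∧
        ∀ E : T.Extension,
          ModCat.IsProjectivePair (M := T.algebras E) (T.monad.free.obj (𝟙_ C))) ∧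
      -- The bijection.
      (∃ (h₁ : _root_.Equivalence (ProjectivePair.Rel (k := k) (C := C)))
        (h₂ : _root_.Equivalence (RightExactLaxMonad.Rel (k := k) (C := C)))
        (e : Quotient ⟨_, h₁⟩ ≃ Quotient ⟨_, h₂⟩),
        (∀ (p : ProjectivePair k C) (R : p.cat.carrier ⥤ C)
          (adj : MonoidalLeftAction.actionRight C p.gen ⊣ R),
          ∃ h : PreservesFiniteColimits (MonoidalLeftAction.actionRight C p.gen ⋙ R),
            e (Quotient.mk ⟨_, h₁⟩ p) = Quotient.mk ⟨_, h₂⟩ (internalHomMonad adj h)) ∧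
        (∀ (T : RightExactLaxMonad k C) (E : T.Extension),
          ∃ h : ModCat.IsProjectivePair (M := T.algebras E) (T.monad.free.obj (𝟙_ C)),
            e.symm (Quotient.mk ⟨_, h₂⟩ T) =
              Quotient.mk ⟨_, h₁⟩ ⟨T.algebras E, T.monad.free.obj (𝟙_ C), h⟩))) ∧
    -- Part 2: injective objects, left exact oplax module comonads and their coalgebras.
    (EnoughInjectives C → (∀ x : C, PreservesFiniteLimits (tensorLeft x)) →
      -- Reconstruction of `M` from `ℓ`.
      (∀ (M : ModCat.{w₂, w₁} k C) (ℓ : M.carrier), ModCat.IsInjectivePair ℓ →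
        ∀ (L : M.carrier ⥤ C) (adj : L ⊣ MonoidalLeftAction.actionRight C ℓ),
          ∃ h : PreservesFiniteLimits (MonoidalLeftAction.actionRight C ℓ ⋙ L),
            Nonempty (internalCohomComonad adj h).Extension ∧
            ∀ E : (internalCohomComonad adj h).Extension,
              M.Equivalent ((internalCohomComonad adj h).coalgebras E)) ∧
      -- The coalgebra `S 1` in the category of coalgebras of `S`.
      (∀ S : LeftExactOplaxComonad k C,
        Nonempty S.Extension ∧
        ∀ E : S.Extension,
          ModCat.IsInjectivePair (M := S.coalgebras E) (S.comonad.cofree.obj (𝟙_ C))) ∧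
      -- The bijection.
      (∃ (h₁ : _root_.Equivalence (InjectivePair.Rel (k := k) (C := C)))
        (h₂ : _root_.Equivalence (LeftExactOplaxComonad.Rel (k := k) (C := C)))
        (e : Quotient ⟨_, h₁⟩ ≃ Quotient ⟨_, h₂⟩),
        (∀ (p : InjectivePair k C) (L : p.cat.carrier ⥤ C)
          (adj : L ⊣ MonoidalLeftAction.actionRight C p.cogen),
          ∃ h : PreservesFiniteLimits (MonoidalLeftAction.actionRight C p.cogen ⋙ L),
            e (Quotient.mk ⟨_, h₁⟩ p) = Quotient.mk ⟨_, h₂⟩ (internalCohomComonad adj h)) ∧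
        (∀ (S : LeftExactOplaxComonad k C) (E : S.Extension),
          ∃ h : ModCat.IsInjectivePair (M := S.coalgebras E) (S.comonad.cofree.obj (𝟙_ C)),
            e.symm (Quotient.mk ⟨_, h₂⟩ S) =
              Quotient.mk ⟨_, h₁⟩ ⟨S.coalgebras E, S.comonad.cofree.obj (𝟙_ C), h⟩))) := by
  refine ⟨fun _ hC => ⟨fun M ℓ h R adj => ?_, fun T => ?_, ?_⟩,
    fun _ hC => ⟨fun M ℓ h L adj => ?_, fun S => ?_, ?_⟩⟩
  · have hR := h.preservesFiniteColimits_comp adj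
    exact ⟨hR, (internalHomMonad adj hR).nonempty_extension hC, h.equivalent_algebras adj hC hR⟩
  · exact ⟨T.nonempty_extension hC, T.isProjectivePair hC⟩
  · exact exists_projectivePair_equiv_rightExactLaxMonad hC
  · have hL := h.preservesFiniteLimits_comp adj
    exact ⟨hL, (internalCohomComonad adj hL).nonempty_extension hC,
      h.equivalent_coalgebras adj hC hL⟩
  · exact ⟨S.nonempty_extension hC, S.isInjectivePair hC⟩
  · exact exists_injectivePair_equiv_leftExactOplaxComonad hC
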